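/- **Conventions.** A graph has vertices $V$ and directed edges $e$ from $i(e)$ to $f(e)$; $G^{op}$ has all edges reversed. Let $P_G(n;v,w)$ be the set of paths of length $n$ from $v$ to $w$. A *Pascal $(G,v_0)$-array* is a family of sets $Y(n;v)$ ($n\in\mathbb N=\{0,1,\dots\}$, $v\in V$) such that $Y(0;v)$ is in bijection with $P_G(0;v_0,v)$ for all $v$, together with injective edge maps $\phi_e:Y(n;i(e))\to Y(n+1;f(e))$ such that $Y(n+1;v)=\bigsqcup_{f(e)=v}\phi_e(Y(n;i(e)))$ for all $n,v$. It *underlies* a sequence of sets $\mathcal C(n)$ via maps $\Phi_n$, with second array $Y'$, if $Y'$ is a Pascal $(G^{op},v_0)$-array and $\Phi_n$ is a bijection from $\mathcal C(n)$ onto $\bigsqcup_v Y(n;v)\times Y'(n;v)$ for every $n\ge 0$. The graph $A_\infty$ has vertices $0,1,2,\dots$ and edges in both directions between $i$ and $i+1$. **Clusters.** Let $\alpha_1,\dots,\alpha_m$ be the simple roots and $s_1,\dots,s_m$ the simple reflections of type $A_m$, write $[i,j]=\alpha_i+\cdots+\alpha_j$, and let $\Phi_{\ge-1}$ consist of the positive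 roots $[i,j]$ ($1\le i\le j\le m$) and the negative simple roots $-\alpha_i$. Let $\sigma_i(\alpha)=-\alpha$ if $\alpha=\pm\alpha_i$, $\sigma_i(\alpha)=\alpha$ if $\alpha=-\alpha_j$ with $j\ne i$, and $\sigma_i(\alpha)=s_i(\alpha)$ otherwise. The relations $\|_c$ on $\Phi_{\ge -1}$, for $c$ a Coxeter element, are determined on pairs of distinct roots by: (I) for positive $\alpha$, $-\alpha_i\,\|_c\,\alpha$ if and only if $\alpha_i$ does not occur in $\alpha$; (II) for any initial letter $s=s_i$ of $c$, $\alpha\,\|_c\,\beta$ if and only if $\sigma_i(\alpha)\,\|_{scs}\,\sigma_i(\beta)$. A *cluster* of type $A_m$ is a maximal subset of $\Phi_{\ge-1}$ of pairwise $c$-compatible roots, for $c=s_ms_{m-1}\cdots s_1$. Let $\mathcal C_c(n)$ be the set of clusters of type $A_{n-1}$. (For $m\le 0$ the empty set is the only cluster of type $A_m$.) **Tagged clusters.** In a tagged cluster each negative root of the cluster may or may not carry a *root tag* (written $-\overline{\alpha_i}$ if it does), and there may be one additional *global tag* $+$. For odd $n$ put $r=(n-1)/2$; for even $n\ge 2$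 put $r=n/2-1$; for $n=0$ put $r=0$. If $n,l$ are odd, $Y_c(n;l)$ is the set of tagged clusters of type $A_r$ with $(l-1)/2$ root tags and no global tag. If $n\ge2$ and $l$ are even, $Y_c(n;l)$ is the set of tagged clusters of type $A_r$ with $l/2$ tags in total (one of which can be the global tag). $Y_c(0;0)$ consists of the empty cluster without tags, $Y_c(0;l)=\emptyset$ for $l>0$, and $Y_c(n;l)=\emptyset$ if $n-l$ is odd. **Edge maps.** For a set $S$ of (possibly tagged) roots let $L_S(i)=j+1$ with $1\le j<i$ maximal such that $-\alpha_j\in S$, and $L_S(i)=1$ if there is no such $j$. The map $\phi_c^+:Y_c(n;l)\to Y_c(n+1;l+1)$ adds a global tag if $n$ is odd; if $n\ge2$ is even it adds the root $-\alpha_{n/2}$, which is tagged if there was a global tag (the global tag is then removed); on $Y_c(0;0)$ it is the unique map. For $l\ge1$ the map $\phi_c^-:Y_c(n;l)\to Y_c(n+1;l-1)$ is the identity if $n$ is odd. If $n$ is even and $C$ has a global tag, it adds the root $[L_C(r+1),r+1]$ and removes the global tag. If $n$ is even and $C$ has no global tag, let $k$ be maximal with $-\overline{\alpha_k}\in C$;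 then every root $-\alpha_i\in C$ with $i\ge k$ (tagged or not) is replaced by $[i+1,r+1]$, and $[L_C(k),r+1]$ is added. **Bra-ket extraction.** Let $X\in\mathcal C_c(n)$. For $r+1\le k\le n-1$ let $I_k=\{i:1\le i\le k,\ [i,k]\in X\}$, $Y_k=\{[i,k]:i\in I_k\}$, and $X_k=\{[i,k]:i\in I_k,\ i\le b_k\}$, where $b_k=r+1$ if $n$ is odd or $k=r+1$, and $b_k=r+2$ otherwise. For each such $k$, do the following simultaneously. If $n$ is even, and either $k>r+1$ and $I_k\subseteq[r+2,n-1]$, or $k=r+1$ and $I_k=\{r+1\}$, leave $Y_k$ alone. Otherwise: if $|X_k|=1$, replace the root in $X_k$ by $[t+1,k]$, where $t<k$ is maximal with $|X_t|>1$ and $t\ge r+1$ ($n$ odd) or $t\ge r+2$ ($n$ even), and if there is no such $t$, then $t=r$ if $n$ is odd or $k=r+1$ and $t=r+1$ otherwise; if $|X_k|>1$, replace the roots in $Y_k$ by $-\alpha_k$ and the roots $-\alpha_{i-1}$ for all $i\in I_k$ other than its minimum, and tag $-\alpha_k$ and $-\alpha_{j-1}$, where $j$ is the second smallest element of $I_k$.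 Let $X'$ be the resulting set with its tags. Let $C$ be the set of elements of $X'$ that involve only $\alpha_1,\dots,\alpha_r$, and let $D$ be the image, under the linear map $\alpha_i\mapsto\alpha_{n-i}$, of the set of elements of $X'$ that involve only $\alpha_{r+1},\dots,\alpha_{n-1}$ ($n$ odd) or only $\alpha_{r+2},\dots,\alpha_{n-1}$ ($n$ even); root tags are kept. If $n$ is even, add a global tag to both $C$ and $D$ if $\alpha_{r+1}\in X'$; to neither if $X'$ contains the untagged root $-\alpha_{r+1}$; and, if $X'$ contains $-\overline{\alpha_{r+1}}$, to the one of $C,D$ which has fewer root tags (to neither if their numbers are equal). Put $\Phi_n(X)=(C,D)$. **Theorem.** The array $Y_c(n;l)$ of tagged clusters, with the edge maps $\phi_c^+$ (for the edges $i\to i+1$) and $\phi_c^-$ (for the edges $i+1\to i$), is a Pascal $(A_\infty,0)$-array. It underlies the sequence $\mathcal C_c(n)$ of root clusters via the bra-ket extraction, with second array $Y_c$ itself: for every $n\ge0$, $X\mapsto(C,D)$ is a bijection from $\mathcal C_c(n)$ onto $\bigsqcup_{l}Y_c(n;l)\times Y_c(n;l)$. -/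

import Mathlib

namespace TaggedClusters

/-! ### Graphs, paths and Pascal arrays -/

/-- A (directed) graph with vertex set `V` and edge set `E`: every edge `e` goes from `src e`
to `tgt e`. -/
structure DirGraph (V E : Type) where
  src : E → V
  tgt : E → V

/-- The opposite graph. -/
def DirGraph.op {V E : Type} (G : DirGraph V E) : DirGraph V E where
  src := G.tgt
  tgt := G.src

/-- `G.IsPath v w es`: the sequence of edges `es` is a path in `G` from `v` to `w`. -/
def DirGraph.IsPath {V E : Type} (G : DirGraph V E) : V → V → List E → Prop
  | v, w, [] => v = w
  | v, w, e :: es => G.src e = v ∧ G.IsPath (G.tgt e) w es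

/-- The set of paths of length `n` from `v` to `w`. -/
def DirGraph.paths {V E : Type} (G : DirGraph V E) (n : ℕ) (v w : V) : Set (List E) :=
  {es | es.length = n ∧ G.IsPath v w es}

/-- The array of sets `Y`, with the edge maps `φ n e : Y n (src e) → Y (n + 1) (tgt e)`, is a
Pascal `(G, v₀)`-array: its layer `0` is in pointwise bijection with the paths of length `0`
starting at `v₀`, the edge maps are injective, and `Y (n + 1) v` is the disjoint union of the
images of the edge maps of the edges that end in `v`. -/
structure IsPascalArray {V E X : Type} (G : DirGraph V E) (v₀ : V) (Y : ℕ → V → Set X)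
    (φ : ℕ → E → X → X) : Prop where
  layer_zero : ∀ v, Nonempty (Y 0 v ≃ G.paths 0 v₀ v)
  mapsTo : ∀ n e, Set.MapsTo (φ n e) (Y n (G.src e)) (Y (n + 1) (G.tgt e))
  injOn : ∀ n e, Set.InjOn (φ n e) (Y n (G.src e))
  disjoint : ∀ n e e', e ≠ e' → G.tgt e = G.tgt e' →
    Disjoint (φ n e '' Y n (G.src e)) (φ n e' '' Y n (G.src e'))
  union : ∀ n v, Y (n + 1) v = ⋃ e ∈ {e | G.tgt e = v}, φ n e '' Y n (G.src e)

/-- `Y` underlies the Catalan `(G, v₀)`-sequence `C` via `Φ` (with the second array `Y'`):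
`Y` is a Pascal `(G, v₀)`-array, `Y'` is a Pascal `(G.op, v₀)`-array, and `Φ n` is a bijection
from `C n` onto the disjoint union over the vertices `v` of the sets `Y n v × Y' n v`. -/
structure UnderliesVia {V E X X' Z : Type} (G : DirGraph V E) (v₀ : V) (Y : ℕ → V → Set X)
    (Y' : ℕ → V → Set X') (C : ℕ → Set Z) (Φ : ℕ → Z → X × X') : Prop where
  left : ∃ φ, IsPascalArray G v₀ Y φ
  right : ∃ φ', IsPascalArray G.op v₀ Y' φ'
  disjoint : ∀ n, Pairwise fun v w => Disjoint (Y n v ×ˢ Y' n v) (Y n w ×ˢ Y' n w)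
  bijOn : ∀ n, Set.BijOn (Φ n) (C n) (⋃ v, Y n v ×ˢ Y' n v)

/-- The graph `A_∞` with vertices `0, 1, 2, …`: the edge `(i, true)` goes from `i` to `i + 1`
and the edge `(i, false)` goes from `i + 1` to `i`. -/
def graphAInf : DirGraph ℕ (ℕ × Bool) where
  src e := if e.2 then e.1 else e.1 + 1
  tgt e := if e.2 then e.1 + 1 else e.1

/-! ### Almost positive roots and clusters of type `A`

The root lattices of all the systems of type `A_m` are realised inside `ℕ → ℤ`; the simple
roots of type `A_m` are `α_1, …, α_m`. -/

/-- The ambient lattice. -/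
abbrev Lat : Type := ℕ → ℤ

/-- The simple root `α_i`. -/
def simpleRoot (i : ℕ) : Lat := Pi.single i 1

/-- The root `α_i + α_{i+1} + ⋯ + α_j`. -/
def rootSum (i j : ℕ) : Lat := ∑ k ∈ Finset.Icc i j, simpleRoot k

/-- The simple reflection `s_i` (`i ≥ 1`),
`s_i v = v - (2 v_i - v_{i-1} - v_{i+1}) α_i`. -/
def simpleRefl (i : ℕ) : Module.End ℤ Lat where
  toFun v := v - (2 * v i - v (i - 1) - v (i + 1)) • simpleRoot i
  map_add' v w := by
    ext k
    simp only [Pi.add_apply, Pi.sub_apply, Pi.smul_apply, smul_eq_mul]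
    ring
  map_smul' a v := by
    ext k
    simp only [Pi.sub_apply, Pi.smul_apply, smul_eq_mul, RingHom.id_apply]
    ring

/-- The positive roots of type `A_m`. -/
def posRoots (m : ℕ) : Set Lat :=
  {α | ∃ i j, 1 ≤ i ∧ i ≤ j ∧ j ≤ m ∧ α = rootSum i j}

/-- The negative simple roots of type `A_m`. -/
def negSimpleRoots (m : ℕ) : Set Lat :=
  {α | ∃ i, 1 ≤ i ∧ i ≤ m ∧ α = -simpleRoot i}

/-- The almost positive roots of type `A_m`. -/
def almostPosRoots (m : ℕ) : Set Lat := posRoots m ∪ negSimpleRoots m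

open Classical in
/-- The involution `σ_i` of the set of almost positive roots. -/
noncomputable def sigma (i : ℕ) (α : Lat) : Lat :=
  if α = simpleRoot i ∨ α = -simpleRoot i then -α
  else if ∃ j, j ≠ i ∧ α = -simpleRoot j then α
  else simpleRefl i α

/-- The word `w` contains each of `1, …, m` exactly once. -/
def IsCoxeterWord (m : ℕ) (w : List ℕ) : Prop :=
  w.Nodup ∧ ∀ i, i ∈ w ↔ 1 ≤ i ∧ i ≤ m

/-- The product of the simple reflections given by a word. The Coxeter elements of type `A_m`
are the elements `wordProd w` with `IsCoxeterWord m w`, and `s` is an initial letter of such an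
element if and only if the element can be written as `wordProd (s :: w)`. -/
def wordProd (w : List ℕ) : Module.End ℤ Lat := (w.map simpleRefl).prod

/-- The defining rules of the family `R c` of binary relations "`c`-compatible" on the almost
positive roots of type `A_m`, where `c` runs through the Coxeter elements. -/
structure IsCompatFamily (m : ℕ) (R : Module.End ℤ Lat → Lat → Lat → Prop) : Prop where
  base : ∀ w, IsCoxeterWord m w → ∀ i, 1 ≤ i → i ≤ m → ∀ α ∈ posRoots m,
    (R (wordProd w) (-simpleRoot i) α ↔ α i = 0)
  rotate : ∀ s w, IsCoxeterWord m (s :: w) → ∀ α ∈ almostPosRoots m, ∀ β ∈ almostPosRoots m,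
    (R (wordProd (s :: w)) α β ↔
      R (simpleRefl s * wordProd (s :: w) * simpleRefl s) (sigma s α) (sigma s β))

/-- The Coxeter element `s_m s_{m-1} ⋯ s_1`. -/
def linearCoxeter (m : ℕ) : Module.End ℤ Lat :=
  wordProd ((List.range m).map fun i => m - i)

/-- Compatibility of almost positive roots with respect to `c = s_m ⋯ s_1`. The two rules
determine the family on pairs of distinct roots, so for such pairs it does not matter that all
families obeying the rules are taken into account. -/
def Compat (m : ℕ) (α β : Lat) : Prop :=
  ∀ R, IsCompatFamily m R → R (linearCoxeter m) α β

/-- The root clusters of type `A_m`: the maximal sets of pairwise compatible almost positive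
roots. -/
def IsCluster (m : ℕ) (X : Set Lat) : Prop :=
  Maximal (fun Z : Set Lat => Z ⊆ almostPosRoots m ∧ Z.Pairwise (Compat m)) X

/-- The set `𝒞_c(n)` of clusters of type `A_{n-1}`. For `n = 0` the rank is `0 - 1 = 0`, so that
the empty set is the only cluster. -/
def rootClusters (n : ℕ) : Set (Set Lat) := {X | IsCluster (n - 1) X}

/-! ### The array of tagged clusters -/

/-- A set of roots, the set of those among them that carry a root tag, and the information
whether there is a global tag. -/
@[ext]
structure TaggedSet where
  roots : Set Lat
  tagged : Set Lat
  globalTag : Prop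

/-- The rank `r` of the clusters in layer `n`: it is `(n - 1) / 2` for odd `n` and `n / 2 - 1`
for even `n` (and `0` for `n = 0`). -/
def layerRank (n : ℕ) : ℕ := if Odd n then (n - 1) / 2 else n / 2 - 1

/-- `C` is a tagged cluster of type `A_m`: only negative roots of the cluster are tagged. -/
def IsTaggedCluster (m : ℕ) (C : TaggedSet) : Prop :=
  IsCluster m C.roots ∧ C.tagged ⊆ C.roots ∩ negSimpleRoots m

open Classical in
/-- The total number of tags. -/
noncomputable def tagCount (C : TaggedSet) : ℕ :=
  C.tagged.ncard + if C.globalTag then 1 else 0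

/-- The array `Y_c(n; l)` of tagged clusters. It is empty unless `n - l` is even. In layer `0`
there is no global tag, so that `Y_c(0; 0)` has one element and `Y_c(0; l)` is empty for
`l > 0`. -/
noncomputable def Yc (n l : ℕ) : Set TaggedSet :=
  {C | IsTaggedCluster (layerRank n) C ∧
    ((Odd n ∧ Odd l ∧ ¬ C.globalTag ∧ C.tagged.ncard = (l - 1) / 2) ∨
      (Even n ∧ Even l ∧ tagCount C = l / 2 ∧ (n = 0 → ¬ C.globalTag)))}

/-- `L_S(i)` is `j + 1` for the largest `j` with `1 ≤ j < i` and `-α_j ∈ S`, and `1` if there is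
no such `j` (the supremum of the empty set of natural numbers is `0`). -/
noncomputable def lowerEnd (S : Set Lat) (i : ℕ) : ℕ :=
  sSup {j | 1 ≤ j ∧ j < i ∧ -simpleRoot j ∈ S} + 1

open Classical in
/-- The map `φ_c^+` on layer `n`. (In layer `0` there is no root `-α_0` to add.) -/
noncomputable def phiPlus (n : ℕ) (C : TaggedSet) : TaggedSet :=
  if Odd n then ⟨C.roots, C.tagged, True⟩
  else if n = 0 then C
  else ⟨insert (-simpleRoot (n / 2)) C.roots,
    if C.globalTag then insert (-simpleRoot (n / 2)) C.tagged else C.tagged, False⟩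

/-- The largest `k ≥ 1` for which `-α_k` carries a root tag. -/
noncomputable def maxTag (C : TaggedSet) : ℕ :=
  sSup {k | 1 ≤ k ∧ -simpleRoot k ∈ C.tagged}

open Classical in
/-- The map `φ_c^-` on layer `n`. -/
noncomputable def phiMinus (n : ℕ) (C : TaggedSet) : TaggedSet :=
  let r := layerRank n
  let k := maxTag C
  if Odd n then C
  else if C.globalTag then
    ⟨insert (rootSum (lowerEnd C.roots (r + 1)) (r + 1)) C.roots, C.tagged, False⟩
  else
    ⟨{α | α ∈ C.roots ∧ ¬ ∃ i, k ≤ i ∧ α = -simpleRoot i} ∪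
        {α | ∃ i, k ≤ i ∧ -simpleRoot i ∈ C.roots ∧ α = rootSum (i + 1) (r + 1)} ∪
        {rootSum (lowerEnd C.roots k) (r + 1)},
      C.tagged \ {-simpleRoot k}, False⟩

/-- The edge maps: `φ_c^+` for the edges `i → i + 1`, and `φ_c^-` for the edges `i + 1 → i`. -/
noncomputable def edgeMap (n : ℕ) (e : ℕ × Bool) (C : TaggedSet) : TaggedSet :=
  if e.2 then phiPlus n C else phiMinus n C

/-! ### Bra-ket extraction

Below `X` is a cluster of type `A_{n-1}` and `r` stands for `layerRank n`. -/

/-- `I_k`, the set of all `i` with `α_i + ⋯ + α_k ∈ X`. -/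
def startSet (X : Set Lat) (k : ℕ) : Set ℕ := {i | 1 ≤ i ∧ i ≤ k ∧ rootSum i k ∈ X}

/-- `Y_k`, the set of all roots `α_i + ⋯ + α_k` in `X`. -/
def endingRoots (X : Set Lat) (k : ℕ) : Set Lat := {α | ∃ i ∈ startSet X k, α = rootSum i k}

/-- The bound for `i` in the definition of `X_k`. -/
def startBound (n k : ℕ) : ℕ :=
  if Odd n ∨ k = layerRank n + 1 then layerRank n + 1 else layerRank n + 2

/-- `X_k`, the set of all roots `α_i + ⋯ + α_k` in `X` for which `i` is at most the bound. -/
def crossingRoots (n : ℕ) (X : Set Lat) (k : ℕ) : Set Lat :=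
  {α | ∃ i ∈ startSet X k, i ≤ startBound n k ∧ α = rootSum i k}

/-- The right half of the simple roots is `α_{r+1}, …, α_{n-1}` for odd `n` and
`α_{r+2}, …, α_{n-1}` for even `n`. -/
def rightStart (n : ℕ) : ℕ := if Odd n then layerRank n + 1 else layerRank n + 2

open Classical in
/-- The index `t` for given `k`: the largest `t < k` in the right half with `|X_t| > 1`; if there
is none, `t = r` for odd `n` or `k = r + 1`, and `t = r + 1` otherwise. -/
noncomputable def cutIndex (n : ℕ) (X : Set Lat) (k : ℕ) : ℕ :=
  let T : Set ℕ := {t | rightStart n ≤ t ∧ t < k ∧ 1 < (crossingRoots n X t).ncard}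
  if T.Nonempty then sSup T
  else if Odd n ∨ k = layerRank n + 1 then layerRank n else layerRank n + 1

/-- For even `n`: the condition under which the elements of `Y_k` are left alone. -/
def LeftAlone (n : ℕ) (X : Set Lat) (k : ℕ) : Prop :=
  Even n ∧ ((layerRank n + 1 < k ∧ ∀ i ∈ startSet X k, layerRank n + 2 ≤ i) ∨
    (k = layerRank n + 1 ∧ startSet X k = {layerRank n + 1}))

/-- The indices `k` that fall under the first replacement rule. -/
def IsSingleIndex (n : ℕ) (X : Set Lat) (k : ℕ) : Prop :=
  layerRank n + 1 ≤ k ∧ k ≤ n - 1 ∧ ¬ LeftAlone n X k ∧ (crossingRoots n X k).ncard = 1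

/-- The indices `k` that fall under the second replacement rule. -/
def IsMultiIndex (n : ℕ) (X : Set Lat) (k : ℕ) : Prop :=
  layerRank n + 1 ≤ k ∧ k ≤ n - 1 ∧ ¬ LeftAlone n X k ∧ 1 < (crossingRoots n X k).ncard

/-- The set `X'` obtained from `X`: if `|X_k| = 1`, the root in `X_k` is replaced by
`α_{t+1} + ⋯ + α_k`; if `|X_k| > 1`, the roots in `Y_k` are replaced by `-α_k` and the roots
`-α_{i-1}`, where `i` runs through the elements of `I_k` other than the smallest. -/
def replaced (n : ℕ) (X : Set Lat) : Set Lat :=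
  {α | α ∈ X ∧ (¬ ∃ k, IsSingleIndex n X k ∧ α ∈ crossingRoots n X k) ∧
      ¬ ∃ k, IsMultiIndex n X k ∧ α ∈ endingRoots X k} ∪
    {α | ∃ k, IsSingleIndex n X k ∧ α = rootSum (cutIndex n X k + 1) k} ∪
    {α | ∃ k, IsMultiIndex n X k ∧ α = -simpleRoot k} ∪
    {α | ∃ k, IsMultiIndex n X k ∧
      ∃ i ∈ startSet X k, (∃ i' ∈ startSet X k, i' < i) ∧ α = -simpleRoot (i - 1)}

/-- The tagged elements of `X'`: for each `k` with `|X_k| > 1`, the roots `-α_k` and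
`-α_{j-1}`, where `j` is the second smallest element of `I_k`. -/
def replacedTags (n : ℕ) (X : Set Lat) : Set Lat :=
  {α | ∃ k, IsMultiIndex n X k ∧ (α = -simpleRoot k ∨
    ∃ j ∈ startSet X k, {i | i ∈ startSet X k ∧ i < j}.ncard = 1 ∧ α = -simpleRoot (j - 1))}

/-- Only the simple roots `α_a, …, α_b` occur in `α`. -/
def SupportedIn (a b : ℕ) (α : Lat) : Prop := ∀ i, α i ≠ 0 → a ≤ i ∧ i ≤ b

/-- The linear map with `α_i ↦ α_{n-i}`. -/
def flipRoot (n : ℕ) (α : Lat) : Lat := fun i => if i ≤ n then α (n - i) else 0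

/-- The part of a set of roots in the left half `α_1, …, α_r`. -/
def leftPart (n : ℕ) (S : Set Lat) : Set Lat := {α | α ∈ S ∧ SupportedIn 1 (layerRank n) α}

/-- The flipped part of a set of roots in the right half. -/
def rightPart (n : ℕ) (S : Set Lat) : Set Lat :=
  flipRoot n '' {α | α ∈ S ∧ SupportedIn (rightStart n) (n - 1) α}

/-- The bra-ket extraction, `X ↦ (C, D)`. For even `n`, both `C` and `D` get a global tag if
`α_{r+1} ∈ X'`; if `X'` contains `-α_{r+1}` with a tag, the one with fewer tags gets a global
tag. -/
noncomputable def braKet (n : ℕ) (X : Set Lat) : TaggedSet × TaggedSet :=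
  let r := layerRank n
  let Z := replaced n X
  let T := replacedTags n X
  let TC := leftPart n T
  let TD := rightPart n T
  (⟨leftPart n Z, TC, Even n ∧ (simpleRoot (r + 1) ∈ Z ∨
      (-simpleRoot (r + 1) ∈ T ∧ TC.ncard < TD.ncard))⟩,
    ⟨rightPart n Z, TD, Even n ∧ (simpleRoot (r + 1) ∈ Z ∨
      (-simpleRoot (r + 1) ∈ T ∧ TD.ncard < TC.ncard))⟩)

end TaggedClusters

namespace TaggedClusters

/-! For `c = s_m ⋯ s_1` the almost positive roots are the diagonals of a polygon with vertices `0,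
…, m + 2`: `[i, j]` is `{i - 1, j + 1}` and `-α_i` is `{i, m + 2}`. Compatible means noncrossing.
Since `Compat` quantifies over all families obeying the two rules, this needs two things. Some
family exists: it is given by the Euler forms of the orientations of the Dynkin diagram
(`isCompatFamily_eulerCompat`). And the rules force the answer (`compatFamily_iff`): rule (II), used
once for every letter of `c`, rotates the polygon by one vertex, and rule (I) decides pairs with
exactly one diagonal at the vertex `m + 2`. So clusters are triangulations, they have `m` elements,
and conversely `m` pairwise noncrossing roots form a cluster (`Noncrossing.isCluster`). Most proofs
below that something is a cluster are such counts.

Pascal array: from odd to even layers the edge maps only record a global tag. From the even layer of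
rank `r`, both maps are inverted by `contractTop`, the contraction of the side `{r + 2, r + 3}` of a
triangulated polygon of rank `r + 1`. The fans at the two ends of that side merge, and the tags
remember where to separate them again. If the triangle on this side has apex `r + 1`, that is, if
`-α_{r+1}` is present, then `φ_c^+` undoes the contraction, and otherwise `φ_c^-` does.

Bra-ket extraction: cut the simple roots in front of some `α_p`. The roots across the cut, and the
fans they belong to, are replaced in such a way that both halves are noncrossing and the number of
roots is unchanged. The ranks `p - 1` and `m + 1 - p` add up to `m`, so both halves are clusters
(`isCluster_sides`). Every `k ≥ p` with several roots `[i, k]`, `i ≤ p`, creates one tag in each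
half, so the tag numbers agree (`ncard_tags_sides`). A larger such `k` has a smaller second start
(`Multi.second_lt`); hence the tags of the two halves can be matched and the cluster recovered
(`eq_of_sides_eq`). For odd `n` the cut is at `p = r + 1`. For even `n` it is at `p = r + 2`; the
left half then has rank `r + 1` and is contracted by `contractTop`, while the global tag of the
right half tells which edge map undoes this (`braKet_even`).

Surjectivity is a count (`bijOn_of_injOn`). The adjacency matrix of `A_∞` is symmetric, so `∑
|Y(a+1; l)| |Y(b; l)| = ∑ |Y(a; l)| |Y(b+1; l)|`, the sums being over `l`. Hence for `n ≥ 1` the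
number of pairs is `|Y(2n-1; 1)|`, and `Y(2n-1; 1)` consists of the clusters of type `A_{n-1}`
without tags. -/

theorem simpleRoot_apply (i k : ℕ) : simpleRoot i k = if k = i then 1 else 0 := by
  simp [simpleRoot, Pi.single_apply]

theorem rootSum_apply (i j k : ℕ) : rootSum i j k = if i ≤ k ∧ k ≤ j then 1 else 0 := by
  simp [rootSum, Finset.sum_apply, simpleRoot_apply]

theorem simpleRefl_apply (i : ℕ) (v : Lat) (k : ℕ) :
    simpleRefl i v k = if k = i then v (i - 1) + v (i + 1) - v i else v k := by
  simp only [simpleRefl, LinearMap.coe_mk, AddHom.coe_mk, Pi.sub_apply, Pi.smul_apply,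
    simpleRoot_apply, smul_eq_mul]
  split_ifs with h
  · subst h; ring
  · ring

theorem rootSum_self (i : ℕ) : rootSum i i = simpleRoot i := by simp [rootSum]

theorem rootSum_inj {i j k l : ℕ} (hij : i ≤ j) (hkl : k ≤ l) (h : rootSum i j = rootSum k l) :
    i = k ∧ j = l := by
  have h1 := congrFun h i
  have h2 := congrFun h j
  have h3 := congrFun h k
  have h4 := congrFun h l
  simp only [rootSum_apply] at h1 h2 h3 h4
  split_ifs at h1 h2 h3 h4 <;> omega

theorem rootSum_ne_neg (i j k : ℕ) : rootSum i j ≠ -simpleRoot k := by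
  intro h
  have h1 := congrFun h k
  simp only [rootSum_apply, Pi.neg_apply, simpleRoot_apply] at h1
  split_ifs at h1

theorem neg_simpleRoot_inj {i k : ℕ} (h : -simpleRoot i = -simpleRoot k) : i = k := by
  have h1 := congrFun h k
  simp only [Pi.neg_apply, simpleRoot_apply] at h1
  split_ifs at h1
  omega

@[simp]
theorem neg_simpleRoot_eq_iff {i k : ℕ} : -simpleRoot i = -simpleRoot k ↔ i = k :=
  ⟨neg_simpleRoot_inj, fun h => by rw [h]⟩

theorem rootSum_eq_zero {i j : ℕ} (h : j < i) : rootSum i j = 0 := by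
  simp [rootSum, Finset.Icc_eq_empty_of_lt h]

theorem rootSum_mem {m i j : ℕ} :
    rootSum i j ∈ almostPosRoots m ↔ 1 ≤ i ∧ i ≤ j ∧ j ≤ m := by
  constructor
  · rintro (⟨a, b, ha, hab, hb, h⟩ | ⟨a, ha, hb, h⟩)
    · by_cases hij : i ≤ j
      · obtain ⟨rfl, rfl⟩ := rootSum_inj hij hab h
        exact ⟨ha, hab, hb⟩
      · have h1 := congrFun h a
        simp only [rootSum_apply] at h1
        split_ifs at h1 <;> omega
    · exact absurd h (rootSum_ne_neg _ _ _)
  · rintro ⟨h1, h2, h3⟩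
    exact Or.inl ⟨i, j, h1, h2, h3, rfl⟩

theorem neg_mem {m i : ℕ} : -simpleRoot i ∈ almostPosRoots m ↔ 1 ≤ i ∧ i ≤ m := by
  constructor
  · rintro (⟨a, b, ha, hab, hb, h⟩ | ⟨a, ha, hb, h⟩)
    · exact absurd h.symm (rootSum_ne_neg _ _ _)
    · obtain rfl := neg_simpleRoot_inj h
      exact ⟨ha, hb⟩
  · rintro ⟨h1, h2⟩
    exact Or.inr ⟨i, h1, h2, rfl⟩

/-! ### The involutions `σ_i` on the almost positive roots -/

theorem sigma_neg_self (i : ℕ) : sigma i (-simpleRoot i) = simpleRoot i := by simp [sigma]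

theorem neg_ne_simpleRoot (i j : ℕ) : -simpleRoot j ≠ simpleRoot i := by
  rw [← rootSum_self i]; exact (rootSum_ne_neg _ _ _).symm

theorem sigma_neg_of_ne {i j : ℕ} (h : j ≠ i) : sigma i (-simpleRoot j) = -simpleRoot j := by
  rw [sigma, if_neg, if_pos ⟨j, h, rfl⟩]
  rintro (h' | h')
  · exact neg_ne_simpleRoot _ _ h'
  · exact h (neg_simpleRoot_inj h')

theorem sigma_simpleRoot (i : ℕ) : sigma i (simpleRoot i) = -simpleRoot i := by simp [sigma]

theorem sigma_rootSum {i j k : ℕ} (hij : i ≤ j) (h : ¬ (i = k ∧ j = k)) :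
    sigma k (rootSum i j) = simpleRefl k (rootSum i j) := by
  rw [sigma, if_neg, if_neg]
  · rintro ⟨l, -, hl⟩
    exact rootSum_ne_neg _ _ _ hl
  · rintro (h' | h')
    · rw [← rootSum_self] at h'
      exact h (rootSum_inj hij le_rfl h')
    · exact rootSum_ne_neg _ _ _ h'

theorem sigma_rootSum_fixed {i j k : ℕ} (hij : i ≤ j)
    (h : k + 1 < i ∨ j + 1 < k ∨ (i < k ∧ k < j)) :
    sigma k (rootSum i j) = rootSum i j := by
  rw [sigma_rootSum hij (by omega)]
  ext l
  simp only [simpleRefl_apply, rootSum_apply]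
  split_ifs <;> omega

theorem sigma_rootSum_grow_right {i j : ℕ} (hij : i ≤ j) :
    sigma (j + 1) (rootSum i j) = rootSum i (j + 1) := by
  rw [sigma_rootSum hij (by omega)]
  ext l
  simp only [simpleRefl_apply, rootSum_apply]
  split_ifs <;> omega

theorem sigma_rootSum_grow_left {i j : ℕ} (hi : 1 ≤ i) (hij : i + 1 ≤ j) :
    sigma i (rootSum (i + 1) j) = rootSum i j := by
  rw [sigma_rootSum hij (by omega)]
  ext l
  simp only [simpleRefl_apply, rootSum_apply]
  split_ifs <;> omega

theorem sigma_rootSum_shrink_right {i j : ℕ} (hij : i ≤ j) :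
    sigma (j + 1) (rootSum i (j + 1)) = rootSum i j := by
  rw [sigma_rootSum (by omega) (by omega)]
  ext l
  simp only [simpleRefl_apply, rootSum_apply]
  split_ifs <;> omega

theorem sigma_rootSum_shrink_left {i j : ℕ} (hi : 1 ≤ i) (hij : i < j) :
    sigma i (rootSum i j) = rootSum (i + 1) j := by
  rw [sigma_rootSum (by omega) (by omega)]
  ext l
  simp only [simpleRefl_apply, rootSum_apply]
  split_ifs <;> omega

theorem simpleRefl_mul_self {i : ℕ} (hi : 1 ≤ i) : simpleRefl i * simpleRefl i = 1 := by
  ext v k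
  simp only [Module.End.mul_apply, simpleRefl_apply, Module.End.one_apply]
  split_ifs <;> first | omega | simp_all

/-- A simple reflection permutes the positive roots other than its own simple root. The cases are
the positions of `k` relative to the interval: next to an end (grow), at an end (shrink), elsewhere
(fixed). -/
theorem sigma_mem_posRoots {m k : ℕ} (hk : 1 ≤ k) (hkm : k ≤ m) {α : Lat}
    (hα : α ∈ posRoots m) (hne : α ≠ simpleRoot k) :
    sigma k α ∈ posRoots m ∧ sigma k α = simpleRefl k α ∧ sigma k α ≠ simpleRoot k := by
  obtain ⟨i, j, hi, hij, hj, rfl⟩ := hα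
  have hne' : ¬ (i = k ∧ j = k) := by
    rintro ⟨rfl, rfl⟩
    exact hne (rootSum_self _)
  refine and_assoc.1 (And.intro (And.intro ?_ (sigma_rootSum hij hne')) ?_)
  · by_cases h1 : k = j + 1
    · subst h1
      rw [sigma_rootSum_grow_right hij]
      exact ⟨_, _, hi, by omega, by omega, rfl⟩
    by_cases h2 : k + 1 = i
    · subst h2
      rw [sigma_rootSum_grow_left hk hij]
      exact ⟨_, _, hk, by omega, by omega, rfl⟩
    by_cases h3 : k = j
    · obtain ⟨j, rfl⟩ : ∃ j', j = j' + 1 := ⟨j - 1, by omega⟩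
      subst h3
      rw [sigma_rootSum_shrink_right (by omega)]
      exact ⟨_, _, hi, by omega, by omega, rfl⟩
    by_cases h4 : k = i
    · subst h4
      rw [sigma_rootSum_shrink_left hk (by omega)]
      exact ⟨_, _, by omega, by omega, by omega, rfl⟩
    rw [sigma_rootSum_fixed hij (by omega)]
    exact ⟨_, _, hi, hij, hj, rfl⟩
  · rw [sigma_rootSum hij hne']
    intro h
    have h0 := congrFun h k
    have h1 := congrFun h (k - 1)
    have h2 := congrFun h (k + 1)
    simp only [simpleRefl_apply, rootSum_apply, simpleRoot_apply] at h0 h1 h2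
    split_ifs at h0 h1 h2 <;> omega

theorem sigma_mem {m k : ℕ} (hk : 1 ≤ k) (hkm : k ≤ m) {α : Lat} (hα : α ∈ almostPosRoots m) :
    sigma k α ∈ almostPosRoots m := by
  rcases hα with hα | ⟨i, hi, him, rfl⟩
  · by_cases h : α = simpleRoot k
    · rw [h, sigma_simpleRoot]
      exact Or.inr ⟨k, hk, hkm, rfl⟩
    · exact Or.inl (sigma_mem_posRoots hk hkm hα h).1
  · by_cases h : i = k
    · rw [h, sigma_neg_self]
      exact Or.inl ⟨k, k, hk, le_rfl, hkm, (rootSum_self k).symm⟩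
    · rw [sigma_neg_of_ne h]
      exact Or.inr ⟨i, hi, him, rfl⟩

/-! ### Existence of the compatibility relations -/

theorem wordProd_cons (s : ℕ) (w : List ℕ) : wordProd (s :: w) = simpleRefl s * wordProd w := by
  simp [wordProd]

theorem wordProd_append (u w : List ℕ) : wordProd (u ++ w) = wordProd u * wordProd w := by
  simp [wordProd]

/-- Turns rule (II) into a rule about words: conjugation by the initial letter moves this letter to
the end. -/
theorem wordProd_rotate {s : ℕ} (hs : 1 ≤ s) (w : List ℕ) :
    simpleRefl s * wordProd (s :: w) * simpleRefl s = wordProd (w ++ [s]) := by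
  rw [wordProd_cons, ← mul_assoc, simpleRefl_mul_self hs, one_mul, wordProd_append]
  simp [wordProd]

theorem wordProd_apply_of_notMem {w : List ℕ} {k : ℕ} (h : k ∉ w) (v : Lat) :
    wordProd w v k = v k := by
  induction w with
  | nil => simp [wordProd]
  | cons t w ih =>
    simp only [List.mem_cons, not_or] at h
    rw [wordProd_cons, Module.End.mul_apply, simpleRefl_apply, if_neg h.1, ih h.2]

/-- The vector `(0, …, 0, 1, 2, 3, …)` which is fixed by all simple reflections but `s_i`. -/
def hinge (i : ℕ) : Lat := fun k => ((k - i : ℕ) : ℤ)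

/-- A reflection fixes a coordinate at which the vector is locally linear, and the hinge is linear
from `i` on. The letter `s_i` may destroy this at `i`, but without `s_{i+1}` no letter that changes
a coordinate above `i` reads the coordinate `i`. -/
theorem wordProd_hinge_above {i : ℕ} {w : List ℕ} (h : i + 1 ∉ w) {k : ℕ} (hk : i + 1 ≤ k) :
    wordProd w (hinge i) k = hinge i k := by
  induction w generalizing k with
  | nil => simp [wordProd]
  | cons t w ih =>
    simp only [List.mem_cons, not_or] at h
    rw [wordProd_cons, Module.End.mul_apply, simpleRefl_apply]
    split_ifs with hkt
    · subst hkt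
      rw [ih h.2 (by omega), ih h.2 (by omega), ih h.2 (by omega)]
      simp only [hinge]
      omega
    · exact ih h.2 hk

theorem wordProd_hinge_fixed {i : ℕ} {w : List ℕ} (h0 : 0 ∉ w) (h : i ∉ w) :
    wordProd w (hinge i) = hinge i := by
  induction w with
  | nil => simp [wordProd]
  | cons t w ih =>
    simp only [List.mem_cons, not_or] at h h0
    rw [wordProd_cons, Module.End.mul_apply, ih h0.2 h.2]
    ext k
    rw [simpleRefl_apply]
    split_ifs with hkt
    · simp only [hinge]
      omega
    · rfl

/-- The letters in front of `s_i` do not change the coordinate `i`, those behind it fix the hinge,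
and `s_i` itself turns the value `0` at the kink into `0 + 1 - 0`. -/
theorem wordProd_hinge_at {i : ℕ} {w : List ℕ} (hw : w.Nodup) (h0 : 0 ∉ w)
    (h : i ∈ w) : wordProd w (hinge i) i = 1 := by
  induction w with
  | nil => simp at h
  | cons t w ih =>
    rw [List.nodup_cons] at hw
    simp only [List.mem_cons, not_or] at h h0
    rw [wordProd_cons, Module.End.mul_apply, simpleRefl_apply]
    split_ifs with hit
    · subst hit
      rw [wordProd_hinge_fixed h0.2 hw.1]
      simp only [hinge]
      omega
    · exact ih hw.2 h0.2 (by simpa [hit] using h)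

/-- For a Coxeter element `c`, this tells that `s_i` comes before `s_{i+1}` in `c`. -/
def Precedes (c : Module.End ℤ Lat) (i : ℕ) : Prop := c (hinge i) (i + 1) = 1

/-- Compatibility families are indexed by Coxeter elements, not by words, so the order of
neighbouring letters must be readable from the element. At `i + 1` the element sends the hinge to `x
+ 2 - 1`, where `x` is the coordinate `i` after the letters of `z`: it is `1` if `s_i` is among them
and `0` otherwise. -/
theorem precedes_iff {i : ℕ} (hi : 1 ≤ i) {u z : List ℕ} (hw : (u ++ (i + 1) :: z).Nodup)
    (h0 : 0 ∉ u ++ (i + 1) :: z) : Precedes (wordProd (u ++ (i + 1) :: z)) i ↔ i ∉ z := by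
  have hu : i + 1 ∉ u := fun h => by
    simp only [List.nodup_append, List.mem_cons] at hw
    exact hw.2.2 _ h _ (Or.inl rfl) rfl
  have hw2 := (List.nodup_append.1 hw).2.1
  rw [List.nodup_cons] at hw2
  have hz0 : 0 ∉ z := fun h => h0 (by simp [h])
  rw [Precedes, wordProd_append, wordProd_cons, Module.End.mul_apply, Module.End.mul_apply,
    wordProd_apply_of_notMem hu, simpleRefl_apply, if_pos rfl,
    wordProd_hinge_above hw2.1 le_rfl,
    wordProd_hinge_above hw2.1 (k := i + 1 + 1) (by omega)]
  have e : i + 1 - 1 = i := by omega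
  rw [e]
  have e1 : hinge i (i + 1) = 1 := by simp [hinge]
  have e2 : hinge i (i + 1 + 1) = 2 := by
    have : i + 1 + 1 - i = 2 := by omega
    simp [hinge, this]
  rw [e1, e2]
  by_cases hiz : i ∈ z
  · rw [wordProd_hinge_at hw2.2 hz0 hiz]
    simp [hiz]
  · rw [wordProd_hinge_fixed hz0 hiz]
    simp [hiz, hinge]

theorem IsCoxeterWord.pos {m : ℕ} {w : List ℕ} (h : IsCoxeterWord m w) : 0 ∉ w := fun h' => by
  have := (h.2 0).1 h'
  omega

theorem IsCoxeterWord.rotate {m s : ℕ} {w : List ℕ} (h : IsCoxeterWord m (s :: w)) :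
    IsCoxeterWord m (w ++ [s]) := by
  have hp : (w ++ [s]).Perm (s :: w) := List.perm_append_singleton s w
  exact ⟨hp.nodup_iff.2 h.1, fun i => by rw [hp.mem_iff]; exact h.2 i⟩

theorem IsCoxeterWord.head_mem {m s : ℕ} {w : List ℕ} (h : IsCoxeterWord m (s :: w)) :
    1 ≤ s ∧ s ≤ m := (h.2 s).1 (by simp)

theorem precedes_head {m s : ℕ} {w : List ℕ} (h : IsCoxeterWord m (s :: w)) (hs : s + 1 ≤ m) :
    Precedes (wordProd (s :: w)) s ∧ ¬ Precedes (wordProd (w ++ [s])) s := by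
  have h1 := h.head_mem
  have hmem : s + 1 ∈ w := by
    have := (h.2 (s + 1)).2 ⟨by omega, hs⟩
    simpa using this
  obtain ⟨u, z, rfl⟩ := List.append_of_mem hmem
  have hz : s ∉ z := fun hz => by
    have := (List.nodup_cons.1 h.1).1
    simp [hz] at this
  constructor
  · rw [← List.cons_append, precedes_iff h1.1]
    · exact hz
    · exact h.1
    · exact h.pos
  · have hr := h.rotate
    rw [List.append_assoc, List.cons_append] at hr ⊢
    rw [precedes_iff h1.1 hr.1 hr.pos]
    simp

theorem precedes_head_pred {m s : ℕ} {w : List ℕ} (h : IsCoxeterWord m ((s + 1) :: w))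
    (hs : 1 ≤ s) :
    ¬ Precedes (wordProd ((s + 1) :: w)) s ∧ Precedes (wordProd (w ++ [s + 1])) s := by
  have h1 := h.head_mem
  have hmem : s ∈ w := by
    have := (h.2 s).2 ⟨hs, by omega⟩
    simpa using this
  constructor
  · have := precedes_iff hs (u := []) (z := w) (by simpa using h.1) (by simpa using h.pos)
    rw [List.nil_append] at this
    rw [this]
    simpa using hmem
  · rw [precedes_iff hs h.rotate.1 h.rotate.pos]
    simp

theorem precedes_rotate {m s i : ℕ} {w : List ℕ} (h : IsCoxeterWord m (s :: w)) (hi : 1 ≤ i)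
    (him : i + 1 ≤ m) (his : i ≠ s) (his' : i + 1 ≠ s) :
    Precedes (wordProd (s :: w)) i ↔ Precedes (wordProd (w ++ [s])) i := by
  have hmem : i + 1 ∈ w := by
    have := (h.2 (i + 1)).2 ⟨by omega, him⟩
    simpa [his'] using this
  obtain ⟨u, z, rfl⟩ := List.append_of_mem hmem
  have hr := h.rotate
  rw [List.append_assoc, List.cons_append] at hr ⊢
  rw [precedes_iff hi hr.1 hr.pos, ← List.cons_append, precedes_iff hi]
  · simp [his]
  · exact h.1
  · exact h.pos

open Classical in
/-- The summands of the Euler form of a Coxeter element. -/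
noncomputable def eulerTerm (c : Module.End ℤ Lat) (α β : Lat) (i : ℕ) : ℤ :=
  α i * β i - if Precedes c i then α i * β (i + 1) else α (i + 1) * β i

/-- The Euler form of a Coxeter element of type `A_m`. -/
noncomputable def eulerForm (m : ℕ) (c : Module.End ℤ Lat) (α β : Lat) : ℤ :=
  ∑ i ∈ Finset.range (m + 1), eulerTerm c α β i

/-- The roots involve only `α_1, …, α_m`. -/
def BoundaryZero (m : ℕ) (α : Lat) : Prop := α 0 = 0 ∧ α (m + 1) = 0

theorem boundaryZero_of_mem {m : ℕ} {α : Lat} (h : α ∈ posRoots m) : BoundaryZero m α := by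
  obtain ⟨i, j, hi, hij, hj, rfl⟩ := h
  simp only [BoundaryZero, rootSum_apply]
  constructor <;> rw [if_neg] <;> omega

theorem sum_range_eq_pair {m s : ℕ} (hs : s + 1 ≤ m) (f : ℕ → ℤ)
    (hf : ∀ i ≤ m, i ≠ s → i ≠ s + 1 → f i = 0) :
    ∑ i ∈ Finset.range (m + 1), f i = f s + f (s + 1) := by
  rw [← Finset.sum_pair (by omega : s ≠ s + 1)]
  symm
  apply Finset.sum_subset
  · intro x
    simp only [Finset.mem_insert, Finset.mem_singleton, Finset.mem_range]
    omega
  · intro x hx hx'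
    simp only [Finset.mem_insert, Finset.mem_singleton, Finset.mem_range] at hx hx'
    exact hf x (by omega) (by omega) (by omega)

/-! ### The Euler form under rotation of the Coxeter word -/

section rotate

variable {m s : ℕ} {w : List ℕ}

/-- An initial letter precedes both of its neighbours, which settles the orientation of both
adjacent edges. At the ends of the diagram a neighbour is missing, but there the boundary
coordinates vanish and the orientation is irrelevant. -/
theorem eulerTerm_head (h : IsCoxeterWord m ((s + 1) :: w)) {α β : Lat}
    (hα : BoundaryZero m α) (hβ : BoundaryZero m β) :
    eulerTerm (wordProd ((s + 1) :: w)) α β s = α s * β s - α (s + 1) * β s ∧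
    eulerTerm (wordProd ((s + 1) :: w)) α β (s + 1) =
      α (s + 1) * β (s + 1) - α (s + 1) * β (s + 2) := by
  have h1 := h.head_mem
  constructor
  · unfold eulerTerm
    by_cases hs : 1 ≤ s
    · rw [if_neg (precedes_head_pred h hs).1]
    · obtain rfl : s = 0 := by omega
      simp [hα.1, hβ.1]
  · unfold eulerTerm
    by_cases hs : s + 2 ≤ m
    · rw [if_pos (precedes_head h hs).1]
    · obtain rfl : m = s + 1 := by omega
      have e1 := hα.2
      have e2 := hβ.2
      simp only [show s + 1 + 1 = s + 2 from rfl] at e1 e2 ⊢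
      simp [e1, e2]

theorem eulerTerm_last (h : IsCoxeterWord m ((s + 1) :: w)) {α β : Lat}
    (hα : BoundaryZero m α) (hβ : BoundaryZero m β) :
    eulerTerm (wordProd (w ++ [s + 1])) α β s = α s * β s - α s * β (s + 1) ∧
    eulerTerm (wordProd (w ++ [s + 1])) α β (s + 1) =
      α (s + 1) * β (s + 1) - α (s + 2) * β (s + 1) := by
  have h1 := h.head_mem
  constructor
  · unfold eulerTerm
    by_cases hs : 1 ≤ s
    · rw [if_pos (precedes_head_pred h hs).2]
    · obtain rfl : s = 0 := by omega
      simp [hα.1, hβ.1]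
  · unfold eulerTerm
    by_cases hs : s + 2 ≤ m
    · rw [if_neg (precedes_head h hs).2]
    · obtain rfl : m = s + 1 := by omega
      have e1 := hα.2
      have e2 := hβ.2
      simp only [show s + 1 + 1 = s + 2 from rfl] at e1 e2 ⊢
      simp [e1, e2]

theorem boundaryZero_simpleRefl (hs : s + 1 ≤ m) {α : Lat} (hα : BoundaryZero m α) :
    BoundaryZero m (simpleRefl (s + 1) α) := by
  simp only [BoundaryZero, simpleRefl_apply]
  rw [if_neg (by omega), if_neg (by omega)]
  exact hα

/-- This is the reflection functor at a source or sink: moving the letter `s + 1` to the end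
reverses the two edges at the node `s + 1` and no others, and the reflection compensates for it.
Only the summands `s` and `s + 1` change, and for these it is a polynomial identity. -/
theorem eulerForm_rotate (h : IsCoxeterWord m ((s + 1) :: w)) {α β : Lat}
    (hα : BoundaryZero m α) (hβ : BoundaryZero m β) :
    eulerForm m (wordProd (w ++ [s + 1])) (simpleRefl (s + 1) α) (simpleRefl (s + 1) β) =
      eulerForm m (wordProd ((s + 1) :: w)) α β := by
  have h1 := h.head_mem
  have hα' := boundaryZero_simpleRefl h1.2 hα
  have hβ' := boundaryZero_simpleRefl h1.2 hβ
  unfold eulerForm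
  rw [← sub_eq_zero, ← Finset.sum_sub_distrib, sum_range_eq_pair h1.2]
  · rw [(eulerTerm_head h hα hβ).1, (eulerTerm_head h hα hβ).2,
      (eulerTerm_last h hα' hβ').1, (eulerTerm_last h hα' hβ').2]
    simp only [simpleRefl_apply]
    simp
    ring
  · intro i him hi hi'
    have e1 : ∀ v : Lat, simpleRefl (s + 1) v i = v i := fun v => by
      rw [simpleRefl_apply, if_neg hi']
    have e2 : ∀ v : Lat, simpleRefl (s + 1) v (i + 1) = v (i + 1) := fun v => by
      rw [simpleRefl_apply, if_neg (by omega)]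
    unfold eulerTerm
    rw [e1, e1, e2, e2]
    by_cases h0 : 1 ≤ i
    · by_cases hm : i + 1 ≤ m
      · have hp := precedes_rotate h h0 hm hi' (by omega)
        by_cases hp' : Precedes (wordProd (w ++ [s + 1])) i
        · rw [if_pos hp', if_pos (hp.2 hp'), sub_self]
        · rw [if_neg hp', if_neg (fun h => hp' (hp.1 h)), sub_self]
      · obtain rfl : m = i := by omega
        simp [hα.2, hβ.2]
    · obtain rfl : i = 0 := by omega
      simp [hα.1, hβ.1]

theorem boundaryZero_simpleRoot (h1 : 1 ≤ s) (h2 : s ≤ m) : BoundaryZero m (simpleRoot s) := by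
  simp only [BoundaryZero, simpleRoot_apply]
  rw [if_neg (by omega), if_neg (by omega)]
  simp

theorem eulerForm_simpleRoot_head (h : IsCoxeterWord m ((s + 1) :: w)) {β : Lat}
    (hβ : BoundaryZero m β) :
    eulerForm m (wordProd ((s + 1) :: w)) (simpleRoot (s + 1)) β =
        β (s + 1) - β s - β (s + 2) ∧
      eulerForm m (wordProd ((s + 1) :: w)) β (simpleRoot (s + 1)) = β (s + 1) := by
  have h1 := h.head_mem
  have hα := boundaryZero_simpleRoot h1.1 h1.2
  constructor
  · unfold eulerForm
    rw [sum_range_eq_pair h1.2, (eulerTerm_head h hα hβ).1, (eulerTerm_head h hα hβ).2]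
    · simp only [simpleRoot_apply]
      simp
      ring
    · intro i hi h2 h3
      unfold eulerTerm
      simp only [simpleRoot_apply]
      rw [if_neg h3, if_neg (by omega : i + 1 ≠ s + 1)]
      simp
  · unfold eulerForm
    rw [sum_range_eq_pair h1.2, (eulerTerm_head h hβ hα).1, (eulerTerm_head h hβ hα).2]
    · simp only [simpleRoot_apply]
      simp
    · intro i hi h2 h3
      unfold eulerTerm
      simp only [simpleRoot_apply]
      rw [if_neg h3, if_neg (by omega : i + 1 ≠ s + 1)]
      simp

theorem eulerForm_simpleRoot_last (h : IsCoxeterWord m ((s + 1) :: w)) {β : Lat}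
    (hβ : BoundaryZero m β) :
    eulerForm m (wordProd (w ++ [s + 1])) (simpleRoot (s + 1)) β = β (s + 1) ∧
      eulerForm m (wordProd (w ++ [s + 1])) β (simpleRoot (s + 1)) =
        β (s + 1) - β s - β (s + 2) := by
  have h1 := h.head_mem
  have hα := boundaryZero_simpleRoot h1.1 h1.2
  constructor
  · unfold eulerForm
    rw [sum_range_eq_pair h1.2, (eulerTerm_last h hα hβ).1, (eulerTerm_last h hα hβ).2]
    · simp only [simpleRoot_apply]
      simp
    · intro i hi h2 h3
      unfold eulerTerm
      simp only [simpleRoot_apply]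
      rw [if_neg h3, if_neg (by omega : i + 1 ≠ s + 1)]
      simp
  · unfold eulerForm
    rw [sum_range_eq_pair h1.2, (eulerTerm_last h hβ hα).1, (eulerTerm_last h hβ hα).2]
    · simp only [simpleRoot_apply]
      simp
      ring
    · intro i hi h2 h3
      unfold eulerTerm
      simp only [simpleRoot_apply]
      rw [if_neg h3, if_neg (by omega : i + 1 ≠ s + 1)]
      simp

end rotate

/-- One half of the compatibility relation. -/
def HalfCompat (m : ℕ) (c : Module.End ℤ Lat) (α β : Lat) : Prop :=
  (∀ i, α = -simpleRoot i → β i ≤ 0) ∧ (α ∈ posRoots m → β ∈ posRoots m → 0 ≤ eulerForm m c α β)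

/-- The compatibility relation given by the Euler forms. -/
def EulerCompat (m : ℕ) (c : Module.End ℤ Lat) (α β : Lat) : Prop :=
  HalfCompat m c α β ∧ HalfCompat m c β α

theorem EulerCompat.comm {m : ℕ} {c : Module.End ℤ Lat} {α β : Lat} :
    EulerCompat m c α β ↔ EulerCompat m c β α := and_comm

theorem neg_notMem_posRoots (m i : ℕ) : -simpleRoot i ∉ posRoots m := by
  rintro ⟨a, b, -, -, -, h⟩
  exact rootSum_ne_neg _ _ _ h.symm

theorem eulerCompat_neg_neg (m : ℕ) (c : Module.End ℤ Lat) (i j : ℕ) :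
    EulerCompat m c (-simpleRoot i) (-simpleRoot j) := by
  have key : ∀ i j, HalfCompat m c (-simpleRoot i) (-simpleRoot j) := fun i j => by
    refine ⟨fun k _ => ?_, fun h => absurd h (neg_notMem_posRoots _ _)⟩
    simp only [Pi.neg_apply, simpleRoot_apply]
    split_ifs <;> simp
  exact ⟨key i j, key j i⟩

theorem posRoots_nonneg {m : ℕ} {α : Lat} (h : α ∈ posRoots m) (k : ℕ) : 0 ≤ α k := by
  obtain ⟨a, b, -, -, -, rfl⟩ := h
  rw [rootSum_apply]
  split_ifs <;> simp

theorem posRoots_ne_neg {m : ℕ} {α : Lat} (h : α ∈ posRoots m) (i : ℕ) : α ≠ -simpleRoot i := by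
  rintro rfl
  exact neg_notMem_posRoots _ _ h

theorem eulerCompat_neg_pos {m : ℕ} (c : Module.End ℤ Lat) (i : ℕ) {β : Lat}
    (hβ : β ∈ posRoots m) : EulerCompat m c (-simpleRoot i) β ↔ β i = 0 := by
  constructor
  · intro h
    exact le_antisymm (h.1.1 i rfl) (posRoots_nonneg hβ i)
  · intro h
    refine ⟨⟨fun k hk => ?_, fun h => absurd h (neg_notMem_posRoots _ _)⟩,
      ⟨fun k hk => absurd hk (posRoots_ne_neg hβ k),
        fun _ h => absurd h (neg_notMem_posRoots _ _)⟩⟩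
    rw [← neg_simpleRoot_inj hk, h]

theorem eulerCompat_pos_pos {m : ℕ} (c : Module.End ℤ Lat) {α β : Lat}
    (hα : α ∈ posRoots m) (hβ : β ∈ posRoots m) :
    EulerCompat m c α β ↔ 0 ≤ eulerForm m c α β ∧ 0 ≤ eulerForm m c β α := by
  constructor
  · intro h
    exact ⟨h.1.2 hα hβ, h.2.2 hβ hα⟩
  · intro h
    exact ⟨⟨fun k hk => absurd hk (posRoots_ne_neg hα k), fun _ _ => h.1⟩,
      ⟨fun k hk => absurd hk (posRoots_ne_neg hβ k), fun _ _ => h.2⟩⟩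

theorem simpleRoot_mem_posRoots {m s : ℕ} (h1 : 1 ≤ s) (h2 : s ≤ m) :
    simpleRoot s ∈ posRoots m := ⟨s, s, h1, le_rfl, h2, (rootSum_self s).symm⟩

/-- In the rotated form, the pairing of `γ = s_{s+1} β` with `α_{s+1}` equals `γ_{s+1} - γ_s -
γ_{s+2} = -β_{s+1}`. Its nonnegativity means `β_{s+1} = 0`, which is rule (I); the pairing in the
other order is `γ_{s+1} ≥ 0` and gives no condition. -/
theorem eulerCompat_rotate_neg {m s : ℕ} {w : List ℕ} (h : IsCoxeterWord m ((s + 1) :: w))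
    {β : Lat} (hβ : β ∈ almostPosRoots m) :
    EulerCompat m (wordProd ((s + 1) :: w)) (-simpleRoot (s + 1)) β ↔
      EulerCompat m (wordProd (w ++ [s + 1])) (simpleRoot (s + 1)) (sigma (s + 1) β) := by
  have h1 := h.head_mem
  have hs := simpleRoot_mem_posRoots h1.1 h1.2
  rcases hβ with hβ | ⟨j, hj, hjm, rfl⟩
  · rw [eulerCompat_neg_pos _ _ hβ]
    by_cases hβs : β = simpleRoot (s + 1)
    · rw [hβs, sigma_simpleRoot, EulerCompat.comm, eulerCompat_neg_pos _ _ hs]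
    · obtain ⟨hp, he, -⟩ := sigma_mem_posRoots h1.1 h1.2 hβ hβs
      rw [eulerCompat_pos_pos _ hs hp,
        (eulerForm_simpleRoot_last h (boundaryZero_of_mem hp)).1,
        (eulerForm_simpleRoot_last h (boundaryZero_of_mem hp)).2]
      have h2 := posRoots_nonneg hβ (s + 1)
      have h3 := posRoots_nonneg hp (s + 1)
      rw [he] at h3 ⊢
      have e1 : simpleRefl (s + 1) β (s + 1) = β s + β (s + 2) - β (s + 1) := by
        simp [simpleRefl_apply]
      have e2 : simpleRefl (s + 1) β s = β s := by simp [simpleRefl_apply]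
      have e3 : simpleRefl (s + 1) β (s + 2) = β (s + 2) := by simp [simpleRefl_apply]
      rw [e1] at h3
      rw [e1, e2, e3]
      omega
  · simp only [eulerCompat_neg_neg, true_iff]
    by_cases hjs : j = s + 1
    · subst hjs
      rw [sigma_neg_self, eulerCompat_pos_pos _ hs hs,
        (eulerForm_simpleRoot_last h (boundaryZero_of_mem hs)).1]
      simp [simpleRoot_apply]
    · rw [sigma_neg_of_ne hjs, EulerCompat.comm, eulerCompat_neg_pos _ _ hs]
      simp [simpleRoot_apply, hjs]

/-- Mirror image of the previous case: the pairing of `α_{s+1}` with `β` is minus the coordinate `s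
+ 1` of the reflected root. -/
theorem eulerCompat_rotate_simple {m s : ℕ} {w : List ℕ} (h : IsCoxeterWord m ((s + 1) :: w))
    {β : Lat} (hβ : β ∈ almostPosRoots m) :
    EulerCompat m (wordProd ((s + 1) :: w)) (simpleRoot (s + 1)) β ↔
      EulerCompat m (wordProd (w ++ [s + 1])) (-simpleRoot (s + 1)) (sigma (s + 1) β) := by
  have h1 := h.head_mem
  have hs := simpleRoot_mem_posRoots h1.1 h1.2
  rcases hβ with hβ | ⟨j, hj, hjm, rfl⟩
  · rw [eulerCompat_pos_pos _ hs hβ,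
        (eulerForm_simpleRoot_head h (boundaryZero_of_mem hβ)).1,
        (eulerForm_simpleRoot_head h (boundaryZero_of_mem hβ)).2]
    by_cases hβs : β = simpleRoot (s + 1)
    · rw [hβs, sigma_simpleRoot]
      simp only [eulerCompat_neg_neg, iff_true]
      simp [simpleRoot_apply]
    · obtain ⟨hp, he, -⟩ := sigma_mem_posRoots h1.1 h1.2 hβ hβs
      rw [eulerCompat_neg_pos _ _ hp]
      have h2 := posRoots_nonneg hβ (s + 1)
      have h3 := posRoots_nonneg hp (s + 1)
      rw [he] at h3 ⊢
      have e1 : simpleRefl (s + 1) β (s + 1) = β s + β (s + 2) - β (s + 1) := by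
        simp [simpleRefl_apply]
      rw [e1] at h3
      rw [e1]
      omega
  · rw [EulerCompat.comm, eulerCompat_neg_pos _ _ hs]
    by_cases hjs : j = s + 1
    · subst hjs
      rw [sigma_neg_self, eulerCompat_neg_pos _ _ hs]
    · rw [sigma_neg_of_ne hjs]
      simp only [eulerCompat_neg_neg, iff_true]
      simp [simpleRoot_apply, hjs]

theorem eulerCompat_rotate {m s : ℕ} {w : List ℕ} (h : IsCoxeterWord m ((s + 1) :: w))
    {α β : Lat} (hα : α ∈ almostPosRoots m) (hβ : β ∈ almostPosRoots m) :
    EulerCompat m (wordProd ((s + 1) :: w)) α β ↔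
      EulerCompat m (wordProd (w ++ [s + 1])) (sigma (s + 1) α) (sigma (s + 1) β) := by
  have h1 := h.head_mem
  by_cases h2 : α = -simpleRoot (s + 1)
  · rw [h2, sigma_neg_self]
    exact eulerCompat_rotate_neg h hβ
  by_cases h3 : α = simpleRoot (s + 1)
  · rw [h3, sigma_simpleRoot]
    exact eulerCompat_rotate_simple h hβ
  by_cases h4 : β = -simpleRoot (s + 1)
  · rw [h4, sigma_neg_self, EulerCompat.comm, EulerCompat.comm (α := sigma _ α)]
    exact eulerCompat_rotate_neg h hα
  by_cases h5 : β = simpleRoot (s + 1)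
  · rw [h5, sigma_simpleRoot, EulerCompat.comm, EulerCompat.comm (α := sigma _ α)]
    exact eulerCompat_rotate_simple h hα
  have key : ∀ j, j ≠ s + 1 → ∀ γ ∈ posRoots m, γ ≠ simpleRoot (s + 1) →
      (EulerCompat m (wordProd ((s + 1) :: w)) (-simpleRoot j) γ ↔
        EulerCompat m (wordProd (w ++ [s + 1])) (-simpleRoot j) (sigma (s + 1) γ)) := by
    intro j hj γ hγ hγs
    obtain ⟨hp, he, -⟩ := sigma_mem_posRoots h1.1 h1.2 hγ hγs
    rw [eulerCompat_neg_pos _ _ hγ, eulerCompat_neg_pos _ _ hp, he, simpleRefl_apply, if_neg hj]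
  rcases hα with hα | ⟨i, hi, him, rfl⟩ <;> rcases hβ with hβ | ⟨j, hj, hjm, rfl⟩
  · obtain ⟨hp, he, -⟩ := sigma_mem_posRoots h1.1 h1.2 hα h3
    obtain ⟨hp', he', -⟩ := sigma_mem_posRoots h1.1 h1.2 hβ h5
    rw [eulerCompat_pos_pos _ hα hβ, eulerCompat_pos_pos _ hp hp', he, he',
      eulerForm_rotate h (boundaryZero_of_mem hα) (boundaryZero_of_mem hβ),
      eulerForm_rotate h (boundaryZero_of_mem hβ) (boundaryZero_of_mem hα)]
  · have hjs : j ≠ s + 1 := fun e => h4 (by rw [e])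
    rw [sigma_neg_of_ne hjs, EulerCompat.comm, EulerCompat.comm (α := sigma _ α)]
    exact key j hjs α hα h3
  · have his : i ≠ s + 1 := fun e => h2 (by rw [e])
    rw [sigma_neg_of_ne his]
    exact key i his β hβ h5
  · have hjs : j ≠ s + 1 := fun e => h4 (by rw [e])
    have his : i ≠ s + 1 := fun e => h2 (by rw [e])
    rw [sigma_neg_of_ne hjs, sigma_neg_of_ne his]
    simp only [eulerCompat_neg_neg]

/-- Without an example of a family, `Compat` could hold vacuously for all pairs. This example
supplies the implication from compatible to noncrossing. -/
theorem isCompatFamily_eulerCompat (m : ℕ) : IsCompatFamily m (EulerCompat m) where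
  base _ _ i _ _ _ hα := eulerCompat_neg_pos _ i hα
  rotate s w h α hα β hβ := by
    obtain ⟨s, rfl⟩ : ∃ t, s = t + 1 := ⟨s - 1, by have := h.head_mem; omega⟩
    rw [wordProd_rotate (by omega)]
    exact eulerCompat_rotate h hα hβ

/-! ### The relation for the linear Coxeter element -/

/-- The diagonal `{a, b}`, `a < b`, of a polygon with vertices `0, …, m + 2`, as an almost
positive root of type `A_m`. -/
def diag (m a b : ℕ) : Lat := if b = m + 2 then -simpleRoot a else rootSum (a + 1) (b - 1)

/-- `a < b` are the vertices of a diagonal of a polygon with vertices `0, …, m + 2`. -/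
def IsDiag (m a b : ℕ) : Prop := a + 2 ≤ b ∧ b ≤ m + 2 ∧ (b = m + 2 → 1 ≤ a)

theorem diag_mem {m a b : ℕ} (h : IsDiag m a b) : diag m a b ∈ almostPosRoots m := by
  obtain ⟨h1, h2, h3⟩ := h
  unfold diag
  split_ifs with hb
  · rw [neg_mem]; omega
  · rw [rootSum_mem]; omega

theorem exists_diag {m : ℕ} {α : Lat} (h : α ∈ almostPosRoots m) :
    ∃ a b, IsDiag m a b ∧ α = diag m a b := by
  rcases h with ⟨i, j, hi, hij, hj, rfl⟩ | ⟨i, hi, him, rfl⟩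
  · refine ⟨i - 1, j + 1, ⟨by omega, by omega, by omega⟩, ?_⟩
    rw [diag, if_neg (by omega), Nat.sub_add_cancel hi, Nat.add_sub_cancel]
  · exact ⟨i, m + 2, ⟨by omega, le_rfl, fun _ => hi⟩, by rw [diag, if_pos rfl]⟩

theorem diag_inj {m a b c d : ℕ} (h : IsDiag m a b) (h' : IsDiag m c d)
    (e : diag m a b = diag m c d) : a = c ∧ b = d := by
  obtain ⟨h1, h2, h3⟩ := h
  obtain ⟨h1', h2', h3'⟩ := h'
  unfold diag at e
  split_ifs at e with hb hd hd
  · exact ⟨neg_simpleRoot_inj e, by omega⟩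
  · exact absurd e.symm (rootSum_ne_neg _ _ _)
  · exact absurd e (rootSum_ne_neg _ _ _)
  · have := rootSum_inj (by omega) (by omega) e
    omega

/-- Apply `σ_k`, then `σ_{k-1}`, …, and finally `σ_1`. -/
noncomputable def sigmaDown : ℕ → Lat → Lat
  | 0, α => α
  | k + 1, α => sigmaDown k (sigma (k + 1) α)

theorem sigmaDown_neg_of_lt {k j : ℕ} (h : k < j) :
    sigmaDown k (-simpleRoot j) = -simpleRoot j := by
  induction k with
  | zero => rfl
  | succ k ih => rw [sigmaDown, sigma_neg_of_ne (by omega), ih (by omega)]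

theorem sigmaDown_of_lt {k i j : ℕ} (hij : i ≤ j) (h : k + 1 < i) :
    sigmaDown k (rootSum i j) = rootSum i j := by
  induction k with
  | zero => rfl
  | succ k ih => rw [sigmaDown, sigma_rootSum_fixed hij (by omega), ih (by omega)]

theorem sigmaDown_inside {k i j : ℕ} (hi : 1 ≤ i) (hik : i ≤ k) (hkj : k < j) :
    sigmaDown k (rootSum i j) = rootSum (i + 1) j := by
  induction k with
  | zero => omega
  | succ k ih =>
    rw [sigmaDown]
    by_cases h : i = k + 1
    · subst h
      rw [sigma_rootSum_shrink_left hi hkj, sigmaDown_of_lt (by omega) (by omega)]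
    · rw [sigma_rootSum_fixed (by omega) (by omega), ih (by omega) (by omega)]

theorem sigmaDown_to_one {k j : ℕ} (h : k + 1 ≤ j) :
    sigmaDown k (rootSum (k + 1) j) = rootSum 1 j := by
  induction k with
  | zero => rfl
  | succ k ih => rw [sigmaDown, sigma_rootSum_grow_left (by omega) h, ih (by omega)]

theorem sigmaDown_end {k i : ℕ} (hi : 1 ≤ i) (h : i ≤ k) :
    sigmaDown k (rootSum i k) = -simpleRoot i := by
  induction k with
  | zero => omega
  | succ k ih =>
    rw [sigmaDown]
    by_cases h' : i = k + 1
    · rw [h', rootSum_self, sigma_simpleRoot, sigmaDown_neg_of_lt (by omega)]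
    · rw [sigma_rootSum_shrink_right (by omega), ih (by omega)]

theorem sigmaDown_neg {k i : ℕ} (hi : 1 ≤ i) (h : i ≤ k) :
    sigmaDown k (-simpleRoot i) = rootSum 1 i := by
  induction k with
  | zero => omega
  | succ k ih =>
    rw [sigmaDown]
    by_cases h' : i = k + 1
    · rw [h', sigma_neg_self, ← rootSum_self, sigmaDown_to_one (by omega)]
    · rw [sigma_neg_of_ne h', ih (by omega)]

/-- The reflections with large index do nothing, `σ_{j+1}` appends `α_{j+1}`, `σ_i` cuts off `α_i`,
and all others fix the root that has been reached. -/
theorem sigmaDown_shift {k i j : ℕ} (hi : 1 ≤ i) (hij : i ≤ j) (h : j < k) :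
    sigmaDown k (rootSum i j) = rootSum (i + 1) (j + 1) := by
  induction k with
  | zero => omega
  | succ k ih =>
    rw [sigmaDown]
    by_cases h' : j = k
    · rw [← h', sigma_rootSum_grow_right hij, sigmaDown_inside hi hij (by omega)]
    · rw [sigma_rootSum_fixed hij (by omega), ih (by omega)]

/-- The composite of all `σ_k` is the rotation of the polygon by one vertex; the vertex `m + 2` goes
to `0`. -/
theorem sigmaDown_diag {m a b : ℕ} (h : IsDiag m a b) :
    sigmaDown m (diag m a b) = if b = m + 2 then diag m 0 (a + 1) else diag m (a + 1) (b + 1) := by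
  obtain ⟨h1, h2, h3⟩ := h
  by_cases hb : b = m + 2
  · rw [if_pos hb, diag, if_pos hb, diag, if_neg (by omega), sigmaDown_neg (h3 hb) (by omega)]
    rfl
  · rw [if_neg hb, diag, if_neg hb, diag]
    split_ifs with hb'
    · obtain rfl : b - 1 = m := by omega
      rw [sigmaDown_end (by omega) (by omega)]
    · rw [sigmaDown_shift (by omega) (by omega) (by omega)]
      congr 1
      omega

/-- The letters `k, k - 1, …, 1`. -/
def downWord (k : ℕ) : List ℕ := (List.range k).map fun i => k - i

theorem downWord_succ (k : ℕ) : downWord (k + 1) = (k + 1) :: downWord k := by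
  simp [downWord, List.range_succ_eq_map, Function.comp_def]

theorem mem_downWord {k i : ℕ} : i ∈ downWord k ↔ 1 ≤ i ∧ i ≤ k := by
  induction k with
  | zero => simp [downWord]; omega
  | succ k ih => rw [downWord_succ, List.mem_cons, ih]; omega

theorem downWord_nodup (k : ℕ) : (downWord k).Nodup := by
  induction k with
  | zero => simp [downWord]
  | succ k ih =>
    rw [downWord_succ, List.nodup_cons, mem_downWord]
    exact ⟨by omega, ih⟩

/-- Rule (II) is used once per letter; `v` collects the letters that have been moved to the end.
After a full turn the word of `c` is back, so the relation for `c` is invariant under the rotation.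
-/
theorem compatFamily_sigmaDown {m : ℕ} {R : Module.End ℤ Lat → Lat → Lat → Prop}
    (hR : IsCompatFamily m R) (k : ℕ) (v : List ℕ) (h : IsCoxeterWord m (downWord k ++ v))
    {α β : Lat} (hα : α ∈ almostPosRoots m) (hβ : β ∈ almostPosRoots m) :
    R (wordProd (downWord k ++ v)) α β ↔
      R (wordProd (v ++ downWord k)) (sigmaDown k α) (sigmaDown k β) := by
  induction k generalizing v α β with
  | zero => simp [downWord, sigmaDown]
  | succ k ih =>
    rw [downWord_succ, List.cons_append] at h ⊢
    have h1 := h.head_mem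
    rw [hR.rotate _ _ h α hα β hβ, wordProd_rotate h1.1, List.append_assoc]
    have hr := h.rotate
    rw [List.append_assoc] at hr
    rw [ih _ hr (sigma_mem h1.1 h1.2 hα) (sigma_mem h1.1 h1.2 hβ), List.append_assoc,
      List.singleton_append]
    rfl

theorem compatFamily_rotation {m : ℕ} {R : Module.End ℤ Lat → Lat → Lat → Prop}
    (hR : IsCompatFamily m R) {α β : Lat} (hα : α ∈ almostPosRoots m)
    (hβ : β ∈ almostPosRoots m) :
    R (linearCoxeter m) α β ↔ R (linearCoxeter m) (sigmaDown m α) (sigmaDown m β) := by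
  have := compatFamily_sigmaDown hR m [] (by
    rw [List.append_nil]; exact ⟨downWord_nodup m, fun i => mem_downWord⟩) hα hβ
  simpa [linearCoxeter, downWord] using this

/-- The diagonals `{a, b}` and `{c, d}` (`a < b`, `c < d`) cross. -/
def Cross (a b c d : ℕ) : Prop := (a < c ∧ c < b ∧ b < d) ∨ (c < a ∧ a < d ∧ d < b)

/-! ### The rules determine the relation: compatible means noncrossing -/

section unique

variable {m : ℕ} {R : Module.End ℤ Lat → Lat → Lat → Prop}

theorem compatFamily_base (hR : IsCompatFamily m R) {a c d : ℕ} (h : IsDiag m a (m + 2))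
    (h' : IsDiag m c d) (hd : d ≠ m + 2) :
    R (linearCoxeter m) (diag m a (m + 2)) (diag m c d) ↔ ¬ Cross a (m + 2) c d := by
  obtain ⟨h1, h2, h3⟩ := h
  obtain ⟨h1', h2', h3'⟩ := h'
  have hpos : rootSum (c + 1) (d - 1) ∈ posRoots m :=
    ⟨_, _, by omega, by omega, by omega, rfl⟩
  rw [diag, if_pos rfl, diag, if_neg hd]
  have := hR.base _ ⟨downWord_nodup m, fun i => mem_downWord⟩ a (h3 rfl) (by omega) _ hpos
  rw [show linearCoxeter m = wordProd (downWord m) from rfl, this, rootSum_apply]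
  unfold Cross
  split_ifs with h <;> simp <;> omega

/-- Rotate `t` times until `b` has become the vertex `m + 2`, then use rule (I). As `b` is not an
end of the other diagonal, that one is a positive root by then. -/
theorem compatFamily_of_right (hR : IsCompatFamily m R) (t : ℕ) {a b c d : ℕ}
    (ht : b + t = m + 2) (h : IsDiag m a b) (h' : IsDiag m c d) (hbc : b ≠ c) (hbd : b ≠ d) :
    R (linearCoxeter m) (diag m a b) (diag m c d) ↔ ¬ Cross a b c d := by
  induction t generalizing a b c d with
  | zero =>
    obtain rfl : b = m + 2 := by omega
    exact compatFamily_base hR h h' (Ne.symm hbd)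
  | succ t ih =>
    rw [compatFamily_rotation hR (diag_mem h) (diag_mem h'), sigmaDown_diag h, sigmaDown_diag h',
      if_neg (by omega)]
    obtain ⟨h1, h2, h3⟩ := h
    obtain ⟨h1', h2', h3'⟩ := h'
    split_ifs with hd
    · rw [ih (by omega) ⟨by omega, by omega, by omega⟩ ⟨by omega, by omega, by omega⟩
        (by omega) (by omega)]
      unfold Cross
      omega
    · rw [ih (by omega) ⟨by omega, by omega, by omega⟩ ⟨by omega, by omega, by omega⟩
        (by omega) (by omega)]
      unfold Cross
      omega

/-- Once `b` has arrived at `m + 2`, one further rotation turns `{a, m + 2}` into `{0, a + 1}`. The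
other end has thereby become the larger one, and the previous lemma applies. -/
theorem compatFamily_of_left (hR : IsCompatFamily m R) (t : ℕ) {a b c d : ℕ}
    (ht : b + t = m + 2) (h : IsDiag m a b) (h' : IsDiag m c d) (hac : a ≠ c) (had : a ≠ d) :
    R (linearCoxeter m) (diag m a b) (diag m c d) ↔ ¬ Cross a b c d := by
  induction t generalizing a b c d with
  | zero =>
    obtain rfl : b = m + 2 := by omega
    rw [compatFamily_rotation hR (diag_mem h) (diag_mem h'), sigmaDown_diag h, sigmaDown_diag h',
      if_pos rfl]
    obtain ⟨h1, h2, h3⟩ := h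
    obtain ⟨h1', h2', h3'⟩ := h'
    have := h3 rfl
    split_ifs with hd
    · have := h3' hd
      rw [compatFamily_of_right hR (m + 2 - (a + 1)) (by omega) ⟨by omega, by omega, by omega⟩
        ⟨by omega, by omega, by omega⟩ (by omega) (by omega)]
      unfold Cross
      omega
    · rw [compatFamily_of_right hR (m + 2 - (a + 1)) (by omega) ⟨by omega, by omega, by omega⟩
        ⟨by omega, by omega, by omega⟩ (by omega) (by omega)]
      unfold Cross
      omega
  | succ t ih =>
    rw [compatFamily_rotation hR (diag_mem h) (diag_mem h'), sigmaDown_diag h, sigmaDown_diag h',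
      if_neg (by omega)]
    obtain ⟨h1, h2, h3⟩ := h
    obtain ⟨h1', h2', h3'⟩ := h'
    split_ifs with hd
    · rw [ih (by omega) ⟨by omega, by omega, by omega⟩ ⟨by omega, by omega, by omega⟩
        (by omega) (by omega)]
      unfold Cross
      omega
    · rw [ih (by omega) ⟨by omega, by omega, by omega⟩ ⟨by omega, by omega, by omega⟩
        (by omega) (by omega)]
      unfold Cross
      omega

/-- Two distinct diagonals share at most one vertex, so `b` or `a` is not an end of the second one.
-/
theorem compatFamily_iff (hR : IsCompatFamily m R) {a b c d : ℕ} (h : IsDiag m a b)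
    (h' : IsDiag m c d) (hne : ¬ (a = c ∧ b = d)) :
    R (linearCoxeter m) (diag m a b) (diag m c d) ↔ ¬ Cross a b c d := by
  have e : b + (m + 2 - b) = m + 2 := by have := h.2.1; omega
  have h1 := h.1
  have h2 := h'.1
  by_cases hb : b ≠ c ∧ b ≠ d
  · exact compatFamily_of_right hR _ e h h' hb.1 hb.2
  · exact compatFamily_of_left hR _ e h h' (by omega) (by omega)

end unique

/-- Existence of a family gives one direction, uniqueness on distinct pairs the other. -/
theorem compat_iff {m a b c d : ℕ} (h : IsDiag m a b) (h' : IsDiag m c d)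
    (hne : ¬ (a = c ∧ b = d)) : Compat m (diag m a b) (diag m c d) ↔ ¬ Cross a b c d :=
  ⟨fun hc => (compatFamily_iff (isCompatFamily_eulerCompat m) h h' hne).1
      (hc _ (isCompatFamily_eulerCompat m)),
    fun hc _ hR => (compatFamily_iff hR h h' hne).2 hc⟩

/-! ### Clusters as maximal sets of noncrossing roots -/

/-- `X` is a set of pairwise noncrossing almost positive roots. -/
structure Noncrossing (m : ℕ) (X : Set Lat) : Prop where
  sub : X ⊆ almostPosRoots m
  pos_pos : ∀ {i j k l}, rootSum i j ∈ X → rootSum k l ∈ X → i < k → k ≤ j + 1 → j < l → False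
  neg_pos : ∀ {u k l}, -simpleRoot u ∈ X → rootSum k l ∈ X → k ≤ u → u ≤ l → False

theorem Noncrossing.bounds {m : ℕ} {X : Set Lat} (h : Noncrossing m X) {i j : ℕ}
    (hij : rootSum i j ∈ X) : 1 ≤ i ∧ i ≤ j ∧ j ≤ m := rootSum_mem.1 (h.sub hij)

theorem Noncrossing.neg_bounds {m : ℕ} {X : Set Lat} (h : Noncrossing m X) {i : ℕ}
    (hi : -simpleRoot i ∈ X) : 1 ≤ i ∧ i ≤ m := neg_mem.1 (h.sub hi)

theorem diag_rootSum {m i j : ℕ} (hi : 1 ≤ i) (hj : j ≤ m) :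
    diag m (i - 1) (j + 1) = rootSum i j := by
  rw [diag, if_neg (by omega), Nat.sub_add_cancel hi, Nat.add_sub_cancel]

theorem diag_neg (m i : ℕ) : diag m i (m + 2) = -simpleRoot i := by
  rw [diag, if_pos rfl]

theorem noncrossing_iff {m : ℕ} {X : Set Lat} :
    Noncrossing m X ↔ X ⊆ almostPosRoots m ∧ X.Pairwise (Compat m) := by
  constructor
  · intro h
    refine ⟨h.sub, fun α hα β hβ hne => ?_⟩
    obtain ⟨a, b, hab, rfl⟩ := exists_diag (h.sub hα)
    obtain ⟨c, d, hcd, rfl⟩ := exists_diag (h.sub hβ)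
    rw [compat_iff hab hcd (fun e => hne (by rw [e.1, e.2]))]
    obtain ⟨h1, h2, h3⟩ := hab
    obtain ⟨h1', h2', h3'⟩ := hcd
    unfold diag at hα hβ
    intro hc
    unfold Cross at hc
    split_ifs at hα hβ with hb hd hd
    · omega
    · exact h.neg_pos hα hβ (by omega) (by omega)
    · exact h.neg_pos hβ hα (by omega) (by omega)
    · rcases hc with hc | hc
      · exact h.pos_pos hα hβ (by omega) (by omega) (by omega)
      · exact h.pos_pos hβ hα (by omega) (by omega) (by omega)
  · rintro ⟨hsub, hX⟩
    refine ⟨hsub, fun {i j k l} h1 h2 h3 h4 h5 => ?_, fun {u k l} h1 h2 h3 h4 => ?_⟩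
    · have b1 := rootSum_mem.1 (hsub h1)
      have b2 := rootSum_mem.1 (hsub h2)
      have hc := hX h1 h2 (fun e => by have := rootSum_inj b1.2.1 b2.2.1 e; omega)
      rw [← diag_rootSum b1.1 b1.2.2, ← diag_rootSum b2.1 b2.2.2,
        compat_iff ⟨by omega, by omega, by omega⟩ ⟨by omega, by omega, by omega⟩ (by omega)] at hc
      exact hc (by unfold Cross; omega)
    · have b1 := neg_mem.1 (hsub h1)
      have b2 := rootSum_mem.1 (hsub h2)
      have hc := hX h1 h2 (rootSum_ne_neg _ _ _).symm
      rw [← diag_neg m, ← diag_rootSum b2.1 b2.2.2,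
        compat_iff ⟨by omega, by omega, by omega⟩ ⟨by omega, by omega, by omega⟩ (by omega)] at hc
      exact hc (by unfold Cross; omega)

theorem isCluster_iff_maximal {m : ℕ} {X : Set Lat} :
    IsCluster m X ↔ Maximal (Noncrossing m) X := by
  have : Noncrossing m = fun Z : Set Lat => Z ⊆ almostPosRoots m ∧ Z.Pairwise (Compat m) := by
    ext Z
    exact noncrossing_iff
  rw [IsCluster, this]

/-! ### Triangulations of the polygon have `m` diagonals -/

theorem almostPosRoots_finite (m : ℕ) : (almostPosRoots m).Finite := by
  refine ((((Finset.range (m + 3)) ×ˢ (Finset.range (m + 3))).finite_toSet).image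
    fun p => diag m p.1 p.2).subset fun α hα => ?_
  obtain ⟨a, b, ⟨h1, h2, -⟩, rfl⟩ := exists_diag hα
  refine ⟨(a, b), ?_, rfl⟩
  simp only [Finset.coe_product, Set.mem_prod, Finset.mem_coe, Finset.mem_range]
  omega

theorem Noncrossing.finite {m : ℕ} {X : Set Lat} (h : Noncrossing m X) : X.Finite :=
  (almostPosRoots_finite m).subset h.sub

theorem Noncrossing.exists_cluster {m : ℕ} {X : Set Lat} (h : Noncrossing m X) :
    ∃ Z, X ⊆ Z ∧ IsCluster m Z := by
  have hfin : {Z : Set Lat | Noncrossing m Z}.Finite :=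
    (almostPosRoots_finite m).finite_subsets.subset fun Z hZ => hZ.sub
  obtain ⟨Z, hXZ, hZ⟩ := hfin.exists_le_maximal h
  exact ⟨Z, hXZ, isCluster_iff_maximal.2 hZ⟩

theorem exists_greatest {P : ℕ → Prop} {n : ℕ} (hb : ∀ c, P c → c ≤ n) (h : ∃ c, P c) :
    ∃ c, P c ∧ ∀ c', P c' → c' ≤ c := by
  classical
  obtain ⟨c, hc⟩ := h
  exact ⟨Nat.findGreatest P n, Nat.findGreatest_spec (hb c hc) hc,
    fun c' hc' => Nat.le_findGreatest (hb c' hc') hc'⟩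

/-- `{a, b}` with `a < b` is a side of the polygon with vertices `0, …, m + 2` or one of the
diagonals in `X`. -/
def IsEdge (m : ℕ) (X : Set Lat) (a b : ℕ) : Prop :=
  a < b ∧ b ≤ m + 2 ∧ (b = a + 1 ∨ (a = 0 ∧ b = m + 2) ∨ (IsDiag m a b ∧ diag m a b ∈ X))

theorem IsEdge.not_cross {m : ℕ} {X : Set Lat} (hX : Noncrossing m X) {a b c d : ℕ}
    (h : IsEdge m X a b) (h' : IsEdge m X c d) : ¬ (a < c ∧ c < b ∧ b < d) := by
  rintro ⟨h1, h2, h3⟩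
  obtain ⟨e1, e2, e3⟩ := h
  obtain ⟨f1, f2, f3⟩ := h'
  rcases e3 with e3 | e3 | ⟨e3, e4⟩
  · omega
  · omega
  rcases f3 with f3 | f3 | ⟨f3, f4⟩
  · omega
  · omega
  have := (noncrossing_iff.1 hX).2 e4 f4
    (fun e => by have := diag_inj e3 f3 e; omega)
  rw [compat_iff e3 f3 (by omega)] at this
  exact this (Or.inl ⟨h1, h2, h3⟩)

theorem isEdge_of_forall_not_cross {m : ℕ} {X : Set Lat} (hX : IsCluster m X) {a b : ℕ}
    (h : IsDiag m a b) (hc : ∀ c d, IsEdge m X c d → ¬ Cross a b c d) : IsEdge m X a b := by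
  rw [isCluster_iff_maximal] at hX
  obtain ⟨h1, h2, h3⟩ := h
  refine ⟨by omega, h2, Or.inr (Or.inr ⟨⟨h1, h2, h3⟩, ?_⟩)⟩
  have key : Noncrossing m (insert (diag m a b) X) := by
    rw [noncrossing_iff, Set.pairwise_insert]
    have hN := noncrossing_iff.1 hX.prop
    refine ⟨Set.insert_subset (diag_mem ⟨h1, h2, h3⟩) hN.1, hN.2, fun β hβ hne => ?_⟩
    obtain ⟨c, d, hcd, rfl⟩ := exists_diag (hN.1 hβ)
    have hE : IsEdge m X c d := by
      obtain ⟨g1, g2, g3⟩ := hcd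
      exact ⟨by omega, g2, Or.inr (Or.inr ⟨⟨g1, g2, g3⟩, hβ⟩)⟩
    have h4 := hc c d hE
    have hne' : ¬ (a = c ∧ b = d) := fun e => hne (by rw [e.1, e.2])
    rw [compat_iff ⟨h1, h2, h3⟩ hcd hne', compat_iff hcd ⟨h1, h2, h3⟩ (by omega)]
    unfold Cross at h4 ⊢
    omega
  exact hX.le_of_ge key (Set.subset_insert _ _) (Set.mem_insert _ _)

/-- The third vertex of the triangle on `{a, b}` is the farthest neighbour `c` of `a` before `b`. If
`{c, b}` were no edge, let `d` be the farthest neighbour of `c` up to `b`: then `{a, d}` crosses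
nothing, so it is an edge by maximality, against the choice of `c`. -/
theorem IsEdge.exists_apex {m : ℕ} {X : Set Lat} (hX : IsCluster m X) {a b : ℕ}
    (h : IsEdge m X a b) (hab : a + 2 ≤ b) :
    ∃ c, a < c ∧ c < b ∧ IsEdge m X a c ∧ IsEdge m X c b := by
  have hN := (isCluster_iff_maximal.1 hX).prop
  have hb := h.2.1
  have side : ∀ k, k + 1 ≤ m + 2 → IsEdge m X k (k + 1) :=
    fun k hk => ⟨by omega, hk, Or.inl rfl⟩
  obtain ⟨c, ⟨hcb, hac⟩, hmax⟩ := exists_greatest (P := fun c => c < b ∧ IsEdge m X a c) (n := b)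
    (fun c hc => hc.1.le) ⟨a + 1, by omega, side a (by omega)⟩
  refine ⟨c, hac.1, hcb, hac, ?_⟩
  by_cases hcb' : b = c + 1
  · rw [hcb']
    exact side c (by omega)
  obtain ⟨d, ⟨hdb, hcd⟩, hmax'⟩ := exists_greatest (P := fun d => d ≤ b ∧ IsEdge m X c d) (n := b)
    (fun c hc => hc.1) ⟨c + 1, by omega, side c (by omega)⟩
  by_cases hd : d = b
  · rwa [hd] at hcd
  exfalso
  have hac1 := hac.1
  have hcd1 := hcd.1
  have hnad : ¬ IsEdge m X a d := fun h' => by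
    have := hmax d ⟨by omega, h'⟩
    omega
  apply hnad
  apply isEdge_of_forall_not_cross hX ⟨by omega, by omega, by omega⟩
  intro p q hpq hcross
  have n1 := hpq.not_cross hN h
  have n2 := h.not_cross hN hpq
  have n3 := hpq.not_cross hN hac
  have n4 := hac.not_cross hN hpq
  have n5 := hpq.not_cross hN hcd
  have n6 := hcd.not_cross hN hpq
  have h1 := hpq.1
  unfold Cross at hcross
  -- An edge across `{a, d}` that avoids `{a, b}`, `{a, c}` and `{c, d}` must start at `c` and end
  -- beyond `d`, but not beyond `b`.
  have hpc : p = c := by omega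
  subst hpc
  have := hmax' q ⟨by omega, hpq⟩
  omega

/-- The edges between the vertices `a, …, b`, except for the sides of the polygon. -/
def edgesWithin (m : ℕ) (X : Set Lat) (a b : ℕ) : Set (ℕ × ℕ) :=
  {p | a ≤ p.1 ∧ p.2 ≤ b ∧ p.1 + 2 ≤ p.2 ∧ IsEdge m X p.1 p.2}

theorem edgesWithin_finite (m : ℕ) (X : Set Lat) (a b : ℕ) : (edgesWithin m X a b).Finite := by
  refine ((Finset.range (b + 1) ×ˢ Finset.range (b + 1)).finite_toSet).subset ?_
  rintro ⟨p, q⟩ ⟨h1, h2, h3, -⟩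
  simp only [Finset.coe_product, Set.mem_prod, Finset.mem_coe, Finset.mem_range] at *
  omega

/-- The triangle on `{a, b}` divides the remaining edges into those on either side of its apex. The
edge `{a, b}` itself is counted, so that the numbers add up. -/
theorem ncard_edgesWithin {m : ℕ} {X : Set Lat} (hX : IsCluster m X) (t : ℕ) {a b : ℕ}
    (ht : b ≤ a + t) (h : IsEdge m X a b) : (edgesWithin m X a b).ncard = b - a - 1 := by
  induction t generalizing a b with
  | zero => have := h.1; omega
  | succ t ih =>
    have h1 := h.1
    by_cases hab : b = a + 1
    · have : edgesWithin m X a b = ∅ := by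
        ext ⟨p, q⟩
        simp only [edgesWithin, Set.mem_ofPred_eq, Set.mem_empty_iff_false, iff_false]
        omega
      rw [this, Set.ncard_empty]
      omega
    · have hN := (isCluster_iff_maximal.1 hX).prop
      obtain ⟨c, hac, hcb, hE1, hE2⟩ := h.exists_apex hX (by omega)
      have hsplit : edgesWithin m X a b =
          insert (a, b) (edgesWithin m X a c ∪ edgesWithin m X c b) := by
        ext ⟨p, q⟩
        simp only [edgesWithin, Set.mem_ofPred_eq, Set.mem_insert_iff, Set.mem_union, Prod.mk.injEq]
        constructor
        · rintro ⟨g1, g2, g3, g4⟩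
          have n1 := g4.not_cross hN hE1
          have n2 := hE1.not_cross hN g4
          have n3 := g4.not_cross hN hE2
          have n4 := hE2.not_cross hN g4
          simp only [g3, g4, and_true]
          omega
        · rintro (⟨rfl, rfl⟩ | ⟨g1, g2, g3, g4⟩ | ⟨g1, g2, g3, g4⟩)
          · exact ⟨le_rfl, le_rfl, by omega, h⟩
          · exact ⟨g1, by omega, g3, g4⟩
          · exact ⟨by omega, g2, g3, g4⟩
      rw [hsplit, Set.ncard_insert_of_notMem _
        ((edgesWithin_finite m X a c).union (edgesWithin_finite m X c b)),
        Set.ncard_union_eq _ (edgesWithin_finite m X a c) (edgesWithin_finite m X c b),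
        ih (by omega) hE1, ih (by omega) hE2]
      · omega
      · rw [Set.disjoint_left]
        rintro ⟨p, q⟩ ⟨g1, g2, g3, g4⟩ ⟨f1, f2, f3, f4⟩
        simp only at *
        omega
      · rintro (⟨g1, g2, g3, g4⟩ | ⟨g1, g2, g3, g4⟩) <;> simp only at * <;> omega

theorem IsCluster.ncard {m : ℕ} {X : Set Lat} (hX : IsCluster m X) : X.ncard = m := by
  have hN := (isCluster_iff_maximal.1 hX).prop
  have h0 : IsEdge m X 0 (m + 2) := ⟨by omega, le_rfl, Or.inr (Or.inl ⟨rfl, rfl⟩)⟩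
  have key : X = (fun p : ℕ × ℕ => diag m p.1 p.2) '' (edgesWithin m X 0 (m + 2) \ {(0, m + 2)}) := by
    ext α
    constructor
    · intro hα
      obtain ⟨a, b, hab, rfl⟩ := exists_diag (hN.sub hα)
      refine ⟨(a, b), ⟨⟨by omega, hab.2.1, hab.1, ?_⟩, ?_⟩, rfl⟩
      · exact ⟨by have := hab.1; simp only; omega, hab.2.1, Or.inr (Or.inr ⟨hab, hα⟩)⟩
      · simp only [Set.mem_singleton_iff, Prod.mk.injEq]
        have := hab.2.2
        omega
    · rintro ⟨⟨a, b⟩, ⟨⟨h1, h2, h3, h4⟩, h5⟩, rfl⟩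
      simp only [Set.mem_singleton_iff, Prod.mk.injEq] at *
      obtain ⟨-, -, h6 | h6 | h6⟩ := h4
      · omega
      · omega
      · exact h6.2
  rw [key, Set.InjOn.ncard_image, Set.ncard_sdiff_singleton_of_mem,
    ncard_edgesWithin hX (m + 2) (by omega) h0]
  · omega
  · exact ⟨le_rfl, le_rfl, by simp, h0⟩
  · have hdiag : ∀ p ∈ edgesWithin m X 0 (m + 2) \ {(0, m + 2)}, IsDiag m p.1 p.2 := by
      rintro ⟨a, b⟩ ⟨⟨h1, h2, h3, h4⟩, h5⟩
      simp only [Set.mem_singleton_iff, Prod.mk.injEq] at *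
      exact ⟨h3, h2, by omega⟩
    intro p hp q hq e
    have := diag_inj (hdiag p hp) (hdiag q hq) e
    exact Prod.ext this.1 this.2

theorem Noncrossing.ncard_le {m : ℕ} {X : Set Lat} (h : Noncrossing m X) : X.ncard ≤ m := by
  obtain ⟨Z, hXZ, hZ⟩ := h.exists_cluster
  rw [← hZ.ncard]
  exact Set.ncard_le_ncard hXZ (isCluster_iff_maximal.1 hZ).prop.finite

theorem IsCluster.noncrossing {m : ℕ} {X : Set Lat} (h : IsCluster m X) : Noncrossing m X :=
  (isCluster_iff_maximal.1 h).prop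

/-- All clusters have the same size, so a noncrossing set of full size cannot be enlarged. This
replaces every direct check of maximality below. -/
theorem Noncrossing.isCluster {m : ℕ} {X : Set Lat} (h : Noncrossing m X) (hc : m ≤ X.ncard) :
    IsCluster m X := by
  obtain ⟨Z, hXZ, hZ⟩ := h.exists_cluster
  rwa [Set.eq_of_subset_of_ncard_le hXZ (by rw [hZ.ncard]; exact hc) hZ.noncrossing.finite]

theorem IsCluster.eq_of_subset {m : ℕ} {X Z : Set Lat} (hX : IsCluster m X)
    (hZ : IsCluster m Z) (h : X ⊆ Z) : X = Z :=
  Set.eq_of_subset_of_ncard_le h (by rw [hX.ncard, hZ.ncard]) hZ.noncrossing.finite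

/-- A root that crosses no element of a cluster belongs to it; the negative case. -/
theorem IsCluster.neg_mem_of_forall {m : ℕ} {X : Set Lat} (hX : IsCluster m X) {u : ℕ}
    (h1 : 1 ≤ u) (h2 : u ≤ m) (h : ∀ k l, rootSum k l ∈ X → k ≤ u → u ≤ l → False) :
    -simpleRoot u ∈ X := by
  have hN := hX.noncrossing
  refine (isCluster_iff_maximal.1 hX).le_of_ge (y := insert (-simpleRoot u) X)
    ⟨Set.insert_subset (neg_mem.2 ⟨h1, h2⟩) hN.sub, ?_, ?_⟩
    (Set.subset_insert _ _) (Set.mem_insert _ _)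
  · rintro i j k l (h3 | h3) (h4 | h4)
    · exact absurd h3 (rootSum_ne_neg _ _ _)
    · exact absurd h3 (rootSum_ne_neg _ _ _)
    · exact absurd h4 (rootSum_ne_neg _ _ _)
    · exact hN.pos_pos h3 h4
  · rintro v k l (h3 | h3) (h4 | h4)
    · exact absurd h4 (rootSum_ne_neg _ _ _)
    · obtain rfl := neg_simpleRoot_inj h3
      exact h k l h4
    · exact absurd h4 (rootSum_ne_neg _ _ _)
    · exact hN.neg_pos h3 h4

/-! ### The edge maps on tagged clusters -/

theorem Noncrossing.of_bounds {m : ℕ} {X : Set Lat} (hsub : X ⊆ almostPosRoots m)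
    (pp : ∀ i j k l, 1 ≤ i → i ≤ j → j ≤ m → 1 ≤ k → k ≤ l → l ≤ m →
      rootSum i j ∈ X → rootSum k l ∈ X → i < k → k ≤ j + 1 → j < l → False)
    (np : ∀ u k l, 1 ≤ u → u ≤ m → 1 ≤ k → k ≤ l → l ≤ m →
      -simpleRoot u ∈ X → rootSum k l ∈ X → k ≤ u → u ≤ l → False) : Noncrossing m X := by
  refine ⟨hsub, fun {i j k l} h1 h2 => ?_, fun {u k l} h1 h2 => ?_⟩
  · have b1 := rootSum_mem.1 (hsub h1)
    have b2 := rootSum_mem.1 (hsub h2)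
    exact pp i j k l b1.1 b1.2.1 b1.2.2 b2.1 b2.2.1 b2.2.2 h1 h2
  · have b1 := neg_mem.1 (hsub h1)
    have b2 := rootSum_mem.1 (hsub h2)
    exact np u k l b1.1 b1.2 b2.1 b2.2.1 b2.2.2 h1 h2

theorem almostPosRoots_mono {m n : ℕ} (h : m ≤ n) : almostPosRoots m ⊆ almostPosRoots n := by
  rintro α (⟨i, j, h1, h2, h3, rfl⟩ | ⟨i, h1, h2, rfl⟩)
  · exact rootSum_mem.2 ⟨h1, h2, h3.trans h⟩
  · exact neg_mem.2 ⟨h1, h2.trans h⟩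

theorem IsTaggedCluster.noncrossing {m : ℕ} {C : TaggedSet} (h : IsTaggedCluster m C) :
    Noncrossing m C.roots := h.1.noncrossing

theorem IsTaggedCluster.exists_of_tagged {m : ℕ} {C : TaggedSet} (h : IsTaggedCluster m C)
    {α : Lat} (hα : α ∈ C.tagged) :
    ∃ i, 1 ≤ i ∧ i ≤ m ∧ α = -simpleRoot i ∧ -simpleRoot i ∈ C.roots := by
  obtain ⟨h1, i, h2, h3, rfl⟩ := h.2 hα
  exact ⟨i, h2, h3, rfl, h1⟩

theorem layerRank_odd (r : ℕ) : layerRank (2 * r + 1) = r := by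
  rw [layerRank, if_pos ⟨r, rfl⟩]; omega

theorem not_odd_even (r : ℕ) : ¬ Odd (2 * r + 2) := by
  rw [Nat.not_odd_iff_even]; exact ⟨r + 1, by omega⟩

theorem layerRank_even (r : ℕ) : layerRank (2 * r + 2) = r := by
  rw [layerRank, if_neg (not_odd_even r)]; omega

theorem phiPlus_even (r : ℕ) (C : TaggedSet) [Decidable C.globalTag] :
    phiPlus (2 * r + 2) C = ⟨insert (-simpleRoot (r + 1)) C.roots,
      if C.globalTag then insert (-simpleRoot (r + 1)) C.tagged else C.tagged, False⟩ := by
  rw [phiPlus, if_neg (not_odd_even r), if_neg (by omega), show (2 * r + 2) / 2 = r + 1 by omega]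
  congr

theorem lowerEnd_spec (S : Set Lat) {i : ℕ} (hi : 1 ≤ i) :
    1 ≤ lowerEnd S i ∧ lowerEnd S i ≤ i ∧
      (lowerEnd S i = 1 ∨ (2 ≤ lowerEnd S i ∧ -simpleRoot (lowerEnd S i - 1) ∈ S)) ∧
      ∀ j, 1 ≤ j → j < i → -simpleRoot j ∈ S → j < lowerEnd S i := by
  set T := {j | 1 ≤ j ∧ j < i ∧ -simpleRoot j ∈ S} with hT
  have hb : BddAbove T := ⟨i, fun j hj => hj.2.1.le⟩
  have e : lowerEnd S i = sSup T + 1 := rfl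
  rw [e, Nat.add_sub_cancel]
  refine ⟨by omega, ?_, ?_, fun j h1 h2 h3 => Nat.lt_succ_of_le (le_csSup hb ⟨h1, h2, h3⟩)⟩
  · rcases T.eq_empty_or_nonempty with h | h
    · rw [h]; simpa using hi
    · exact (Nat.sSup_mem h hb).2.1
  · rcases T.eq_empty_or_nonempty with h | h
    · left; rw [h]; simp
    · right
      have := Nat.sSup_mem h hb
      exact ⟨by have := this.1; omega, this.2.2⟩

theorem lowerEnd_eq {S : Set Lat} {i L : ℕ} (h1 : 1 ≤ L) (h2 : L ≤ i)
    (h3 : 2 ≤ L → -simpleRoot (L - 1) ∈ S)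
    (h4 : ∀ j, 1 ≤ j → j < i → -simpleRoot j ∈ S → j < L) : lowerEnd S i = L := by
  obtain ⟨g1, g2, g3, g4⟩ := lowerEnd_spec S (h1.trans h2)
  apply le_antisymm
  · rcases g3 with g3 | ⟨g3, g5⟩
    · omega
    · have := h4 _ (by omega) (by omega) g5
      omega
  · by_cases hL : 2 ≤ L
    · have := g4 (L - 1) (by omega) (by omega) (h3 hL)
      omega
    · omega

/-- The map `φ_c^-` on even layers affects the roots `-α_i` with `i ≥ k`. -/
def IsMinusIndex (r : ℕ) (C : TaggedSet) (k : ℕ) : Prop :=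
  (C.globalTag ∧ k = r + 1) ∨
    (¬ C.globalTag ∧ -simpleRoot k ∈ C.tagged ∧ ∀ t, -simpleRoot t ∈ C.tagged → t ≤ k)

theorem exists_isMinusIndex {r : ℕ} {C : TaggedSet} (hC : IsTaggedCluster r C)
    (h : C.globalTag ∨ C.tagged.Nonempty) : ∃ k, IsMinusIndex r C k := by
  by_cases hg : C.globalTag
  · exact ⟨r + 1, Or.inl ⟨hg, rfl⟩⟩
  · obtain ⟨α, hα⟩ := h.resolve_left hg
    obtain ⟨i, -, -, rfl, -⟩ := hC.exists_of_tagged hα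
    obtain ⟨k, hk, hmax⟩ := exists_greatest (P := fun k => -simpleRoot k ∈ C.tagged) (n := r)
      (fun c hc => by
        obtain ⟨i, -, h2, h3, -⟩ := hC.exists_of_tagged hc
        rwa [neg_simpleRoot_inj h3]) ⟨i, hα⟩
    exact ⟨k, Or.inr ⟨hg, hk, hmax⟩⟩

/-- The value of `φ_c^-` on the even layer of rank `r` if the roots `-α_i` with `i ≥ k` are
affected. -/
noncomputable def minusLift (r k : ℕ) (C : TaggedSet) : TaggedSet :=
  ⟨{α | α ∈ C.roots ∧ ¬ ∃ i, k ≤ i ∧ α = -simpleRoot i} ∪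
      {α | ∃ i, k ≤ i ∧ -simpleRoot i ∈ C.roots ∧ α = rootSum (i + 1) (r + 1)} ∪
      {rootSum (lowerEnd C.roots k) (r + 1)},
    C.tagged \ {-simpleRoot k}, False⟩

/-- The two cases of `φ_c^-` are one construction: a global tag acts like a tag at `k = r + 1`. No
`-α_i` with `i ≥ r + 1` occurs in type `A_r`, so then nothing is replaced and only the root
`[L(r+1), r+1]` is added. -/
theorem phiMinus_even {r k : ℕ} {C : TaggedSet} (hC : IsTaggedCluster r C)
    (hk : IsMinusIndex r C k) : phiMinus (2 * r + 2) C = minusLift r k C := by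
  have hN := hC.noncrossing
  unfold phiMinus
  simp only [layerRank_even]
  rw [if_neg (not_odd_even r)]
  rcases hk with ⟨hg, rfl⟩ | ⟨hg, hk, hmax⟩
  · rw [if_pos hg, minusLift]
    have hne : ∀ i, r + 1 ≤ i → -simpleRoot i ∉ C.roots := fun i hi h => by
      have := hN.neg_bounds h
      omega
    congr 1
    · ext α
      simp only [Set.mem_insert_iff, Set.mem_union, Set.mem_ofPred_eq, Set.mem_singleton_iff]
      constructor
      · rintro (h | h)
        · exact Or.inr h
        · refine Or.inl (Or.inl ⟨h, ?_⟩)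
          rintro ⟨i, hi, rfl⟩
          exact hne i hi h
      · rintro ((h | ⟨i, hi, h, -⟩) | h)
        · exact Or.inr h.1
        · exact absurd h (hne i hi)
        · exact Or.inl h
    · rw [Set.sdiff_singleton_eq_self]
      intro h
      exact hne (r + 1) le_rfl (hC.2 h).1
  · rw [if_neg hg, minusLift]
    obtain ⟨k', hk1, -, e, -⟩ := hC.exists_of_tagged hk
    have := neg_simpleRoot_inj e
    have hmk : maxTag C = k := by
      apply le_antisymm
      · exact csSup_le ⟨k, by omega, hk⟩ fun t ht => hmax t ht.2
      · exact le_csSup ⟨k, fun t ht => hmax t ht.2⟩ ⟨by omega, hk⟩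
    rw [hmk]

/-- The last two alternatives cover empty sums, for which endpoints cannot be compared. Both are
impossible once `C` is a tagged cluster and `k` is its minus index. -/
theorem mem_minusLift_rootSum {r k i j : ℕ} {C : TaggedSet} (hij : i ≤ j) :
    rootSum i j ∈ (minusLift r k C).roots → rootSum i j ∈ C.roots ∨
      (j = r + 1 ∧ (i = lowerEnd C.roots k ∨ (k + 1 ≤ i ∧ -simpleRoot (i - 1) ∈ C.roots))) ∨
        r + 1 < lowerEnd C.roots k ∨ ∃ u, r + 1 ≤ u ∧ -simpleRoot u ∈ C.roots := by
  rintro ((h | ⟨u, hu, h, e⟩) | e)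
  · exact Or.inl h.1
  · right
    by_cases hur : u ≤ r
    · left
      obtain ⟨rfl, rfl⟩ := rootSum_inj hij (by omega) e
      exact ⟨rfl, Or.inr ⟨by omega, h⟩⟩
    · exact Or.inr (Or.inr ⟨u, by omega, h⟩)
  · right
    by_cases hL : lowerEnd C.roots k ≤ r + 1
    · left
      obtain ⟨rfl, rfl⟩ := rootSum_inj hij hL e
      exact ⟨rfl, Or.inl rfl⟩
    · exact Or.inr (Or.inl (by omega))

theorem mem_minusLift_neg {r k u : ℕ} {C : TaggedSet} :
    -simpleRoot u ∈ (minusLift r k C).roots ↔ -simpleRoot u ∈ C.roots ∧ u < k := by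
  constructor
  · rintro ((h | ⟨v, hv, h, e⟩) | e)
    · refine ⟨h.1, ?_⟩
      by_contra hu
      exact h.2 ⟨u, by omega, rfl⟩
    · exact absurd e.symm (rootSum_ne_neg _ _ _)
    · exact absurd e.symm (rootSum_ne_neg _ _ _)
  · rintro ⟨h1, h2⟩
    refine Or.inl (Or.inl ⟨h1, ?_⟩)
    rintro ⟨i, hi, e⟩
    have := neg_simpleRoot_inj e
    omega

/-! ### Both edge maps on even layers produce tagged clusters -/

section minus

variable {r k : ℕ} {C : TaggedSet}

theorem IsMinusIndex.bounds (hC : IsTaggedCluster r C) (hk : IsMinusIndex r C k) :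
    1 ≤ k ∧ k ≤ r + 1 := by
  rcases hk with ⟨-, rfl⟩ | ⟨-, hk, -⟩
  · omega
  · obtain ⟨k', h1, h2, e, -⟩ := hC.exists_of_tagged hk
    have := neg_simpleRoot_inj e
    omega

theorem rootSum_mem_minusLift (hC : IsTaggedCluster r C) (hk : IsMinusIndex r C k) {i j : ℕ}
    (hij : i ≤ j) :
    rootSum i j ∈ (minusLift r k C).roots ↔ rootSum i j ∈ C.roots ∨
      (j = r + 1 ∧ (i = lowerEnd C.roots k ∨ (k + 1 ≤ i ∧ -simpleRoot (i - 1) ∈ C.roots))) := by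
  have hb := hk.bounds hC
  have hL := lowerEnd_spec C.roots hb.1
  constructor
  · intro h
    rcases mem_minusLift_rootSum hij h with h | h | h | ⟨u, hu, h⟩
    · exact Or.inl h
    · exact Or.inr h
    · omega
    · have := hC.noncrossing.neg_bounds h
      omega
  · rintro (h | ⟨rfl, rfl | ⟨h1, h2⟩⟩)
    · refine Or.inl (Or.inl ⟨h, ?_⟩)
      rintro ⟨u, -, e⟩
      exact rootSum_ne_neg _ _ _ e
    · exact Or.inr rfl
    · exact Or.inl (Or.inr ⟨i - 1, by omega, h2, by rw [Nat.sub_add_cancel (by omega)]⟩)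

theorem minusLift_subset (hC : IsTaggedCluster r C) (hk : IsMinusIndex r C k) :
    (minusLift r k C).roots ⊆ almostPosRoots (r + 1) := by
  have hb := hk.bounds hC
  have hL := lowerEnd_spec C.roots hb.1
  rintro α ((h | ⟨v, hv, h, rfl⟩) | rfl)
  · exact almostPosRoots_mono (by omega) (hC.noncrossing.sub h.1)
  · have := hC.noncrossing.neg_bounds h
    exact rootSum_mem.2 ⟨by omega, by omega, le_rfl⟩
  · exact rootSum_mem.2 ⟨by omega, by omega, le_rfl⟩

/-- Geometrically the top vertex is split in two and its fan is distributed at `k`. A root of `C`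
that crosses a new root `[i, r+1]` also crosses `-α_{i-1}`, which lies in `C` (if `i = 1`, no
crossing is possible). -/
theorem minusLift_noncrossing (hC : IsTaggedCluster r C) (hk : IsMinusIndex r C k) :
    Noncrossing (r + 1) (minusLift r k C).roots := by
  have hb := hk.bounds hC
  have hN := hC.noncrossing
  obtain ⟨L1, L2, L3, L4⟩ := lowerEnd_spec C.roots hb.1
  refine Noncrossing.of_bounds (minusLift_subset hC hk) ?_ ?_
  · intro i j i' j' b1 b2 b3 b4 b5 b6 h h' c1 c2 c3
    rw [rootSum_mem_minusLift hC hk b2] at h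
    rw [rootSum_mem_minusLift hC hk b5] at h'
    rcases h with h | ⟨h, -⟩
    · rcases h' with h' | ⟨rfl, rfl | ⟨h1, h2⟩⟩
      · exact hN.pos_pos h h' c1 c2 c3
      · rcases L3 with L3 | ⟨L3, L5⟩
        · omega
        · exact hN.neg_pos L5 h (by omega) (by omega)
      · exact hN.neg_pos h2 h (by omega) (by omega)
    · omega
  · intro u i j b1 b2 b4 b5 b6 h h' c1 c2
    rw [mem_minusLift_neg] at h
    rw [rootSum_mem_minusLift hC hk b5] at h'
    rcases h' with h' | ⟨rfl, rfl | ⟨h1, h2⟩⟩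
    · exact hN.neg_pos h.1 h' c1 c2
    · have := L4 u b1 h.2 h.1
      omega
    · omega

/-- Replacing the roots `-α_i` with `i ≥ k` preserves their number, and `[L(k), r+1]` is one
additional root, distinct from the others because `L(k) ≤ k`. -/
theorem ncard_minusLift (hC : IsTaggedCluster r C) (hk : IsMinusIndex r C k) :
    (minusLift r k C).roots.ncard = r + 1 := by
  have hb := hk.bounds hC
  have hN := hC.noncrossing
  obtain ⟨L1, L2, L3, L4⟩ := lowerEnd_spec C.roots hb.1
  set A := {α | α ∈ C.roots ∧ ¬ ∃ i, k ≤ i ∧ α = -simpleRoot i} with hA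
  set J := {i | k ≤ i ∧ -simpleRoot i ∈ C.roots} with hJ
  have hJfin : J.Finite := (Set.finite_Iic r).subset fun i hi => (hN.neg_bounds hi.2).2
  have hAfin : A.Finite := hN.finite.subset fun α h => h.1
  have e1 : C.roots = A ∪ (fun i => -simpleRoot i) '' J := by
    ext α
    constructor
    · intro h
      by_cases h' : ∃ i, k ≤ i ∧ α = -simpleRoot i
      · obtain ⟨i, hi, rfl⟩ := h'
        exact Or.inr ⟨i, ⟨hi, h⟩, rfl⟩
      · exact Or.inl ⟨h, h'⟩
    · rintro (h | ⟨i, hi, rfl⟩)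
      · exact h.1
      · exact hi.2
  have e2 : (minusLift r k C).roots =
      A ∪ (fun i => rootSum i (r + 1)) '' (insert (lowerEnd C.roots k) ((· + 1) '' J)) := by
    ext α
    constructor
    · rintro ((h | ⟨v, hv, h, rfl⟩) | rfl)
      · exact Or.inl h
      · exact Or.inr ⟨v + 1, Or.inr ⟨v, ⟨hv, h⟩, rfl⟩, rfl⟩
      · exact Or.inr ⟨_, Or.inl rfl, rfl⟩
    · rintro (h | ⟨i, rfl | ⟨v, hv, rfl⟩, rfl⟩)
      · exact Or.inl (Or.inl h)
      · exact Or.inr rfl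
      · exact Or.inl (Or.inr ⟨v, hv.1, hv.2, rfl⟩)
  have c1 : C.roots.ncard = A.ncard + J.ncard := by
    rw [e1, Set.ncard_union_eq _ hAfin (hJfin.image _), Set.InjOn.ncard_image]
    · exact fun i _ j _ h => neg_simpleRoot_inj h
    · rw [Set.disjoint_left]
      rintro _ ⟨h1, h2⟩ ⟨i, hi, rfl⟩
      exact h2 ⟨i, hi.1, rfl⟩
  rw [hC.1.ncard] at c1
  have hJb : ∀ i ∈ J, i ≤ r := fun i hi => (hN.neg_bounds hi.2).2
  rw [e2, Set.ncard_union_eq _ hAfin (((hJfin.image _).insert _).image _),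
    Set.InjOn.ncard_image, Set.ncard_insert_of_notMem _ (hJfin.image _),
    Set.InjOn.ncard_image]
  · omega
  · intro i _ j _ h
    simpa using h
  · rintro ⟨i, hi, e⟩
    have := hi.1
    simp only at e
    omega
  · have key : ∀ i ∈ insert (lowerEnd C.roots k) ((· + 1) '' J), i ≤ r + 1 := by
      rintro i (rfl | ⟨v, hv, rfl⟩)
      · omega
      · have := hJb v hv
        simp only
        omega
    intro i hi j hj h
    exact (rootSum_inj (key i hi) (key j hj) h).1
  · rw [Set.disjoint_left]
    rintro _ ⟨h1, -⟩ ⟨i, hi, rfl⟩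
    have := hN.bounds h1
    omega

theorem phiMinus_even_mem (hC : IsTaggedCluster r C) (hk : IsMinusIndex r C k) :
    IsTaggedCluster (r + 1) (minusLift r k C) := by
  refine ⟨(minusLift_noncrossing hC hk).isCluster (ncard_minusLift hC hk).ge, ?_⟩
  rintro α ⟨h1, h2⟩
  obtain ⟨i, hi, hir, rfl, hi'⟩ := hC.exists_of_tagged h1
  refine ⟨mem_minusLift_neg.2 ⟨hi', ?_⟩, i, hi, by omega, rfl⟩
  simp only [Set.mem_singleton_iff, neg_simpleRoot_eq_iff] at h2
  rcases hk with ⟨-, rfl⟩ | ⟨-, -, h⟩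
  · omega
  · have := h i h1
    omega

theorem phiPlus_even_mem (hC : IsTaggedCluster r C) :
    IsTaggedCluster (r + 1) (phiPlus (2 * r + 2) C) := by
  classical
  have hN := hC.noncrossing
  rw [phiPlus_even]
  have hnot : -simpleRoot (r + 1) ∉ C.roots := fun h => by
    have := hN.neg_bounds h
    omega
  have hN' : Noncrossing (r + 1) (insert (-simpleRoot (r + 1)) C.roots) := by
    refine ⟨Set.insert_subset (neg_mem.2 ⟨by omega, le_rfl⟩)
      (hN.sub.trans (almostPosRoots_mono (by omega))), ?_, ?_⟩
    · rintro i j k l (h3 | h3) (h4 | h4)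
      · exact absurd h3 (rootSum_ne_neg _ _ _)
      · exact absurd h3 (rootSum_ne_neg _ _ _)
      · exact absurd h4 (rootSum_ne_neg _ _ _)
      · exact hN.pos_pos h3 h4
    · rintro v k l (h3 | h3) (h4 | h4)
      · exact absurd h4 (rootSum_ne_neg _ _ _)
      · obtain rfl := neg_simpleRoot_inj h3
        have := hN.bounds h4
        omega
      · exact absurd h4 (rootSum_ne_neg _ _ _)
      · exact hN.neg_pos h3 h4
  refine ⟨hN'.isCluster ?_, ?_⟩
  · rw [Set.ncard_insert_of_notMem hnot hN.finite, hC.1.ncard]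
  · have h0 : C.tagged ⊆ insert (-simpleRoot (r + 1)) C.roots ∩ negSimpleRoots (r + 1) := by
      intro α h
      obtain ⟨i, hi, hir, rfl, hi'⟩ := hC.exists_of_tagged h
      exact ⟨Or.inr hi', i, hi, by omega, rfl⟩
    dsimp only
    split_ifs with hg
    · exact Set.insert_subset ⟨Or.inl rfl, r + 1, by omega, le_rfl, rfl⟩ h0
    · exact h0

end minus

/-! ### The inverse of the edge maps on even layers -/

/-- The set of all `i` with `α_i + ⋯ + α_k ∈ X`, without bounds on `i`. -/
def startsAt (X : Set Lat) (k : ℕ) : Set ℕ := {i | rootSum i k ∈ X}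

/-- `j` is the second smallest element of `I`. -/
def IsSecond (I : Set ℕ) (j : ℕ) : Prop := j ∈ I ∧ ∃ i₀ ∈ I, i₀ < j ∧ ∀ i ∈ I, i < j → i = i₀

theorem isSecond_iff_ncard {I : Set ℕ} {j : ℕ} :
    IsSecond I j ↔ j ∈ I ∧ {i | i ∈ I ∧ i < j}.ncard = 1 := by
  rw [Set.ncard_eq_one, IsSecond]
  refine and_congr_right fun _ => exists_congr fun i₀ => ?_
  constructor
  · rintro ⟨h1, h2, h3⟩
    ext i
    exact ⟨fun h => h3 i h.1 h.2, fun h => by rw [Set.mem_singleton_iff.1 h]; exact ⟨h1, h2⟩⟩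
  · intro h
    have h1 : i₀ ∈ {i | i ∈ I ∧ i < j} := by rw [h]; rfl
    refine ⟨h1.1, h1.2, fun i hi hij => ?_⟩
    have : i ∈ {i | i ∈ I ∧ i < j} := ⟨hi, hij⟩
    rwa [h] at this

theorem exists_least {I : Set ℕ} (h : I.Nonempty) : ∃ i₀ ∈ I, ∀ i ∈ I, i₀ ≤ i :=
  ⟨sInf I, Nat.sInf_mem h, fun _ hi => Nat.sInf_le hi⟩

theorem exists_isSecond {I : Set ℕ} {i j : ℕ} (hi : i ∈ I) (hj : j ∈ I) (hij : i < j) :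
    ∃ s, IsSecond I s ∧ s ≤ j := by
  obtain ⟨i₀, h0, hmin⟩ := exists_least ⟨i, hi⟩
  obtain ⟨s, hs, hs'⟩ := exists_least (I := {s | s ∈ I ∧ i₀ < s})
    ⟨j, hj, by have := hmin i hi; omega⟩
  refine ⟨s, ⟨hs.1, i₀, h0, hs.2, fun t ht hts => ?_⟩, hs' j ⟨hj, by have := hmin i hi; omega⟩⟩
  by_contra hne
  have h1 := hmin t ht
  have := hs' t ⟨ht, by omega⟩
  omega

theorem IsSecond.le {I : Set ℕ} {i i' j : ℕ} (h : IsSecond I j) (hi : i ∈ I) (hi' : i' ∈ I)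
    (hii : i' < i) : j ≤ i := by
  obtain ⟨-, i₀, h0, h1, h2⟩ := h
  by_contra hlt
  have e1 := h2 i hi (by omega)
  have e2 := h2 i' hi' (by omega)
  omega

theorem IsSecond.unique {I : Set ℕ} {j j' : ℕ} (h : IsSecond I j) (h' : IsSecond I j') :
    j = j' := by
  obtain ⟨h1, i₀, h2, h3, -⟩ := id h
  obtain ⟨h1', i₀', h2', h3', -⟩ := id h'
  exact le_antisymm (h.le h1' h2' h3') (h'.le h1 h2 h3)

/-- The contraction of the last but one side of the polygon, with the tags that make it
invert the edge maps. -/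
def contractTop (r : ℕ) (X : TaggedSet) : TaggedSet :=
  ⟨{α | α ∈ X.roots ∧ α ≠ -simpleRoot (r + 1) ∧ ∀ i, α ≠ rootSum i (r + 1)} ∪
      {α | ∃ i ∈ startsAt X.roots (r + 1), (∃ i' ∈ startsAt X.roots (r + 1), i' < i) ∧
        α = -simpleRoot (i - 1)},
    {α | α ∈ X.tagged ∧ α ≠ -simpleRoot (r + 1)} ∪
      {α | ∃ j, IsSecond (startsAt X.roots (r + 1)) j ∧ α = -simpleRoot (j - 1)},
    -simpleRoot (r + 1) ∈ X.tagged ∨ ∃ i, startsAt X.roots (r + 1) = {i}⟩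

/-! ### Contraction of a side, and its inversion by the edge maps -/

section contract

variable {r : ℕ} {X : TaggedSet}

theorem startsAt_bounds {m k i : ℕ} {Z : Set Lat} (hZ : Noncrossing m Z) (h : i ∈ startsAt Z k) :
    1 ≤ i ∧ i ≤ k ∧ k ≤ m := hZ.bounds h

theorem rootSum_mem_contractTop {i j : ℕ} (hij : i ≤ j) :
    rootSum i j ∈ (contractTop r X).roots ↔ rootSum i j ∈ X.roots ∧ j ≠ r + 1 := by
  constructor
  · rintro (⟨h1, h2, h3⟩ | ⟨i', -, -, e⟩)
    · exact ⟨h1, fun e => h3 i (by rw [e])⟩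
    · exact absurd e (rootSum_ne_neg _ _ _)
  · rintro ⟨h1, h2⟩
    refine Or.inl ⟨h1, rootSum_ne_neg _ _ _, fun i' e => ?_⟩
    by_cases hi' : i' ≤ r + 1
    · exact h2 (rootSum_inj hij hi' e).2
    · rw [rootSum_eq_zero (by omega : r + 1 < i')] at e
      have := congrFun e i
      rw [rootSum_apply, if_pos ⟨le_rfl, hij⟩] at this
      simp at this

theorem neg_mem_contractTop (hX : Noncrossing (r + 1) X.roots) {u : ℕ} :
    -simpleRoot u ∈ (contractTop r X).roots ↔ (-simpleRoot u ∈ X.roots ∧ u ≠ r + 1) ∨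
      (u + 1 ∈ startsAt X.roots (r + 1) ∧ ∃ i' ∈ startsAt X.roots (r + 1), i' < u + 1) := by
  constructor
  · rintro (⟨h1, h2, h3⟩ | ⟨i, hi, h, e⟩)
    · exact Or.inl ⟨h1, fun e => h2 (by rw [e])⟩
    · have := startsAt_bounds hX hi
      have := neg_simpleRoot_inj e
      obtain rfl : i = u + 1 := by omega
      exact Or.inr ⟨hi, h⟩
  · rintro (⟨h1, h2⟩ | ⟨h1, h2⟩)
    · exact Or.inl ⟨h1, fun e => h2 (neg_simpleRoot_inj e), fun i => (rootSum_ne_neg _ _ _).symm⟩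
    · exact Or.inr ⟨u + 1, h1, h2, by rw [Nat.add_sub_cancel]⟩

theorem contractTop_subset (hX : Noncrossing (r + 1) X.roots) :
    (contractTop r X).roots ⊆ almostPosRoots r := by
  rintro α (⟨h1, h2, h3⟩ | ⟨i, hi, ⟨i', hi', hii⟩, rfl⟩)
  · rcases hX.sub h1 with ⟨i, j, b1, b2, b3, rfl⟩ | ⟨i, b1, b2, rfl⟩
    · have : j ≠ r + 1 := fun e => h3 i (by rw [e])
      exact rootSum_mem.2 ⟨b1, b2, by omega⟩
    · have : i ≠ r + 1 := fun e => h2 (by rw [e])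
      exact neg_mem.2 ⟨b1, by omega⟩
  · have := startsAt_bounds hX hi
    have := startsAt_bounds hX hi'
    exact neg_mem.2 ⟨by omega, by omega⟩

theorem contractTop_noncrossing (hX : Noncrossing (r + 1) X.roots) :
    Noncrossing r (contractTop r X).roots := by
  refine Noncrossing.of_bounds (contractTop_subset hX) ?_ ?_
  · intro i j k l b1 b2 b3 b4 b5 b6 h1 h2
    exact hX.pos_pos ((rootSum_mem_contractTop b2).1 h1).1 ((rootSum_mem_contractTop b5).1 h2).1
  · intro u k l b1 b2 b3 b4 b5 h1 h2 c1 c2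
    have h2 := ((rootSum_mem_contractTop b4).1 h2).1
    rcases (neg_mem_contractTop hX).1 h1 with h1 | ⟨h1, -⟩
    · exact hX.neg_pos h1.1 h2 c1 c2
    · exact hX.pos_pos h2 h1 (by omega) (by omega) (by omega)

theorem startsAt_finite (hX : Noncrossing (r + 1) X.roots) :
    (startsAt X.roots (r + 1)).Finite :=
  (Set.finite_Iic (r + 1)).subset fun _ hi => (startsAt_bounds hX hi).2.1

/-- In type `A_{r+1}` the roots that cross `-α_{r+1}` are those ending with `α_{r+1}`. This
dichotomy separates the images of `φ_c^+` and `φ_c^-`. -/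
theorem startsAt_nonempty_iff (hX : IsCluster (r + 1) X.roots) :
    (startsAt X.roots (r + 1)).Nonempty ↔ -simpleRoot (r + 1) ∉ X.roots := by
  have hN := hX.noncrossing
  constructor
  · rintro ⟨i, hi⟩ h
    exact hN.neg_pos h hi (startsAt_bounds hN hi).2.1 le_rfl
  · intro h
    by_contra hne
    refine h (hX.neg_mem_of_forall (by omega) le_rfl fun k l h1 h2 h3 => hne ⟨k, ?_⟩)
    have := hN.bounds h1
    obtain rfl : l = r + 1 := by omega
    exact h1

/-- Exactly one root disappears: `-α_{r+1}`, or the longest root ending with `α_{r+1}`, which merges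
with a root or side at the top vertex. -/
theorem ncard_contractTop (hX : IsCluster (r + 1) X.roots) :
    (contractTop r X).roots.ncard = r := by
  have hN := hX.noncrossing
  have hc := hX.ncard
  set I := startsAt X.roots (r + 1) with hI
  set A := {α | α ∈ X.roots ∧ α ≠ -simpleRoot (r + 1) ∧ ∀ i, α ≠ rootSum i (r + 1)} with hA
  have hIfin : I.Finite := startsAt_finite hN
  have hAfin : A.Finite := hN.finite.subset fun α h => h.1
  by_cases hne : I.Nonempty
  · have hneg := (startsAt_nonempty_iff hX).1 hne
    obtain ⟨i₀, h0, hmin⟩ := exists_least hne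
    have e1 : X.roots = A ∪ (fun i => rootSum i (r + 1)) '' I := by
      ext α
      constructor
      · intro h
        by_cases h' : ∃ i, α = rootSum i (r + 1)
        · obtain ⟨i, rfl⟩ := h'
          exact Or.inr ⟨i, h, rfl⟩
        · exact Or.inl ⟨h, fun e => hneg (e ▸ h), fun i e => h' ⟨i, e⟩⟩
      · rintro (h | ⟨i, hi, rfl⟩)
        · exact h.1
        · exact hi
    have e2 : (contractTop r X).roots = A ∪ (fun i => -simpleRoot (i - 1)) '' (I \ {i₀}) := by
      ext α
      constructor
      · rintro (h | ⟨i, hi, ⟨i', hi', hii⟩, rfl⟩)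
        · exact Or.inl h
        · exact Or.inr ⟨i, ⟨hi, fun e => by
            have := hmin i' hi'
            rw [Set.mem_singleton_iff.1 e] at hii
            omega⟩, rfl⟩
      · rintro (h | ⟨i, ⟨hi, hne⟩, rfl⟩)
        · exact Or.inl h
        · have := hmin i hi
          have hne' : i ≠ i₀ := hne
          exact Or.inr ⟨i, hi, ⟨i₀, h0, by omega⟩, rfl⟩
    rw [e1, Set.ncard_union_eq _ hAfin (hIfin.image _), Set.InjOn.ncard_image] at hc
    · rw [e2, Set.ncard_union_eq _ hAfin ((hIfin.sdiff).image _), Set.InjOn.ncard_image,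
        Set.ncard_sdiff_singleton_of_mem h0]
      · have : 0 < I.ncard := (Set.ncard_pos hIfin).2 hne
        omega
      · intro i hi j hj e
        have h1 := startsAt_bounds hN hi.1
        have h2 := startsAt_bounds hN hj.1
        have := neg_simpleRoot_inj e
        omega
      · rw [Set.disjoint_left]
        rintro _ ⟨h1, -, -⟩ ⟨i, ⟨hi, hne⟩, rfl⟩
        have b := startsAt_bounds hN hi
        have b0 := startsAt_bounds hN h0
        have := hmin i hi
        have hne' : i ≠ i₀ := hne
        exact hN.neg_pos h1 h0 (by omega) (by omega)
    · intro i hi j hj e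
      exact (rootSum_inj (startsAt_bounds hN hi).2.1 (startsAt_bounds hN hj).2.1 e).1
    · rw [Set.disjoint_left]
      rintro _ ⟨-, -, h⟩ ⟨i, hi, rfl⟩
      exact h i rfl
  · have hneg : -simpleRoot (r + 1) ∈ X.roots := by
      by_contra h
      exact hne ((startsAt_nonempty_iff hX).2 h)
    have e2 : (contractTop r X).roots = X.roots \ {-simpleRoot (r + 1)} := by
      ext α
      constructor
      · rintro (h | ⟨i, hi, -⟩)
        · exact ⟨h.1, h.2.1⟩
        · exact absurd ⟨i, hi⟩ hne
      · rintro ⟨h1, h2⟩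
        refine Or.inl ⟨h1, h2, ?_⟩
        rintro i rfl
        exact hne ⟨i, h1⟩
    rw [e2, Set.ncard_sdiff_singleton_of_mem hneg]
    omega

theorem isTaggedCluster_contractTop (hX : IsTaggedCluster (r + 1) X) :
    IsTaggedCluster r (contractTop r X) := by
  have hN := hX.noncrossing
  refine ⟨(contractTop_noncrossing hN).isCluster (ncard_contractTop hX.1).ge, ?_⟩
  have key : ∀ α ∈ (contractTop r X).tagged,
      α ∈ (contractTop r X).roots ∧ ∃ i, α = -simpleRoot i := by
    rintro α (⟨h1, h2⟩ | ⟨j, hj, rfl⟩)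
    · obtain ⟨i, -, -, rfl, h⟩ := hX.exists_of_tagged h1
      exact ⟨Or.inl ⟨h, h2, fun i => (rootSum_ne_neg _ _ _).symm⟩, i, rfl⟩
    · obtain ⟨h1, i₀, h2, h3, -⟩ := hj
      exact ⟨Or.inr ⟨j, h1, ⟨i₀, h2, h3⟩, rfl⟩, j - 1, rfl⟩
  intro α hα
  obtain ⟨h1, i, rfl⟩ := key α hα
  have := neg_mem.1 (contractTop_subset hN h1)
  exact ⟨h1, i, this.1, this.2, rfl⟩

theorem neg_mem_contractTop_tagged (hX : IsTaggedCluster (r + 1) X) {u : ℕ} :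
    -simpleRoot u ∈ (contractTop r X).tagged ↔ (-simpleRoot u ∈ X.tagged ∧ u ≠ r + 1) ∨
      IsSecond (startsAt X.roots (r + 1)) (u + 1) := by
  constructor
  · rintro (⟨h1, h2⟩ | ⟨j, hj, e⟩)
    · exact Or.inl ⟨h1, fun e => h2 (by rw [e])⟩
    · have := startsAt_bounds hX.noncrossing hj.1
      have := neg_simpleRoot_inj e
      obtain rfl : j = u + 1 := by omega
      exact Or.inr hj
  · rintro (⟨h1, h2⟩ | h)
    · exact Or.inl ⟨h1, fun e => h2 (neg_simpleRoot_inj e)⟩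
    · exact Or.inr ⟨u + 1, h, by rw [Nat.add_sub_cancel]⟩

theorem phiPlus_contractTop (hX : IsTaggedCluster (r + 1) X) (hg : ¬ X.globalTag)
    (h : -simpleRoot (r + 1) ∈ X.roots) : phiPlus (2 * r + 2) (contractTop r X) = X := by
  classical
  have hI : ∀ i, i ∉ startsAt X.roots (r + 1) := fun i hi =>
    (startsAt_nonempty_iff hX.1).1 ⟨i, hi⟩ h
  rw [phiPlus_even]
  have hglob : (contractTop r X).globalTag ↔ -simpleRoot (r + 1) ∈ X.tagged := by
    refine ⟨fun h => h.resolve_right ?_, Or.inl⟩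
    rintro ⟨i, hi⟩
    exact hI i (by rw [hi]; rfl)
  have htag : (contractTop r X).tagged = X.tagged \ {-simpleRoot (r + 1)} := by
    ext α
    constructor
    · rintro (h | ⟨j, hj, -⟩)
      · exact h
      · exact absurd hj.1 (hI j)
    · exact Or.inl
  apply TaggedSet.ext
  · ext α
    constructor
    · rintro (rfl | h | ⟨i, hi, -⟩)
      · exact h
      · exact h.1
      · exact absurd hi (hI i)
    · intro hα
      by_cases hα' : α = -simpleRoot (r + 1)
      · exact Or.inl hα'
      · refine Or.inr (Or.inl ⟨hα, hα', ?_⟩)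
        rintro i rfl
        exact hI i hα
  · simp only [hglob, htag]
    split_ifs with ht
    · rw [Set.insert_sdiff_singleton, Set.insert_eq_of_mem ht]
    · rw [Set.sdiff_singleton_eq_self ht]
  · exact propext ⟨False.elim, hg⟩

/-- The place `k` where the merged fan has to be separated is visible in the tags: it is `r + 1`
(global tag) if only one root ends with `α_{r+1}`, and otherwise `j - 1` for the second smallest
start `j`. All other tags belong to roots `-α_u` with `u` below the smallest start, so `k` is the
largest tagged index. -/
theorem exists_minusLift_contractTop (hX : IsTaggedCluster (r + 1) X) (hg : ¬ X.globalTag)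
    (h : -simpleRoot (r + 1) ∉ X.roots) :
    ∃ k, IsMinusIndex r (contractTop r X) k ∧ minusLift r k (contractTop r X) = X := by
  have hN := hX.noncrossing
  have hC := isTaggedCluster_contractTop hX
  have ht : -simpleRoot (r + 1) ∉ X.tagged := fun h' => h (hX.2 h').1
  obtain ⟨i₀, h0, hmin⟩ := exists_least ((startsAt_nonempty_iff hX.1).2 h)
  have b0 := startsAt_bounds hN h0
  have htagb : ∀ u, -simpleRoot u ∈ X.roots → u < i₀ := fun u hu => by
    by_contra hui
    have := hN.neg_bounds hu
    exact hN.neg_pos hu h0 (by omega) (by omega)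
  have hex : ∃ k, IsMinusIndex r (contractTop r X) k ∧ i₀ ≤ k ∧
      (∀ i ∈ startsAt X.roots (r + 1), i ≠ i₀ → k + 1 ≤ i) ∧
      (k = r + 1 ∨ IsSecond (startsAt X.roots (r + 1)) (k + 1)) := by
    by_cases hs : startsAt X.roots (r + 1) = {i₀}
    · refine ⟨r + 1, Or.inl ⟨Or.inr ⟨i₀, hs⟩, rfl⟩, b0.2.1, fun i hi hne => ?_, Or.inl rfl⟩
      rw [hs] at hi
      exact absurd hi hne
    · have : ∃ i ∈ startsAt X.roots (r + 1), i₀ < i := by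
        by_contra hcon
        apply hs
        ext i
        refine ⟨fun hi => ?_, fun hi => by rw [Set.mem_singleton_iff.1 hi]; exact h0⟩
        have := hmin i hi
        by_contra hne
        exact hcon ⟨i, hi, lt_of_le_of_ne this (Ne.symm hne)⟩
      obtain ⟨i, hi, hii⟩ := this
      obtain ⟨j, hj, -⟩ := exists_isSecond h0 hi hii
      obtain ⟨hj1, i₁, hi1, hij1, -⟩ := id hj
      have := hmin i₁ hi1
      obtain ⟨k, rfl⟩ : ∃ k, j = k + 1 := ⟨j - 1, by omega⟩
      refine ⟨k, Or.inr ⟨?_, (neg_mem_contractTop_tagged hX).2 (Or.inr hj), ?_⟩, by omega, ?_,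
        Or.inr hj⟩
      · rintro (h' | ⟨i', h'⟩)
        · exact ht h'
        · rw [h'] at h0 hi
          rw [Set.mem_singleton_iff] at h0 hi
          omega
      · intro t ht
        rcases (neg_mem_contractTop_tagged hX).1 ht with ht | ht
        · have := htagb t (hX.2 ht.1).1
          omega
        · have := ht.unique hj
          omega
      · intro i hi hne
        exact hj.le hi h0 (lt_of_le_of_ne (hmin i hi) (Ne.symm hne))
  obtain ⟨k, hk, hik, hkmin, hksec⟩ := hex
  have hkb := hk.bounds hC
  -- The contraction contains `-α_{i₀-1}` (if `i₀ ≥ 2`), because any root across it would cross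
  -- `[i₀, r+1]` in `X`; and it contains no `-α_j` with `i₀ ≤ j < k`.
  have hL : lowerEnd (contractTop r X).roots k = i₀ := by
    refine lowerEnd_eq b0.1 hik (fun h2 => ?_) (fun j h1 h2 h3 => ?_)
    · refine hC.1.neg_mem_of_forall (by omega) (by omega) fun a b h1 h3 h4 => ?_
      have b1 := hC.noncrossing.bounds h1
      have h1 := ((rootSum_mem_contractTop b1.2.1).1 h1).1
      exact hN.pos_pos h1 h0 (by omega) (by omega) (by omega)
    · rcases (neg_mem_contractTop hN).1 h3 with h3 | ⟨h3, i', h4, h5⟩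
      · exact htagb j h3.1
      · have := hmin i' h4
        have := hkmin _ h3 (by omega)
        omega
  refine ⟨k, hk, TaggedSet.ext ?_ ?_ (propext ⟨False.elim, hg⟩)⟩
  · have hmem : ∀ {i j : ℕ}, i ≤ j →
        (rootSum i j ∈ (minusLift r k (contractTop r X)).roots ↔ rootSum i j ∈ X.roots) := by
      intro i j hij
      rw [rootSum_mem_minusLift hC hk hij, rootSum_mem_contractTop hij, hL]
      constructor
      · rintro (h1 | ⟨rfl, rfl | ⟨h1, h2⟩⟩)
        · exact h1.1
        · exact h0
        · rcases (neg_mem_contractTop hN).1 h2 with h3 | ⟨h3, -⟩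
          · have := htagb _ h3.1
            omega
          · rwa [Nat.sub_add_cancel (by omega)] at h3
      · intro h1
        by_cases hj : j = r + 1
        · subst hj
          refine Or.inr ⟨rfl, ?_⟩
          by_cases hi : i = i₀
          · exact Or.inl hi
          · have h2 := hkmin i h1 hi
            refine Or.inr ⟨h2, (neg_mem_contractTop hN).2 (Or.inr ?_)⟩
            rw [Nat.sub_add_cancel (by omega)]
            exact ⟨h1, i₀, h0, by omega⟩
        · exact Or.inl ⟨h1, hj⟩
    ext α
    constructor
    · intro hα
      rcases minusLift_subset hC hk hα with ⟨i, j, -, hij, -, rfl⟩ | ⟨i, hi, hir, rfl⟩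
      · exact (hmem hij).1 hα
      · obtain ⟨h1, h2⟩ := mem_minusLift_neg.1 hα
        rcases (neg_mem_contractTop hN).1 h1 with h3 | ⟨h3, i', h4, h5⟩
        · exact h3.1
        · have := hmin i' h4
          have := hkmin _ h3 (by omega)
          omega
    · intro hα
      rcases hN.sub hα with ⟨i, j, -, hij, -, rfl⟩ | ⟨i, hi, hir, rfl⟩
      · exact (hmem hij).2 hα
      · have := htagb i hα
        exact mem_minusLift_neg.2 ⟨(neg_mem_contractTop hN).2 (Or.inl ⟨hα, by omega⟩), by omega⟩
  · ext α
    constructor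
    · rintro ⟨h1, h2⟩
      rcases h1 with h1 | ⟨j, hj, rfl⟩
      · exact h1.1
      · rcases hksec with rfl | hksec
        · have b := startsAt_bounds hN hj.1
          obtain ⟨hj1, i₁, h3, h4, -⟩ := hj
          have := hmin i₁ h3
          have := hkmin j hj1 (by omega)
          omega
        · rw [hj.unique hksec] at h2
          exact absurd rfl h2
    · intro hα
      obtain ⟨i, hi, -, rfl, hi'⟩ := hX.exists_of_tagged hα
      have := htagb i hi'
      refine ⟨(neg_mem_contractTop_tagged hX).2 (Or.inl ⟨hα, by omega⟩), ?_⟩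
      simp only [Set.mem_singleton_iff, neg_simpleRoot_eq_iff]
      omega

end contract

/-! ### Contraction undoes the edge maps; behaviour of the tag numbers -/

section inverse

variable {r k : ℕ} {C : TaggedSet}

theorem contractTop_phiPlus (hC : IsTaggedCluster r C) :
    contractTop r (phiPlus (2 * r + 2) C) = C := by
  classical
  have hN := hC.noncrossing
  have hnot : -simpleRoot (r + 1) ∉ C.roots := fun h => by
    have := hN.neg_bounds h
    omega
  have hnot' : -simpleRoot (r + 1) ∉ C.tagged := fun h => hnot (hC.2 h).1
  rw [phiPlus_even]
  have hI : ∀ i, rootSum i (r + 1) ∉ insert (-simpleRoot (r + 1)) C.roots := by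
    rintro i (e | h)
    · exact rootSum_ne_neg _ _ _ e
    · have := hN.bounds h
      omega
  apply TaggedSet.ext
  · ext α
    constructor
    · rintro (⟨h1 | h1, h2, h3⟩ | ⟨i, hi, -⟩)
      · exact absurd h1 h2
      · exact h1
      · exact absurd hi (hI i)
    · intro hα
      refine Or.inl ⟨Or.inr hα, fun e => hnot (e ▸ hα), ?_⟩
      rintro i rfl
      exact hI i (Or.inr hα)
  · ext α
    constructor
    · rintro (⟨h1, h2⟩ | ⟨j, hj, -⟩)
      · dsimp only at h1
        split_ifs at h1
        · exact h1.resolve_left h2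
        · exact h1
      · exact absurd hj.1 (hI j)
    · intro hα
      refine Or.inl ⟨?_, fun e => hnot' (e ▸ hα)⟩
      dsimp only
      split_ifs
      · exact Or.inr hα
      · exact hα
  · apply propext
    constructor
    · rintro (h | ⟨i, hi⟩)
      · dsimp only at h
        split_ifs at h with hg
        · exact hg
        · exact absurd h hnot'
      · have : i ∈ startsAt (insert (-simpleRoot (r + 1)) C.roots) (r + 1) := by
          rw [hi]; rfl
        exact absurd this (hI i)
    · intro hg
      left
      dsimp only
      rw [if_pos hg]
      exact Or.inl rfl

/-- After the lift the starts at `r + 1` are `L ≤ k` and the numbers `i + 1` with `-α_i ∈ C`, `i ≥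
k`. Without a global tag `-α_k` belongs to `C`, so `k + 1` is the second smallest start and its tag
is restored; with a global tag `L` is the only start. -/
theorem contractTop_minusLift (hC : IsTaggedCluster r C) (hk : IsMinusIndex r C k) :
    contractTop r (minusLift r k C) = C := by
  have hN := hC.noncrossing
  have hX := phiMinus_even_mem hC hk
  have hNX := hX.noncrossing
  have hkb := hk.bounds hC
  obtain ⟨L1, L2, L3, L4⟩ := lowerEnd_spec C.roots hkb.1
  set L := lowerEnd C.roots k with hL
  have hI : ∀ i, i ∈ startsAt (minusLift r k C).roots (r + 1) ↔
      i = L ∨ (k + 1 ≤ i ∧ -simpleRoot (i - 1) ∈ C.roots) := by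
    intro i
    by_cases hi : i ≤ r + 1
    · rw [startsAt, Set.mem_ofPred_eq, rootSum_mem_minusLift hC hk hi]
      refine ⟨fun h => ?_, fun h => Or.inr ⟨rfl, h⟩⟩
      rcases h with h | h
      · have := hN.bounds h
        omega
      · exact h.2
    · refine iff_of_false (fun h => hi (startsAt_bounds hNX h).2.1) ?_
      rintro (h | h)
      · omega
      · have := hN.neg_bounds h.2
        omega
  have hLI := (hI L).2 (Or.inl rfl)
  have hmin : ∀ i ∈ startsAt (minusLift r k C).roots (r + 1), L ≤ i := by
    intro i hi
    rcases (hI i).1 hi with h | h <;> omega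
  have hsec : ∀ j, IsSecond (startsAt (minusLift r k C).roots (r + 1)) j ↔
      (¬ C.globalTag ∧ j = k + 1) := by
    intro j
    constructor
    · intro hj
      obtain ⟨h1, i₀, h2, h3, h4⟩ := id hj
      have := hmin i₀ h2
      have hj' := ((hI j).1 h1).resolve_left (by omega)
      rcases hk with ⟨hg, rfl⟩ | ⟨hg, hk, -⟩
      · have := hN.neg_bounds hj'.2
        omega
      · refine ⟨hg, ?_⟩
        have hk1 := (hI (k + 1)).2 (Or.inr ⟨le_rfl, (hC.2 hk).1⟩)
        have := hj.le hk1 hLI (by omega)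
        omega
    · rintro ⟨hg, rfl⟩
      rcases hk with ⟨hg', -⟩ | ⟨-, hk, -⟩
      · exact absurd hg' hg
      · refine ⟨(hI _).2 (Or.inr ⟨le_rfl, (hC.2 hk).1⟩), L, hLI, by omega, fun i hi hik => ?_⟩
        exact ((hI i).1 hi).resolve_right fun h => by omega
  apply TaggedSet.ext
  · ext α
    constructor
    · intro hα
      rcases contractTop_subset hNX hα with ⟨i, j, -, hij, hj, rfl⟩ | ⟨i, hi, hir, rfl⟩
      · have h1 := ((rootSum_mem_contractTop hij).1 hα).1
        rw [rootSum_mem_minusLift hC hk hij] at h1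
        exact h1.resolve_right fun h => by omega
      · rcases (neg_mem_contractTop hNX).1 hα with h | ⟨h1, i', h2, h3⟩
        · exact (mem_minusLift_neg.1 h.1).1
        · have := hmin i' h2
          have := ((hI _).1 h1).resolve_left (by omega)
          rw [Nat.add_sub_cancel] at this
          exact this.2
    · intro hα
      rcases hN.sub hα with ⟨i, j, -, hij, hj, rfl⟩ | ⟨i, hi, hir, rfl⟩
      · exact (rootSum_mem_contractTop hij).2
          ⟨(rootSum_mem_minusLift hC hk hij).2 (Or.inl hα), by omega⟩
      · refine (neg_mem_contractTop hNX).2 ?_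
        by_cases hik : i < k
        · exact Or.inl ⟨mem_minusLift_neg.2 ⟨hα, hik⟩, by omega⟩
        · refine Or.inr ⟨(hI _).2 (Or.inr ⟨by omega, ?_⟩), L, hLI, by omega⟩
          rwa [Nat.add_sub_cancel]
  · ext α
    constructor
    · rintro (⟨h1, -⟩ | ⟨j, hj, rfl⟩)
      · exact h1.1
      · obtain ⟨hg, rfl⟩ := (hsec j).1 hj
        rcases hk with ⟨hg', -⟩ | ⟨-, hk, -⟩
        · exact absurd hg' hg
        · rwa [Nat.add_sub_cancel]
    · intro hα
      obtain ⟨i, hi, hir, rfl, -⟩ := hC.exists_of_tagged hα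
      refine (neg_mem_contractTop_tagged hX).2 ?_
      by_cases hik : i = k
      · subst hik
        right
        rw [hsec]
        refine ⟨fun hg => ?_, rfl⟩
        rcases hk with ⟨-, hk⟩ | ⟨hg', -⟩
        · omega
        · exact hg' hg
      · refine Or.inl ⟨⟨hα, ?_⟩, by omega⟩
        exact fun e => hik (neg_simpleRoot_inj e)
  · apply propext
    constructor
    · rintro (h | ⟨i, hi⟩)
      · have := hN.neg_bounds (hC.2 h.1).1
        omega
      · by_contra hg
        rcases hk with ⟨hg', -⟩ | ⟨-, hk, -⟩
        · exact hg hg'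
        · have h1 := (hI (k + 1)).2 (Or.inr ⟨le_rfl, (hC.2 hk).1⟩)
          rw [hi, Set.mem_singleton_iff] at h1 hLI
          omega
    · intro hg
      refine Or.inr ⟨L, ?_⟩
      ext i
      rw [hI, Set.mem_singleton_iff]
      refine ⟨fun h => h.resolve_right fun h' => ?_, Or.inl⟩
      rcases hk with ⟨-, rfl⟩ | ⟨hg', -⟩
      · have := hN.neg_bounds h'.2
        omega
      · exact hg' hg

theorem tagged_finite {m : ℕ} (hC : IsTaggedCluster m C) : C.tagged.Finite :=
  hC.noncrossing.finite.subset fun _ h => (hC.2 h).1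

theorem tagCount_of_globalTag (h : C.globalTag) : tagCount C = C.tagged.ncard + 1 := by
  rw [tagCount, if_pos h]

theorem tagCount_of_not_globalTag (h : ¬ C.globalTag) : tagCount C = C.tagged.ncard := by
  rw [tagCount, if_neg h, add_zero]

/-- A global tag is converted into a root tag, so the total is preserved. In contrast `φ_c^-` uses
up one tag, which is why the vertex moves up in one case and down in the other. -/
theorem ncard_tagged_phiPlus (hC : IsTaggedCluster r C) :
    (phiPlus (2 * r + 2) C).tagged.ncard = tagCount C := by
  classical
  have hnot' : -simpleRoot (r + 1) ∉ C.tagged := fun h => by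
    have := hC.noncrossing.neg_bounds (hC.2 h).1
    omega
  rw [phiPlus_even]
  dsimp only
  split_ifs with hg
  · rw [Set.ncard_insert_of_notMem hnot' (tagged_finite hC), tagCount_of_globalTag hg]
  · rw [tagCount_of_not_globalTag hg]

theorem ncard_tagged_minusLift (hC : IsTaggedCluster r C) (hk : IsMinusIndex r C k) :
    (minusLift r k C).tagged.ncard + 1 = tagCount C := by
  have hf := tagged_finite hC
  change (C.tagged \ {-simpleRoot k}).ncard + 1 = _
  rcases hk with ⟨hg, rfl⟩ | ⟨hg, hk, -⟩
  · rw [tagCount_of_globalTag hg, Set.sdiff_singleton_eq_self]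
    intro h
    have := hC.noncrossing.neg_bounds (hC.2 h).1
    omega
  · rw [tagCount_of_not_globalTag hg, Set.ncard_sdiff_singleton_add_one hk hf]

end inverse

/-! ### The Pascal array of tagged clusters -/

theorem mem_Yc_odd {r l : ℕ} {C : TaggedSet} : C ∈ Yc (2 * r + 1) l ↔
    IsTaggedCluster r C ∧ ¬ C.globalTag ∧ l = 2 * C.tagged.ncard + 1 := by
  have ho : Odd (2 * r + 1) := ⟨r, rfl⟩
  have he : ¬ Even (2 * r + 1) := Nat.not_even_iff_odd.2 ho
  simp only [Yc, Set.mem_ofPred_eq, layerRank_odd, ho, he, true_and, false_and, or_false]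
  refine and_congr_right fun _ => ?_
  constructor
  · rintro ⟨⟨t, ht⟩, h1, h2⟩
    exact ⟨h1, by omega⟩
  · rintro ⟨h1, h2⟩
    exact ⟨⟨_, h2⟩, h1, by omega⟩

theorem mem_Yc_even {r l : ℕ} {C : TaggedSet} : C ∈ Yc (2 * r + 2) l ↔
    IsTaggedCluster r C ∧ l = 2 * tagCount C := by
  have ho : ¬ Odd (2 * r + 2) := not_odd_even r
  have he : Even (2 * r + 2) := Nat.not_odd_iff_even.1 ho
  simp only [Yc, Set.mem_ofPred_eq, layerRank_even, ho, he, true_and, false_and, false_or]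
  refine and_congr_right fun _ => ?_
  constructor
  · rintro ⟨⟨t, ht⟩, h1, h2⟩
    omega
  · intro h
    exact ⟨⟨tagCount C, by omega⟩, by omega, by omega⟩

theorem almostPosRoots_zero : almostPosRoots 0 = ∅ := by
  ext α
  constructor
  · rintro (⟨i, j, h1, h2, h3, -⟩ | ⟨i, h1, h2, -⟩) <;> omega
  · exact False.elim

theorem isCluster_zero {X : Set Lat} : IsCluster 0 X ↔ X = ∅ := by
  constructor
  · intro h
    exact Set.subset_empty_iff.1 (almostPosRoots_zero ▸ h.noncrossing.sub)
  · rintro rfl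
    have : Noncrossing 0 (∅ : Set Lat) := ⟨Set.empty_subset _, fun h => h.elim, fun h => h.elim⟩
    exact this.isCluster (Nat.zero_le _)

theorem isTaggedCluster_zero {C : TaggedSet} :
    IsTaggedCluster 0 C ↔ C.roots = ∅ ∧ C.tagged = ∅ := by
  rw [IsTaggedCluster, isCluster_zero]
  constructor
  · rintro ⟨h1, h2⟩
    rw [h1, Set.empty_inter] at h2
    exact ⟨h1, Set.subset_empty_iff.1 h2⟩
  · rintro ⟨h1, h2⟩
    exact ⟨h1, by rw [h2]; exact Set.empty_subset _⟩

theorem mem_Yc_zero {l : ℕ} {C : TaggedSet} : C ∈ Yc 0 l ↔ C = ⟨∅, ∅, False⟩ ∧ l = 0 := by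
  have e0 : layerRank 0 = 0 := by simp [layerRank]
  simp only [Yc, Set.mem_ofPred_eq, e0, Nat.not_odd_zero, Even.zero, false_and, false_or,
    true_and, isTaggedCluster_zero, forall_const]
  constructor
  · rintro ⟨⟨h1, h2⟩, ⟨t, ht⟩, h3, h4⟩
    rw [tagCount_of_not_globalTag h4, h2, Set.ncard_empty] at h3
    exact ⟨TaggedSet.ext h1 h2 (propext ⟨h4, False.elim⟩), by omega⟩
  · rintro ⟨rfl, rfl⟩
    exact ⟨⟨rfl, rfl⟩, ⟨0, rfl⟩, by rw [tagCount_of_not_globalTag id]; simp, id⟩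

theorem layer_cases (n : ℕ) : n = 0 ∨ (∃ r, n = 2 * r + 1) ∨ ∃ r, n = 2 * r + 2 := by
  rcases Nat.even_or_odd' n with ⟨k, hk | hk⟩
  · rcases k with - | k
    · exact Or.inl hk
    · exact Or.inr (Or.inr ⟨k, by omega⟩)
  · exact Or.inr (Or.inl ⟨k, hk⟩)

theorem phiPlus_odd (r : ℕ) (C : TaggedSet) :
    phiPlus (2 * r + 1) C = ⟨C.roots, C.tagged, True⟩ := by
  rw [phiPlus, if_pos ⟨r, rfl⟩]

theorem phiMinus_odd (r : ℕ) (C : TaggedSet) : phiMinus (2 * r + 1) C = C := by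
  unfold phiMinus
  simp only
  rw [if_pos ⟨r, rfl⟩]

theorem phiPlus_zero (C : TaggedSet) : phiPlus 0 C = C := by simp [phiPlus]

theorem exists_isMinusIndex_of_tagCount {r : ℕ} {C : TaggedSet} (hC : IsTaggedCluster r C)
    (h : 1 ≤ tagCount C) : ∃ k, IsMinusIndex r C k := by
  refine exists_isMinusIndex hC ?_
  by_contra hcon
  rw [not_or, Set.not_nonempty_iff_eq_empty] at hcon
  rw [tagCount_of_not_globalTag hcon.1, hcon.2, Set.ncard_empty] at h
  omega

theorem edgeMap_true_mapsTo (n i : ℕ) : Set.MapsTo (phiPlus n) (Yc n i) (Yc (n + 1) (i + 1)) := by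
  intro C hC
  rcases layer_cases n with rfl | ⟨r, rfl⟩ | ⟨r, rfl⟩
  · rw [phiPlus_zero]
    obtain ⟨rfl, rfl⟩ := mem_Yc_zero.1 hC
    exact (mem_Yc_odd (r := 0)).2 ⟨isTaggedCluster_zero.2 ⟨rfl, rfl⟩, id, by simp⟩
  · obtain ⟨h1, h2, h3⟩ := mem_Yc_odd.1 hC
    rw [phiPlus_odd]
    refine mem_Yc_even.2 ⟨h1, ?_⟩
    rw [tagCount_of_globalTag trivial]
    simp only
    omega
  · obtain ⟨h1, h2⟩ := mem_Yc_even.1 hC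
    refine (mem_Yc_odd (r := r + 1)).2 ⟨phiPlus_even_mem h1, ?_, ?_⟩
    · classical
      rw [phiPlus_even]
      exact id
    · rw [ncard_tagged_phiPlus h1, h2]

theorem edgeMap_false_mapsTo (n i : ℕ) :
    Set.MapsTo (phiMinus n) (Yc n (i + 1)) (Yc (n + 1) i) := by
  intro C hC
  rcases layer_cases n with rfl | ⟨r, rfl⟩ | ⟨r, rfl⟩
  · have := (mem_Yc_zero.1 hC).2
    omega
  · obtain ⟨h1, h2, h3⟩ := mem_Yc_odd.1 hC
    rw [phiMinus_odd]
    refine mem_Yc_even.2 ⟨h1, ?_⟩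
    rw [tagCount_of_not_globalTag h2]
    omega
  · obtain ⟨h1, h2⟩ := mem_Yc_even.1 hC
    obtain ⟨k, hk⟩ := exists_isMinusIndex_of_tagCount h1 (by omega)
    rw [phiMinus_even h1 hk]
    refine (mem_Yc_odd (r := r + 1)).2 ⟨phiMinus_even_mem h1 hk, id, ?_⟩
    have := ncard_tagged_minusLift h1 hk
    omega

theorem edgeMap_true_injOn (n i : ℕ) : Set.InjOn (phiPlus n) (Yc n i) := by
  intro C hC D hD e
  rcases layer_cases n with rfl | ⟨r, rfl⟩ | ⟨r, rfl⟩
  · rw [(mem_Yc_zero.1 hC).1, (mem_Yc_zero.1 hD).1]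
  · rw [phiPlus_odd, phiPlus_odd, TaggedSet.mk.injEq] at e
    exact TaggedSet.ext e.1 e.2.1
      (propext (iff_of_false (mem_Yc_odd.1 hC).2.1 (mem_Yc_odd.1 hD).2.1))
  · rw [← contractTop_phiPlus (mem_Yc_even.1 hC).1, ← contractTop_phiPlus (mem_Yc_even.1 hD).1, e]

theorem edgeMap_false_injOn (n i : ℕ) : Set.InjOn (phiMinus n) (Yc n (i + 1)) := by
  intro C hC D hD e
  rcases layer_cases n with rfl | ⟨r, rfl⟩ | ⟨r, rfl⟩
  · rw [(mem_Yc_zero.1 hC).1, (mem_Yc_zero.1 hD).1]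
  · rwa [phiMinus_odd, phiMinus_odd] at e
  · obtain ⟨h1, h2⟩ := mem_Yc_even.1 hC
    obtain ⟨h1', h2'⟩ := mem_Yc_even.1 hD
    obtain ⟨k, hk⟩ := exists_isMinusIndex_of_tagCount h1 (by omega)
    obtain ⟨k', hk'⟩ := exists_isMinusIndex_of_tagCount h1' (by omega)
    rw [phiMinus_even h1 hk, phiMinus_even h1' hk'] at e
    rw [← contractTop_minusLift h1 hk, ← contractTop_minusLift h1' hk', e]

theorem edgeMap_images_disjoint (n i j : ℕ) :
    Disjoint (phiPlus n '' Yc n i) (phiMinus n '' Yc n (j + 1)) := by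
  rw [Set.disjoint_left]
  rintro _ ⟨C, hC, rfl⟩ ⟨D, hD, e⟩
  rcases layer_cases n with rfl | ⟨r, rfl⟩ | ⟨r, rfl⟩
  · have := (mem_Yc_zero.1 hD).2
    omega
  · rw [phiMinus_odd, phiPlus_odd] at e
    apply (mem_Yc_odd.1 hD).2.1
    rw [e]
    trivial
  · classical
    obtain ⟨h1', h2'⟩ := mem_Yc_even.1 hD
    obtain ⟨k', hk'⟩ := exists_isMinusIndex_of_tagCount h1' (by omega)
    rw [phiMinus_even h1' hk', phiPlus_even] at e
    have h : -simpleRoot (r + 1) ∈ (minusLift r k' D).roots := by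
      rw [e]
      exact Or.inl rfl
    have := h1'.noncrossing.neg_bounds (mem_minusLift_neg.1 h).1
    omega

/-- An element of an even layer remembers its edge through the global tag. In an odd layer of rank
`r + 1` it is decided by the presence of `-α_{r+1}`, and the preimage is the contraction. -/
theorem exists_edge_of_mem_Yc_succ {n v : ℕ} {X : TaggedSet} (hX : X ∈ Yc (n + 1) v) :
    (∃ i, v = i + 1 ∧ X ∈ phiPlus n '' Yc n i) ∨ X ∈ phiMinus n '' Yc n (v + 1) := by
  rcases layer_cases n with rfl | ⟨r, rfl⟩ | ⟨r, rfl⟩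
  · obtain ⟨h1, h2, h3⟩ := (mem_Yc_odd (r := 0)).1 hX
    obtain ⟨h4, h5⟩ := isTaggedCluster_zero.1 h1
    rw [h5, Set.ncard_empty] at h3
    refine Or.inl ⟨0, h3, X, mem_Yc_zero.2 ⟨?_, rfl⟩, phiPlus_zero X⟩
    exact TaggedSet.ext h4 h5 (propext ⟨h2, False.elim⟩)
  · obtain ⟨h1, h2⟩ := mem_Yc_even.1 hX
    by_cases hg : X.globalTag
    · rw [tagCount_of_globalTag hg] at h2
      refine Or.inl ⟨v - 1, by omega, ⟨X.roots, X.tagged, False⟩,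
        mem_Yc_odd.2 ⟨h1, id, by simp only; omega⟩, ?_⟩
      rw [phiPlus_odd]
      exact TaggedSet.ext rfl rfl (propext ⟨fun _ => hg, fun _ => trivial⟩)
    · rw [tagCount_of_not_globalTag hg] at h2
      exact Or.inr ⟨X, mem_Yc_odd.2 ⟨h1, hg, by omega⟩, phiMinus_odd r X⟩
  · obtain ⟨h1, h2, h3⟩ := (mem_Yc_odd (r := r + 1)).1 hX
    have hC := isTaggedCluster_contractTop h1
    by_cases h : -simpleRoot (r + 1) ∈ X.roots
    · have e := phiPlus_contractTop h1 h2 h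
      have hc := ncard_tagged_phiPlus hC
      rw [e] at hc
      exact Or.inl ⟨v - 1, by omega, contractTop r X, mem_Yc_even.2 ⟨hC, by omega⟩, e⟩
    · obtain ⟨k, hk, e⟩ := exists_minusLift_contractTop h1 h2 h
      have hc := ncard_tagged_minusLift hC hk
      rw [e] at hc
      exact Or.inr ⟨contractTop r X, mem_Yc_even.2 ⟨hC, by omega⟩, (phiMinus_even hC hk).trans e⟩

theorem isPascalArray_Yc : IsPascalArray graphAInf 0 Yc edgeMap where
  layer_zero v := by
    by_cases hv : v = 0
    · subst hv
      have e1 : Yc 0 0 = {⟨∅, ∅, False⟩} := by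
        ext C
        rw [mem_Yc_zero]
        simp
      have e2 : graphAInf.paths 0 0 0 = {[]} := by
        ext es
        simp only [DirGraph.paths, Set.mem_ofPred_eq, List.length_eq_zero_iff,
          Set.mem_singleton_iff]
        refine ⟨fun h => h.1, ?_⟩
        rintro rfl
        exact ⟨rfl, rfl⟩
      rw [e1, e2]
      exact ⟨Equiv.ofUnique _ _⟩
    · have e1 : IsEmpty (Yc 0 v) := ⟨fun C => hv (mem_Yc_zero.1 C.2).2⟩
      have e2 : IsEmpty (graphAInf.paths 0 0 v) := by
        refine ⟨?_⟩
        rintro ⟨es, h1, h2⟩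
        obtain rfl := List.length_eq_zero_iff.1 h1
        exact hv h2.symm
      exact ⟨Equiv.equivOfIsEmpty _ _⟩
  mapsTo := by
    rintro n ⟨i, b⟩
    cases b
    · exact edgeMap_false_mapsTo n i
    · exact edgeMap_true_mapsTo n i
  injOn := by
    rintro n ⟨i, b⟩
    cases b
    · exact edgeMap_false_injOn n i
    · exact edgeMap_true_injOn n i
  disjoint := by
    rintro n ⟨i, b⟩ ⟨j, c⟩ hne h
    cases b <;> cases c
    · exact absurd (congrArg (fun k : ℕ => (k, false)) (show i = j from h)) hne
    · exact (edgeMap_images_disjoint n j i).symm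
    · exact edgeMap_images_disjoint n i j
    · exact absurd (congrArg (fun k : ℕ => (k, true)) (Nat.succ_injective (show i + 1 = j + 1 from h)))
        hne
  union := by
    intro n v
    apply Set.Subset.antisymm
    · intro X hX
      simp only [Set.mem_iUnion]
      rcases exists_edge_of_mem_Yc_succ hX with ⟨i, rfl, h⟩ | h
      · exact ⟨(i, true), rfl, h⟩
      · exact ⟨(v, false), rfl, h⟩
    · intro X hX
      simp only [Set.mem_iUnion] at hX
      obtain ⟨⟨i, b⟩, rfl, C, hC, rfl⟩ := hX
      cases b
      · exact edgeMap_false_mapsTo n i hC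
      · exact edgeMap_true_mapsTo n i hC

/-- Reversing all edges of `A_∞` exchanges the two edges between `i` and `i + 1`, so the same array
works with the two edge maps exchanged. -/
theorem isPascalArray_op_Yc :
    IsPascalArray graphAInf.op 0 Yc fun n e => edgeMap n (e.1, !e.2) where
  layer_zero v := by
    have e : graphAInf.op.paths 0 0 v = graphAInf.paths 0 0 v := by
      ext es
      simp only [DirGraph.paths, Set.mem_ofPred_eq]
      refine and_congr_right fun h => ?_
      obtain rfl := List.length_eq_zero_iff.1 h
      exact Iff.rfl
    rw [e]
    exact isPascalArray_Yc.layer_zero v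
  mapsTo := by
    rintro n ⟨i, b⟩
    cases b
    · exact edgeMap_true_mapsTo n i
    · exact edgeMap_false_mapsTo n i
  injOn := by
    rintro n ⟨i, b⟩
    cases b
    · exact edgeMap_true_injOn n i
    · exact edgeMap_false_injOn n i
  disjoint := by
    rintro n ⟨i, b⟩ ⟨j, c⟩ hne h
    cases b <;> cases c
    · exact absurd (congrArg (fun k : ℕ => (k, false)) (Nat.succ_injective (show i + 1 = j + 1 from h)))
        hne
    · exact edgeMap_images_disjoint n i j
    · exact (edgeMap_images_disjoint n j i).symm
    · exact absurd (congrArg (fun k : ℕ => (k, true)) (show i = j from h)) hne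
  union := by
    intro n v
    rw [isPascalArray_Yc.union n v]
    ext X
    simp only [Set.mem_iUnion]
    constructor
    · rintro ⟨⟨i, b⟩, h, hX⟩
      refine ⟨(i, !b), ?_, ?_⟩
      · cases b <;> exact h
      · cases b <;> exact hX
    · rintro ⟨⟨i, b⟩, h, hX⟩
      refine ⟨(i, !b), ?_, ?_⟩
      · cases b <;> exact h
      · cases b <;> exact hX

/-! ### Counting -/

theorem Yc_succ_eq_succ (n l : ℕ) :
    Yc (n + 1) (l + 1) = phiPlus n '' Yc n l ∪ phiMinus n '' Yc n (l + 2) := by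
  apply Set.Subset.antisymm
  · intro X hX
    rcases exists_edge_of_mem_Yc_succ hX with ⟨i, e, h⟩ | h
    · obtain rfl := Nat.succ_injective e
      exact Or.inl h
    · exact Or.inr h
  · rintro _ (⟨C, hC, rfl⟩ | ⟨C, hC, rfl⟩)
    · exact edgeMap_true_mapsTo n l hC
    · exact edgeMap_false_mapsTo n (l + 1) hC

theorem Yc_succ_eq_zero (n : ℕ) : Yc (n + 1) 0 = phiMinus n '' Yc n 1 := by
  apply Set.Subset.antisymm
  · intro X hX
    rcases exists_edge_of_mem_Yc_succ hX with ⟨i, e, -⟩ | h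
    · omega
    · exact h
  · rintro _ ⟨C, hC, rfl⟩
    exact edgeMap_false_mapsTo n 0 hC

theorem Yc_finite (n l : ℕ) : (Yc n l).Finite := by
  induction n generalizing l with
  | zero => exact (Set.finite_singleton ⟨∅, ∅, False⟩).subset fun C hC => (mem_Yc_zero.1 hC).1
  | succ n ih =>
    rcases l with - | l
    · rw [Yc_succ_eq_zero]
      exact (ih 1).image _
    · rw [Yc_succ_eq_succ]
      exact ((ih l).image _).union ((ih (l + 2)).image _)

/-- The number of elements of `Y_c(n; l)`. -/
noncomputable def countYc (n l : ℕ) : ℕ := (Yc n l).ncard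

theorem countYc_succ_succ (n l : ℕ) :
    countYc (n + 1) (l + 1) = countYc n l + countYc n (l + 2) := by
  rw [countYc, Yc_succ_eq_succ, Set.ncard_union_eq (edgeMap_images_disjoint n l (l + 1))
    ((Yc_finite _ _).image _) ((Yc_finite _ _).image _), (edgeMap_true_injOn n l).ncard_image,
    (edgeMap_false_injOn n (l + 1)).ncard_image]
  rfl

theorem countYc_succ_zero (n : ℕ) : countYc (n + 1) 0 = countYc n 1 := by
  rw [countYc, Yc_succ_eq_zero, (edgeMap_false_injOn n 0).ncard_image]
  rfl

theorem countYc_zero (l : ℕ) : countYc 0 l = if l = 0 then 1 else 0 := by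
  split_ifs with h
  · subst h
    rw [countYc, Set.ncard_eq_one]
    refine ⟨⟨∅, ∅, False⟩, ?_⟩
    ext C
    simp [mem_Yc_zero]
  · rw [countYc, Set.ncard_eq_zero (Yc_finite _ _)]
    ext C
    simp [mem_Yc_zero, h]

theorem countYc_eq_zero {n l : ℕ} (h : n < l) : countYc n l = 0 := by
  induction n generalizing l with
  | zero => rw [countYc_zero, if_neg (by omega)]
  | succ n ih =>
    obtain ⟨l, rfl⟩ : ∃ k, l = k + 1 := ⟨l - 1, by omega⟩
    rw [countYc_succ_succ, ih (by omega), ih (by omega)]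

/-- The number of pairs of elements of layers `a` and `b` at the same vertex `l < L`. -/
noncomputable def countPairs (L a b : ℕ) : ℕ :=
  ∑ l ∈ Finset.range L, countYc a l * countYc b l

/-- Apart from the boundary term caused by truncating the sum, the right hand side is symmetric in
`a` and `b`. -/
theorem countPairs_succ (L a b : ℕ) : countPairs (L + 1) (a + 1) b =
    ∑ l ∈ Finset.range (L + 1), (countYc a l * countYc b (l + 1) + countYc a (l + 1) * countYc b l)
      - countYc a L * countYc b (L + 1) := by
  rw [countPairs, Finset.sum_range_succ', countYc_succ_zero, Finset.sum_add_distrib,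
    Finset.sum_range_succ (fun l => countYc a l * countYc b (l + 1)),
    Finset.sum_range_succ' (fun l => countYc a (l + 1) * countYc b l)]
  have h2 : ∀ k : ℕ, k + 1 + 1 = k + 2 := fun _ => rfl
  simp only [countYc_succ_succ, add_mul, Finset.sum_add_distrib, h2, zero_add]
  omega

/-- The symmetry of the adjacency matrix of `A_∞`. The boundary terms vanish because layer `n` is
empty above the vertex `n`. -/
theorem countPairs_shift {L a b : ℕ} (ha : a < L) (hb : b < L) :
    countPairs (L + 1) (a + 1) b = countPairs (L + 1) a (b + 1) := by
  have e : countPairs (L + 1) a (b + 1) = countPairs (L + 1) (b + 1) a := by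
    simp only [countPairs, mul_comm]
  rw [e, countPairs_succ, countPairs_succ, countYc_eq_zero ha, countYc_eq_zero hb,
    zero_mul, zero_mul]
  congr 1
  refine Finset.sum_congr rfl fun l _ => ?_
  ring

theorem countPairs_shift_add {L a b k : ℕ} (h : a + b + k ≤ L) :
    countPairs (L + 1) (a + k) b = countPairs (L + 1) a (b + k) := by
  induction k generalizing b with
  | zero => rfl
  | succ k ih =>
    rw [← add_assoc, countPairs_shift (by omega) (by omega), ih (by omega), add_assoc, add_comm 1]

theorem countPairs_one {L b : ℕ} (h : 1 ≤ L) : countPairs (L + 1) 1 b = countYc b 1 := by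
  rw [countPairs, Finset.sum_eq_single 1]
  · rw [countYc_succ_succ, countYc_zero, countYc_zero]
    simp
  · intro l _ hl
    rcases l with - | l
    · rw [countYc_succ_zero, countYc_zero]
      simp
    · rw [countYc_eq_zero (by omega), zero_mul]
  · intro h'
    simp at h'
    omega

theorem countYc_one (r : ℕ) : countYc (2 * r + 1) 1 = {X | IsCluster r X}.ncard := by
  have e : Yc (2 * r + 1) 1 = (fun X => (⟨X, ∅, False⟩ : TaggedSet)) '' {X | IsCluster r X} := by
    ext C
    rw [mem_Yc_odd]
    constructor
    · rintro ⟨h1, h2, h3⟩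
      have h4 : C.tagged = ∅ := (Set.ncard_eq_zero (tagged_finite h1)).1 (by omega)
      exact ⟨C.roots, h1.1, TaggedSet.ext rfl h4.symm (propext ⟨False.elim, h2⟩)⟩
    · rintro ⟨X, hX, rfl⟩
      exact ⟨⟨hX, Set.empty_subset _⟩, id, by simp⟩
  rw [countYc, e, Set.InjOn.ncard_image]
  intro X _ Z _ h
  exact congrArg TaggedSet.roots h

/-- For positive `n`, layer by layer one factor is moved down to layer `1`, which has a single
element, at the vertex `1`. What remains is `Y(2n-1; 1)`, that is, clusters of type `A_{n-1}`
without tags. -/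
theorem countPairs_eq_ncard_rootClusters {L n : ℕ} (h : 2 * n ≤ L) :
    countPairs (L + 1) n n = (rootClusters n).ncard := by
  rcases n with - | n
  · have e : rootClusters 0 = {∅} := by
      ext X
      exact isCluster_zero
    rw [e, Set.ncard_singleton, countPairs, Finset.sum_eq_single 0]
    · simp [countYc_zero]
    · intro l _ hl
      rw [countYc_zero, if_neg hl, zero_mul]
    · intro h
      simp at h
  · rw [add_comm n 1, countPairs_shift_add (by omega), countPairs_one (by omega),
      show 1 + n + n = 2 * n + 1 by omega, countYc_one, rootClusters, Nat.add_sub_cancel_left]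

theorem ncard_biUnion_pairs_le (n L : ℕ) :
    (⋃ v ∈ Set.Iio L, Yc n v ×ˢ Yc n v).Finite ∧
      (⋃ v ∈ Set.Iio L, Yc n v ×ˢ Yc n v).ncard ≤ countPairs L n n := by
  induction L with
  | zero => simp [countPairs]
  | succ L ih =>
    have e : (⋃ v ∈ Set.Iio (L + 1), Yc n v ×ˢ Yc n v) =
        (⋃ v ∈ Set.Iio L, Yc n v ×ˢ Yc n v) ∪ Yc n L ×ˢ Yc n L := by
      rw [show Set.Iio (L + 1) = insert L (Set.Iio L) by ext; simp, Set.biUnion_insert,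
        Set.union_comm]
    rw [e]
    refine ⟨ih.1.union ((Yc_finite n L).prod (Yc_finite n L)), (Set.ncard_union_le _ _).trans ?_⟩
    rw [countPairs, Finset.sum_range_succ, Set.ncard_prod]
    exact Nat.add_le_add_right ih.2 _

/-- The set of pairs has at most as many elements as there are clusters, so surjectivity follows
from injectivity. -/
theorem bijOn_of_injOn {n : ℕ} {Φ : Set Lat → TaggedSet × TaggedSet}
    (hm : Set.MapsTo Φ (rootClusters n) (⋃ v, Yc n v ×ˢ Yc n v))
    (hi : Set.InjOn Φ (rootClusters n)) :
    Set.BijOn Φ (rootClusters n) (⋃ v, Yc n v ×ˢ Yc n v) := by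
  refine ⟨hm, hi, ?_⟩
  -- Vertices above `n` contribute nothing; the bound `2 * n + 1` is chosen large enough for the
  -- truncated sums to be shifted without boundary terms.
  have e : (⋃ v, Yc n v ×ˢ Yc n v) = ⋃ v ∈ Set.Iio (2 * n + 1), Yc n v ×ˢ Yc n v := by
    ext p
    simp only [Set.mem_iUnion]
    constructor
    · rintro ⟨v, hv⟩
      refine ⟨v, ?_, hv⟩
      by_contra hlt
      have : countYc n v = 0 := countYc_eq_zero (by rw [Set.mem_Iio] at hlt; omega)
      rw [countYc, Set.ncard_eq_zero (Yc_finite _ _)] at this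
      rw [this] at hv
      exact hv.1
    · rintro ⟨v, -, hv⟩
      exact ⟨v, hv⟩
  have h2 := ncard_biUnion_pairs_le n (2 * n + 1)
  rw [← e] at h2
  have h3 : Φ '' rootClusters n = ⋃ v, Yc n v ×ˢ Yc n v := by
    refine Set.eq_of_subset_of_ncard_le hm.image_subset ?_ h2.1
    rw [hi.ncard_image, ← countPairs_eq_ncard_rootClusters le_rfl]
    exact h2.2
  rw [Set.SurjOn, h3]

theorem disjoint_pairs (n : ℕ) :
    Pairwise fun v w => Disjoint (Yc n v ×ˢ Yc n v) (Yc n w ×ˢ Yc n w) := by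
  intro v w hne
  rw [Set.disjoint_left]
  rintro ⟨C, D⟩ ⟨h1, -⟩ ⟨h2, -⟩
  rcases layer_cases n with rfl | ⟨r, rfl⟩ | ⟨r, rfl⟩
  · exact hne ((mem_Yc_zero.1 h1).2.trans (mem_Yc_zero.1 h2).2.symm)
  · exact hne ((mem_Yc_odd.1 h1).2.2.trans (mem_Yc_odd.1 h2).2.2.symm)
  · exact hne ((mem_Yc_even.1 h1).2.trans (mem_Yc_even.1 h2).2.symm)

/-! ### Bra-ket extraction at an arbitrary place

The simple roots are split into `α_1, …, α_{p-1}` and `α_p, …, α_m`. -/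

/-- There is exactly one root in `X` that ends with `α_k` and starts at most at `α_p`. -/
def Single (p : ℕ) (X : Set Lat) (k : ℕ) : Prop :=
  p ≤ k ∧ ∃ i, startsAt X k ∩ Set.Iic p = {i}

/-- There are several roots in `X` that end with `α_k` and start at most at `α_p`. -/
def Multi (p : ℕ) (X : Set Lat) (k : ℕ) : Prop :=
  p ≤ k ∧ ∃ i j, i < j ∧ j ≤ p ∧ rootSum i k ∈ X ∧ rootSum j k ∈ X

open Classical in
/-- The largest `t < k` with `Multi p X t`, and `p - 1` if there is none. -/
noncomputable def cutAt (p : ℕ) (X : Set Lat) (k : ℕ) : ℕ :=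
  if {t | Multi p X t ∧ t < k}.Nonempty then sSup {t | Multi p X t ∧ t < k} else p - 1

/-- The result of the replacements in the bra-ket extraction. -/
def splitRoots (p : ℕ) (X : Set Lat) : Set Lat :=
  {α | α ∈ X ∧ (¬ ∃ k i, Single p X k ∧ i ≤ p ∧ i ≤ k ∧ α = rootSum i k) ∧
      ¬ ∃ k i, Multi p X k ∧ i ≤ k ∧ α = rootSum i k} ∪
    {α | ∃ k, Single p X k ∧ α = rootSum (cutAt p X k + 1) k} ∪
    {α | ∃ k, Multi p X k ∧ α = -simpleRoot k} ∪
    {α | ∃ k, Multi p X k ∧ ∃ i ∈ startsAt X k, (∃ i' ∈ startsAt X k, i' < i) ∧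
      α = -simpleRoot (i - 1)}

/-- The tags that arise in the bra-ket extraction. -/
def splitTags (p : ℕ) (X : Set Lat) : Set Lat :=
  {α | ∃ k, Multi p X k ∧ (α = -simpleRoot k ∨
    ∃ j, IsSecond (startsAt X k) j ∧ α = -simpleRoot (j - 1))}

theorem cutAt_spec {p k : ℕ} (X : Set Lat) (hp : 1 ≤ p) (hk : p ≤ k) :
    p ≤ cutAt p X k + 1 ∧ cutAt p X k < k ∧ (p ≤ cutAt p X k → Multi p X (cutAt p X k)) ∧
      ∀ t, Multi p X t → t < k → t ≤ cutAt p X k := by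
  unfold cutAt
  have hb : BddAbove {t | Multi p X t ∧ t < k} := ⟨k, fun t ht => ht.2.le⟩
  split_ifs with h
  · have h1 := Nat.sSup_mem h hb
    exact ⟨h1.1.1.trans (Nat.le_succ _), h1.2, fun _ => h1.1, fun t h2 h3 => le_csSup hb ⟨h2, h3⟩⟩
  · exact ⟨by omega, by omega, fun h' => by omega, fun t h2 h3 => absurd ⟨t, h2, h3⟩ h⟩

/-! ### The replaced roots: crossings and number -/

section split

variable {p m : ℕ} {X : Set Lat}

theorem Multi.exists_least (hX : Noncrossing m X) {k : ℕ} (h : Multi p X k) :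
    ∃ i₀, rootSum i₀ k ∈ X ∧ 1 ≤ i₀ ∧ i₀ < p ∧ ∀ i ∈ startsAt X k, i₀ ≤ i := by
  obtain ⟨h1, i, j, h2, h3, h4, h5⟩ := h
  obtain ⟨i₀, h6, h7⟩ := TaggedClusters.exists_least (I := startsAt X k) ⟨i, h4⟩
  have := h7 i h4
  exact ⟨i₀, h6, (hX.bounds h6).1, by omega, h7⟩

theorem Multi.exists_second {k : ℕ} (h : Multi p X k) :
    ∃ j, IsSecond (startsAt X k) j ∧ j ≤ p := by
  obtain ⟨h1, i, j, h2, h3, h4, h5⟩ := h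
  obtain ⟨s, hs, hsj⟩ := exists_isSecond (I := startsAt X k) h4 h5 h2
  exact ⟨s, hs, hsj.trans h3⟩

theorem Multi.second_le {k j : ℕ} (h : Multi p X k) (hj : IsSecond (startsAt X k) j) : j ≤ p := by
  obtain ⟨j', h1, h2⟩ := h.exists_second
  rwa [hj.unique h1]

theorem Single.exists_start {k : ℕ} (h : Single p X k) :
    ∃ i, rootSum i k ∈ X ∧ i ≤ p ∧ ∀ i', rootSum i' k ∈ X → i' ≤ p → i' = i := by
  obtain ⟨h1, i, hi⟩ := h
  have h2 : i ∈ startsAt X k ∩ Set.Iic p := by rw [hi]; rfl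
  refine ⟨i, h2.1, h2.2, fun i' h3 h4 => ?_⟩
  have : i' ∈ startsAt X k ∩ Set.Iic p := ⟨h3, h4⟩
  rwa [hi] at this

theorem Single.not_multi {k : ℕ} (h : Single p X k) : ¬ Multi p X k := by
  rintro ⟨-, i, j, h2, h3, h4, h5⟩
  obtain ⟨i', -, -, h6⟩ := h.exists_start
  have := h6 i h4 (by omega)
  have := h6 j h5 h3
  omega

theorem single_or_multi {i k : ℕ} (h : rootSum i k ∈ X) (hi : i ≤ p) (hk : p ≤ k) :
    Single p X k ∨ Multi p X k := by
  by_cases hm : Multi p X k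
  · exact Or.inr hm
  · refine Or.inl ⟨hk, i, ?_⟩
    ext i'
    constructor
    · rintro ⟨h1, h2⟩
      by_contra hne
      rcases lt_or_gt_of_ne (show i' ≠ i from hne) with h3 | h3
      · exact hm ⟨hk, i', i, h3, hi, h1, h⟩
      · exact hm ⟨hk, i, i', h3, h2, h, h1⟩
    · intro h1
      rw [Set.mem_singleton_iff.1 h1]
      exact ⟨h, hi⟩

theorem rootSum_mem_splitRoots (hp : 1 ≤ p) {i j : ℕ} (hij : i ≤ j) :
    rootSum i j ∈ splitRoots p X ↔ (rootSum i j ∈ X ∧ (j < p ∨ (p < i ∧ ¬ Multi p X j))) ∨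
      (Single p X j ∧ i = cutAt p X j + 1) := by
  constructor
  · rintro (((⟨h1, h2, h3⟩ | ⟨k, h1, e⟩) | ⟨k, -, e⟩) | ⟨k, -, i', -, -, e⟩)
    · left
      refine ⟨h1, ?_⟩
      by_cases hj : j < p
      · exact Or.inl hj
      · refine Or.inr ⟨?_, fun hm => h3 ⟨j, i, hm, hij, rfl⟩⟩
        by_contra hi
        rcases single_or_multi h1 (by omega : i ≤ p) (by omega) with h | h
        · exact h2 ⟨j, i, h, by omega, hij, rfl⟩
        · exact h3 ⟨j, i, h, hij, rfl⟩
    · have := cutAt_spec X hp h1.1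
      obtain ⟨rfl, rfl⟩ := rootSum_inj hij (by omega) e
      exact Or.inr ⟨h1, rfl⟩
    · exact absurd e (rootSum_ne_neg _ _ _)
    · exact absurd e (rootSum_ne_neg _ _ _)
  · rintro (⟨h1, h2⟩ | ⟨h1, rfl⟩)
    · refine Or.inl (Or.inl (Or.inl ⟨h1, ?_, ?_⟩))
      · rintro ⟨k, i', h3, h4, h5, e⟩
        obtain ⟨rfl, rfl⟩ := rootSum_inj hij h5 e
        have := h3.1
        omega
      · rintro ⟨k, i', h3, h4, e⟩
        obtain ⟨rfl, rfl⟩ := rootSum_inj hij h4 e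
        rcases h2 with h2 | h2
        · have := h3.1
          omega
        · exact h2.2 h3
    · exact Or.inl (Or.inl (Or.inr ⟨j, h1, rfl⟩))

theorem neg_mem_splitRoots (hX : Noncrossing m X) {u : ℕ} :
    -simpleRoot u ∈ splitRoots p X ↔ -simpleRoot u ∈ X ∨ Multi p X u ∨
      ∃ k, Multi p X k ∧ rootSum (u + 1) k ∈ X ∧ ∃ i, rootSum i k ∈ X ∧ i ≤ u := by
  constructor
  · rintro (((⟨h1, h2, h3⟩ | ⟨k, h1, e⟩) | ⟨k, h, e⟩) | ⟨k, h, i, h1, ⟨i', h2, h3⟩, e⟩)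
    · exact Or.inl h1
    · exact absurd e.symm (rootSum_ne_neg _ _ _)
    · rw [neg_simpleRoot_inj e]
      exact Or.inr (Or.inl h)
    · have := hX.bounds h1
      have := neg_simpleRoot_inj e
      obtain rfl : i = u + 1 := by omega
      exact Or.inr (Or.inr ⟨k, h, h1, i', h2, by omega⟩)
  · rintro (h | h | ⟨k, h, h1, i, h2, h3⟩)
    · refine Or.inl (Or.inl (Or.inl ⟨h, ?_, ?_⟩))
      · rintro ⟨k, i, -, -, -, e⟩
        exact rootSum_ne_neg _ _ _ e.symm
      · rintro ⟨k, i, -, -, e⟩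
        exact rootSum_ne_neg _ _ _ e.symm
    · exact Or.inl (Or.inr ⟨u, h, rfl⟩)
    · exact Or.inr ⟨k, h, u + 1, h1, ⟨i, h2, by omega⟩, by rw [Nat.add_sub_cancel]⟩

theorem neg_mem_splitTags (hX : Noncrossing m X) {u : ℕ} :
    -simpleRoot u ∈ splitTags p X ↔ Multi p X u ∨
      ∃ k, Multi p X k ∧ IsSecond (startsAt X k) (u + 1) := by
  constructor
  · rintro ⟨k, h, e | ⟨j, hj, e⟩⟩
    · rw [neg_simpleRoot_inj e]
      exact Or.inl h
    · have := hX.bounds hj.1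
      have := neg_simpleRoot_inj e
      obtain rfl : j = u + 1 := by omega
      exact Or.inr ⟨k, h, hj⟩
  · rintro (h | ⟨k, h, hj⟩)
    · exact ⟨u, h, Or.inl rfl⟩
    · exact ⟨k, h, Or.inr ⟨u + 1, hj, by rw [Nat.add_sub_cancel]⟩⟩

theorem splitTags_subset (hX : Noncrossing m X) {α : Lat} (h : α ∈ splitTags p X) :
    α ∈ splitRoots p X ∧ ∃ u, α = -simpleRoot u := by
  obtain ⟨k, hk, rfl | ⟨j, hj, rfl⟩⟩ := h
  · exact ⟨(neg_mem_splitRoots hX).2 (Or.inr (Or.inl hk)), k, rfl⟩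
  · obtain ⟨h1, i₀, h2, h3, -⟩ := hj
    exact ⟨Or.inr ⟨k, hk, j, h1, ⟨i₀, h2, h3⟩, rfl⟩, _, rfl⟩

theorem splitRoots_subset (hX : Noncrossing m X) (hp : 1 ≤ p) :
    splitRoots p X ⊆ almostPosRoots m := by
  rintro α (((⟨h1, -⟩ | ⟨k, h1, rfl⟩) | ⟨k, h, rfl⟩) | ⟨k, h, i, h1, ⟨i', h2, h3⟩, rfl⟩)
  · exact hX.sub h1
  · have := cutAt_spec X hp h1.1
    obtain ⟨i, h2, -⟩ := h1.exists_start
    have := hX.bounds h2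
    exact rootSum_mem.2 ⟨by omega, by omega, by omega⟩
  · obtain ⟨i, h2, -⟩ := h.exists_least hX
    have := hX.bounds h2
    exact neg_mem.2 ⟨by omega, by omega⟩
  · have := hX.bounds h1
    have := hX.bounds h2
    exact neg_mem.2 ⟨by omega, by omega⟩

/-- No element of `splitRoots p X` involves both `α_{p-1}` and `α_p`. -/
theorem splitRoots_left_or_right (hp : 1 ≤ p) {i j : ℕ} (hij : i ≤ j)
    (h : rootSum i j ∈ splitRoots p X) : j < p ∨ p ≤ i := by
  rcases (rootSum_mem_splitRoots hp hij).1 h with ⟨-, h | h⟩ | ⟨hs, rfl⟩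
  · exact Or.inl h
  · exact Or.inr h.1.le
  · exact Or.inr (cutAt_spec X hp hs.1).1

/-- In the left half a new root `-α_u` stems from some `[u+1, k] ∈ X` with `k ≥ p`, and a root of
the left half that crosses the former crosses the latter. -/
theorem splitRoots_left_neg_pos (hX : Noncrossing m X) (hp : 1 ≤ p) {u k l : ℕ} (hkl : k ≤ l)
    (hl : l < p) (h : -simpleRoot u ∈ splitRoots p X) (h' : rootSum k l ∈ splitRoots p X)
    (h1 : k ≤ u) (h2 : u ≤ l) : False := by
  rcases (rootSum_mem_splitRoots hp hkl).1 h' with ⟨h', -⟩ | ⟨h', -⟩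
  · rcases (neg_mem_splitRoots hX).1 h with h | h | ⟨k', h, h3, -⟩
    · exact hX.neg_pos h h' h1 h2
    · have := h.1
      omega
    · have := h.1
      exact hX.pos_pos h' h3 (by omega) (by omega) (by omega)
  · have := h'.1
    omega

/-- A crossing is traced back to `X`. If the later root is new, `[t+1, l]`, then `X` has a root
`[i₀, t]` with `i₀ < p`, which crosses a kept earlier root. If only the earlier root is new, the
root it replaced crosses the later one. For two new roots the maximality of the earlier cut index is
violated, or an index is both `Single` and `Multi`. -/
theorem splitRoots_right_pos_pos (hX : Noncrossing m X) (hp : 1 ≤ p) {i j k l : ℕ} (hij : i ≤ j)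
    (hkl : k ≤ l) (hi : p ≤ i) (h : rootSum i j ∈ splitRoots p X)
    (h' : rootSum k l ∈ splitRoots p X) (h1 : i < k) (h2 : k ≤ j + 1) (h3 : j < l) : False := by
  rcases (rootSum_mem_splitRoots hp hij).1 h with ⟨h, h4⟩ | ⟨hs, rfl⟩
  · rcases (rootSum_mem_splitRoots hp hkl).1 h' with ⟨h', -⟩ | ⟨hs', rfl⟩
    · exact hX.pos_pos h h' h1 h2 h3
    · obtain ⟨c1, c2, c3, c4⟩ := cutAt_spec X hp hs'.1
      have hm := c3 (by omega)
      have hne : j ≠ cutAt p X l := by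
        rintro rfl
        exact (h4.resolve_left (by omega)).2 hm
      obtain ⟨i₀, g1, g2, g3, -⟩ := hm.exists_least hX
      exact hX.pos_pos g1 h (by omega) (by omega) (by omega)
  · obtain ⟨c1, c2, c3, c4⟩ := cutAt_spec X hp hs.1
    obtain ⟨i₀, g1, g2, -⟩ := hs.exists_start
    rcases (rootSum_mem_splitRoots hp hkl).1 h' with ⟨h', -⟩ | ⟨hs', rfl⟩
    · exact hX.pos_pos g1 h' (by omega) (by omega) (by omega)
    · obtain ⟨d1, d2, d3, d4⟩ := cutAt_spec X hp hs'.1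
      have hm := d3 (by omega)
      by_cases hc : cutAt p X l < j
      · have := c4 _ hm hc
        omega
      · have : cutAt p X l = j := by omega
        rw [this] at hm
        exact hs.not_multi hm

theorem splitRoots_right_neg_pos (hX : Noncrossing m X) (hp : 1 ≤ p) {u k l : ℕ} (hkl : k ≤ l)
    (hk : p ≤ k) (h : -simpleRoot u ∈ splitRoots p X) (h' : rootSum k l ∈ splitRoots p X)
    (h1 : k ≤ u) (h2 : u ≤ l) : False := by
  rcases (rootSum_mem_splitRoots hp hkl).1 h' with ⟨h', h4⟩ | ⟨hs', rfl⟩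
  · have h4 := h4.resolve_left (by omega)
    have key : ∀ t, Multi p X t → k ≤ t → t ≤ l → False := fun t ht h5 h6 => by
      by_cases htl : t = l
      · exact h4.2 (htl ▸ ht)
      · obtain ⟨i₀, g1, g2, g3, -⟩ := ht.exists_least hX
        exact hX.pos_pos g1 h' (by omega) (by omega) (by omega)
    rcases (neg_mem_splitRoots hX).1 h with h | h | ⟨k', h, h5, -⟩
    · exact hX.neg_pos h h' h1 h2
    · exact key u h h1 h2
    · have := hX.bounds h5
      by_cases hkl' : k' ≤ l
      · exact key k' h (by omega) hkl'
      · exact hX.pos_pos h' h5 (by omega) (by omega) (by omega)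
  · obtain ⟨c1, c2, c3, c4⟩ := cutAt_spec X hp hs'.1
    obtain ⟨i₀, g1, g2, -⟩ := hs'.exists_start
    have key : ∀ t, Multi p X t → t ≤ l → t ≤ cutAt p X l := fun t ht h5 => by
      by_cases htl : t = l
      · exact absurd (htl ▸ ht) hs'.not_multi
      · exact c4 t ht (by omega)
    rcases (neg_mem_splitRoots hX).1 h with h | h | ⟨k', h, h5, -⟩
    · exact hX.neg_pos h g1 (by omega) (by omega)
    · have := key u h h2
      omega
    · have := hX.bounds h5
      by_cases hkl' : k' ≤ l
      · have := key k' h hkl'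
        omega
      · exact hX.pos_pos g1 h5 (by omega) (by omega) (by omega)

/-- If `j ≤ j'`, the longest root ending with `α_k` would cross `[j', k']`. Thus the second starts
strictly decrease as `k` increases, which lets the tags of the two halves be matched. -/
theorem Multi.second_lt {k k' j j' : ℕ} (hX : Noncrossing m X) (h : Multi p X k)
    (h' : Multi p X k') (hkk : k < k') (hj : IsSecond (startsAt X k) j)
    (hj' : IsSecond (startsAt X k') j') : j' < j := by
  by_contra hlt
  have h1 := h'.second_le hj'
  have h2 := h.1
  obtain ⟨-, i₀, h3, h4, -⟩ := hj
  exact hX.pos_pos h3 hj'.1 (by omega) (by omega) hkk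

/-- The pairs of first and last indices of the roots in `X` that are replaced. -/
def splitPairs (p : ℕ) (X : Set Lat) : Set (ℕ × ℕ) :=
  {q | rootSum q.1 q.2 ∈ X ∧ ((Single p X q.2 ∧ q.1 ≤ p) ∨ Multi p X q.2)}

open Classical in
/-- What the root `α_i + ⋯ + α_k` is replaced by. -/
noncomputable def splitImage (p : ℕ) (X : Set Lat) (q : ℕ × ℕ) : Lat :=
  if Single p X q.2 then rootSum (cutAt p X q.2 + 1) q.2
  else if ∀ i ∈ startsAt X q.2, q.1 ≤ i then -simpleRoot q.2 else -simpleRoot (q.1 - 1)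

theorem splitImage_injOn (hX : Noncrossing m X) (hp : 1 ≤ p) :
    Set.InjOn (splitImage p X) (splitPairs p X) := by
  -- The images `-α_k` and `-α_{i'-1}` of different kinds cannot agree: for `k = i' - 1` the longest
  -- root `[i₀, k]` would cross the adjoining root `[k+1, k']`.
  have aux : ∀ k i' k', Multi p X k → Multi p X k' → rootSum i' k' ∈ X →
      (¬ ∀ t ∈ startsAt X k', i' ≤ t) → k = i' - 1 → False := by
    intro k i' k' h h' h1 h2 e
    have b := hX.bounds h1
    obtain ⟨i₀, g1, g2, g3, -⟩ := h.exists_least hX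
    have := h.1
    exact hX.pos_pos g1 h1 (by omega) (by omega) (by omega)
  rintro ⟨i, k⟩ ⟨h1, h2⟩ ⟨i', k'⟩ ⟨h1', h2'⟩ e
  simp only at h1 h2 h1' h2'
  unfold splitImage at e
  simp only at e
  by_cases s1 : Single p X k
  · rw [if_pos s1] at e
    by_cases s2 : Single p X k'
    · rw [if_pos s2] at e
      have c := cutAt_spec X hp s1.1
      have c' := cutAt_spec X hp s2.1
      obtain ⟨-, rfl⟩ := rootSum_inj (by omega) (by omega) e
      obtain ⟨t, -, -, ht⟩ := s1.exists_start
      have h3 := (h2.resolve_right s1.not_multi).2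
      have h3' := (h2'.resolve_right s1.not_multi).2
      rw [ht i h1 h3, ht i' h1' h3']
    · rw [if_neg s2] at e
      split_ifs at e <;> exact absurd e (rootSum_ne_neg _ _ _)
  rw [if_neg s1] at e
  by_cases s2 : Single p X k'
  · rw [if_pos s2] at e
    split_ifs at e <;> exact absurd e.symm (rootSum_ne_neg _ _ _)
  rw [if_neg s2] at e
  by_cases l1 : ∀ t ∈ startsAt X k, i ≤ t
  · rw [if_pos l1] at e
    by_cases l2 : ∀ t ∈ startsAt X k', i' ≤ t
    · rw [if_pos l2] at e
      obtain rfl := neg_simpleRoot_inj e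
      rw [le_antisymm (l1 i' h1') (l2 i h1)]
    · rw [if_neg l2] at e
      exact (aux k i' k' (h2.resolve_left fun h => s1 h.1) (h2'.resolve_left fun h => s2 h.1) h1' l2
        (neg_simpleRoot_inj e)).elim
  · rw [if_neg l1] at e
    by_cases l2 : ∀ t ∈ startsAt X k', i' ≤ t
    · rw [if_pos l2] at e
      exact (aux k' i k (h2'.resolve_left fun h => s2 h.1) (h2.resolve_left fun h => s1 h.1) h1 l1
        (neg_simpleRoot_inj e).symm).elim
    rw [if_neg l2] at e
    have hm := h2.resolve_left fun h => s1 h.1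
    have hm' := h2'.resolve_left fun h => s2 h.1
    obtain ⟨i₀, g1, g2, g3, g4⟩ := hm.exists_least hX
    obtain ⟨i₀', g1', g2', g3', g4'⟩ := hm'.exists_least hX
    have b := hX.bounds h1
    have b' := hX.bounds h1'
    have l3 : i₀ < i := by
      by_contra hle
      exact l1 fun t ht => (not_lt.1 hle).trans (g4 t ht)
    have l3' : i₀' < i' := by
      by_contra hle
      exact l2 fun t ht => (not_lt.1 hle).trans (g4' t ht)
    have e' := neg_simpleRoot_inj e
    obtain rfl : i = i' := by omega
    rcases lt_trichotomy k k' with h | h | h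
    · exact (hX.pos_pos g1 h1' l3 (by omega) h).elim
    · rw [h]
    · exact (hX.pos_pos g1' h1 l3' (by omega) h).elim

/-- The roots in `X` that are not replaced. -/
def splitKept (p : ℕ) (X : Set Lat) : Set Lat :=
  {α | α ∈ X ∧ (¬ ∃ k i, Single p X k ∧ i ≤ p ∧ i ≤ k ∧ α = rootSum i k) ∧
      ¬ ∃ k i, Multi p X k ∧ i ≤ k ∧ α = rootSum i k}

theorem splitRoots_eq (hX : Noncrossing m X) :
    splitRoots p X = splitKept p X ∪ splitImage p X '' splitPairs p X := by
  ext α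
  constructor
  · rintro (((h | ⟨k, h1, rfl⟩) | ⟨k, h, rfl⟩) | ⟨k, h, i, h1, ⟨i', h2, h3⟩, rfl⟩)
    · exact Or.inl h
    · obtain ⟨i, h2, h3, -⟩ := h1.exists_start
      exact Or.inr ⟨(i, k), ⟨h2, Or.inl ⟨h1, h3⟩⟩, by rw [splitImage, if_pos h1]⟩
    · obtain ⟨i₀, h2, -, -, h3⟩ := h.exists_least hX
      refine Or.inr ⟨(i₀, k), ⟨h2, Or.inr h⟩, ?_⟩
      rw [splitImage, if_neg (fun hs => hs.not_multi h), if_pos h3]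
    · refine Or.inr ⟨(i, k), ⟨h1, Or.inr h⟩, ?_⟩
      rw [splitImage, if_neg (fun hs => hs.not_multi h), if_neg]
      intro hcon
      have := hcon i' h2
      simp only at this
      omega
  · rintro (h | ⟨⟨i, k⟩, ⟨h1, h2⟩, rfl⟩)
    · exact Or.inl (Or.inl (Or.inl h))
    · unfold splitImage
      simp only at h1 h2 ⊢
      split_ifs with s l
      · exact Or.inl (Or.inl (Or.inr ⟨k, s, rfl⟩))
      · exact Or.inl (Or.inr ⟨k, h2.resolve_left fun h => s h.1, rfl⟩)
      · refine Or.inr ⟨k, h2.resolve_left fun h => s h.1, i, h1, ?_, rfl⟩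
        by_contra hcon
        exact l fun t ht => not_lt.1 fun hlt => hcon ⟨t, ht, hlt⟩

theorem eq_splitKept_union (p : ℕ) (X : Set Lat) :
    X = splitKept p X ∪ (fun q : ℕ × ℕ => rootSum q.1 q.2) '' splitPairs p X := by
  ext α
  constructor
  · intro h
    by_cases h1 : ∃ k i, Single p X k ∧ i ≤ p ∧ i ≤ k ∧ α = rootSum i k
    · obtain ⟨k, i, h2, h3, h4, rfl⟩ := h1
      exact Or.inr ⟨(i, k), ⟨h, Or.inl ⟨h2, h3⟩⟩, rfl⟩
    by_cases h1' : ∃ k i, Multi p X k ∧ i ≤ k ∧ α = rootSum i k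
    · obtain ⟨k, i, h2, h3, rfl⟩ := h1'
      exact Or.inr ⟨(i, k), ⟨h, Or.inr h2⟩, rfl⟩
    exact Or.inl ⟨h, h1, h1'⟩
  · rintro (h | ⟨q, h, rfl⟩)
    · exact h.1
    · exact h.1

theorem splitPairs_finite (hX : Noncrossing m X) : (splitPairs p X).Finite := by
  refine ((Finset.range (m + 1) ×ˢ Finset.range (m + 1)).finite_toSet).subset ?_
  rintro ⟨i, k⟩ ⟨h, -⟩
  have := hX.bounds h
  simp only [Finset.coe_product, Set.mem_prod, Finset.mem_coe, Finset.mem_range]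
  simp only at this
  omega

/-- No new root is also a kept one: each crosses some root of `X`, except for `[p, k]` with `k` of
the type `Single`, which if present in `X` is itself among the roots to be replaced. -/
theorem ncard_splitRoots (hX : Noncrossing m X) (hp : 1 ≤ p) :
    (splitRoots p X).ncard = X.ncard := by
  have hf := splitPairs_finite (p := p) hX
  have hk : (splitKept p X).Finite := hX.finite.subset fun α h => h.1
  conv_rhs => rw [eq_splitKept_union p X]
  rw [splitRoots_eq hX, Set.ncard_union_eq _ hk (hf.image _), Set.ncard_union_eq _ hk (hf.image _),
    (splitImage_injOn hX hp).ncard_image, Set.InjOn.ncard_image]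
  · rintro ⟨i, k⟩ ⟨h1, -⟩ ⟨i', k'⟩ ⟨h2, -⟩ e
    have := rootSum_inj (hX.bounds h1).2.1 (hX.bounds h2).2.1 e
    exact Prod.ext this.1 this.2
  · rw [Set.disjoint_left]
    rintro _ ⟨-, h1, h2⟩ ⟨⟨i, k⟩, ⟨h3, h4⟩, rfl⟩
    have := hX.bounds h3
    rcases h4 with h4 | h4
    · exact h1 ⟨k, i, h4.1, h4.2, this.2.1, rfl⟩
    · exact h2 ⟨k, i, h4, this.2.1, rfl⟩
  · rw [Set.disjoint_left]
    rintro _ ⟨h0, h1, h2⟩ ⟨⟨i, k⟩, ⟨h3, h4⟩, rfl⟩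
    unfold splitImage at h0 h1 h2
    simp only at h0 h1 h2 h3 h4
    have b := hX.bounds h3
    split_ifs at h0 h1 h2 with s l
    · obtain ⟨c1, c2, c3, c4⟩ := cutAt_spec X hp s.1
      by_cases hc : p ≤ cutAt p X k
      · obtain ⟨i₀, g1, g2, g3, -⟩ := (c3 hc).exists_least hX
        exact hX.pos_pos g1 h0 (by omega) le_rfl c2
      · exact h1 ⟨k, _, s, by omega, by omega, rfl⟩
    · exact hX.neg_pos h0 h3 b.2.1 le_rfl
    · have : ∃ t ∈ startsAt X k, t < i := by
        by_contra hcon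
        exact l fun t ht => not_lt.1 fun hlt => hcon ⟨t, ht, hlt⟩
      obtain ⟨t, ht, hti⟩ := this
      have := hX.bounds ht
      exact hX.neg_pos h0 ht (by omega) (by omega)

end split

/-! ### Supports and the flip of the right half -/

theorem supportedIn_rootSum {a b i j : ℕ} (hij : i ≤ j) :
    SupportedIn a b (rootSum i j) ↔ a ≤ i ∧ j ≤ b := by
  simp only [SupportedIn, rootSum_apply]
  constructor
  · intro h
    have h1 := h i (by rw [if_pos ⟨le_rfl, hij⟩]; simp)
    have h2 := h j (by rw [if_pos ⟨hij, le_rfl⟩]; simp)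
    exact ⟨h1.1, h2.2⟩
  · intro h k hk
    have : i ≤ k ∧ k ≤ j := by
      by_contra hcon
      rw [if_neg hcon] at hk
      exact hk rfl
    omega

theorem supportedIn_neg {a b u : ℕ} : SupportedIn a b (-simpleRoot u) ↔ a ≤ u ∧ u ≤ b := by
  simp only [SupportedIn, Pi.neg_apply, simpleRoot_apply]
  constructor
  · intro h
    exact h u (by simp)
  · intro h k hk
    have : k = u := by
      by_contra hcon
      rw [if_neg hcon] at hk
      simp at hk
    rwa [this]

theorem flipRoot_rootSum {n i j : ℕ} (hi : 1 ≤ i) (hij : i ≤ j) (hj : j ≤ n) :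
    flipRoot n (rootSum i j) = rootSum (n - j) (n - i) := by
  ext k
  simp only [flipRoot, rootSum_apply]
  split_ifs <;> omega

theorem flipRoot_neg {n u : ℕ} (hu : 1 ≤ u) (hun : u ≤ n) :
    flipRoot n (-simpleRoot u) = -simpleRoot (n - u) := by
  ext k
  simp only [flipRoot, Pi.neg_apply, simpleRoot_apply]
  split_ifs <;> omega

theorem flipRoot_flipRoot {n : ℕ} {α : Lat} (h : ∀ i, n < i → α i = 0) :
    flipRoot n (flipRoot n α) = α := by
  ext k
  simp only [flipRoot]
  split_ifs with h1 h2
  · congr 1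
    omega
  · omega
  · exact (h k (by omega)).symm

/-- The elements of `S` that involve only `α_1, …, α_{p-1}`. -/
def leftSide (p : ℕ) (S : Set Lat) : Set Lat := {α | α ∈ S ∧ SupportedIn 1 (p - 1) α}

/-- The flipped set of the elements of `S` that involve only `α_p, …, α_{n-1}`. -/
def rightSide (p n : ℕ) (S : Set Lat) : Set Lat :=
  flipRoot n '' {α | α ∈ S ∧ SupportedIn p (n - 1) α}

theorem rightSide_injective {p n : ℕ} {S T : Set Lat} (h : rightSide p n S = rightSide p n T) :
    {α | α ∈ S ∧ SupportedIn p (n - 1) α} = {α | α ∈ T ∧ SupportedIn p (n - 1) α} := by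
  have key : ∀ S : Set Lat, flipRoot n '' rightSide p n S =
      {α | α ∈ S ∧ SupportedIn p (n - 1) α} := by
    intro S
    rw [rightSide, Set.image_image]
    convert Set.image_id _ using 1
    refine Set.image_congr fun α hα => flipRoot_flipRoot fun i hi => ?_
    by_contra hne
    have := hα.2 i hne
    omega
  rw [← key S, ← key T, h]

theorem rightSide_ncard (p n : ℕ) (S : Set Lat) :
    (rightSide p n S).ncard = {α | α ∈ S ∧ SupportedIn p (n - 1) α}.ncard := by
  refine Set.InjOn.ncard_image fun α hα β hβ e => ?_
  have key : ∀ α : Lat, SupportedIn p (n - 1) α → flipRoot n (flipRoot n α) = α :=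
    fun α hα => flipRoot_flipRoot fun i hi => by
      by_contra hne
      have := hα i hne
      omega
  rw [← key α hα.2, ← key β hβ.2, e]

/-! ### Both halves are tagged clusters with equally many root tags -/

section split

variable {p m : ℕ} {X : Set Lat}

theorem exists_of_mem_rightSide {S : Set Lat} (hS : S ⊆ almostPosRoots m) {α : Lat}
    (h : α ∈ rightSide p (m + 1) S) :
    (∃ i j, p ≤ i ∧ i ≤ j ∧ j ≤ m ∧ rootSum i j ∈ S ∧ α = rootSum (m + 1 - j) (m + 1 - i)) ∨
      ∃ u, p ≤ u ∧ u ≤ m ∧ -simpleRoot u ∈ S ∧ α = -simpleRoot (m + 1 - u) := by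
  obtain ⟨β, ⟨h1, h2⟩, rfl⟩ := h
  rcases hS h1 with ⟨i, j, b1, b2, b3, rfl⟩ | ⟨u, b1, b2, rfl⟩
  · rw [supportedIn_rootSum b2] at h2
    exact Or.inl ⟨i, j, h2.1, b2, b3, h1, flipRoot_rootSum b1 b2 (by omega)⟩
  · rw [supportedIn_neg] at h2
    exact Or.inr ⟨u, h2.1, b2, h1, flipRoot_neg b1 (by omega)⟩

theorem rightSide_splitRoots_noncrossing (hX : Noncrossing m X) (hp : 1 ≤ p) :
    Noncrossing (m + 1 - p) (rightSide p (m + 1) (splitRoots p X)) := by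
  have hS := splitRoots_subset hX hp
  have pos : ∀ {a b}, rootSum a b ∈ rightSide p (m + 1) (splitRoots p X) → a ≤ b →
      ∃ i j, p ≤ i ∧ i ≤ j ∧ j ≤ m ∧ rootSum i j ∈ splitRoots p X ∧
        a = m + 1 - j ∧ b = m + 1 - i := by
    intro a b h hab
    rcases exists_of_mem_rightSide hS h with ⟨i, j, b1, b2, b3, h1, e⟩ | ⟨u, -, -, -, e⟩
    · exact ⟨i, j, b1, b2, b3, h1, rootSum_inj hab (by omega) e⟩
    · exact absurd e (rootSum_ne_neg _ _ _)
  refine Noncrossing.of_bounds ?_ ?_ ?_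
  · intro α hα
    rcases exists_of_mem_rightSide hS hα with ⟨i, j, b1, b2, b3, -, rfl⟩ | ⟨u, b1, b2, -, rfl⟩
    · exact rootSum_mem.2 ⟨by omega, by omega, by omega⟩
    · exact neg_mem.2 ⟨by omega, by omega⟩
  · intro a b c d _ h1 _ _ h2 _ h3 h4 c1 c2 c3
    obtain ⟨i, j, b1, b2, b3, h5, rfl, rfl⟩ := pos h3 h1
    obtain ⟨k, l, b1', b2', b3', h6, rfl, rfl⟩ := pos h4 h2
    exact splitRoots_right_pos_pos hX hp b2' b2 b1' h6 h5 (by omega) (by omega) (by omega)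
  · intro v c d _ _ _ h2 _ h3 h4 c1 c2
    obtain ⟨k, l, b1', b2', b3', h6, rfl, rfl⟩ := pos h4 h2
    rcases exists_of_mem_rightSide hS h3 with ⟨i, j, b1, b2, b3, h1, e⟩ | ⟨u, b1, b2, h5, e⟩
    · exact absurd e.symm (rootSum_ne_neg _ _ _)
    · have := neg_simpleRoot_inj e
      exact splitRoots_right_neg_pos hX hp b2' b1' h5 h6 (by omega) (by omega)

theorem leftSide_splitRoots_subset (hX : Noncrossing m X) (hp : 1 ≤ p) :
    leftSide p (splitRoots p X) ⊆ almostPosRoots (p - 1) := by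
  rintro α ⟨h1, h2⟩
  rcases splitRoots_subset hX hp h1 with ⟨i, j, b1, b2, b3, rfl⟩ | ⟨u, b1, b2, rfl⟩
  · rw [supportedIn_rootSum b2] at h2
    exact rootSum_mem.2 ⟨b1, b2, h2.2⟩
  · rw [supportedIn_neg] at h2
    exact neg_mem.2 h2

theorem leftSide_splitRoots_noncrossing (hX : Noncrossing m X) (hp : 1 ≤ p) :
    Noncrossing (p - 1) (leftSide p (splitRoots p X)) := by
  refine Noncrossing.of_bounds (leftSide_splitRoots_subset hX hp) ?_ ?_
  · intro i j k l _ h1 h2 _ h3 h4 h5 h6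
    have h5 := (rootSum_mem_splitRoots hp h1).1 h5.1
    have h6 := (rootSum_mem_splitRoots hp h3).1 h6.1
    rcases h5 with ⟨h5, -⟩ | ⟨h5, -⟩
    · rcases h6 with ⟨h6, -⟩ | ⟨h6, -⟩
      · exact hX.pos_pos h5 h6
      · have := h6.1
        omega
    · have := h5.1
      omega
  · intro u k l _ _ _ h3 h4 h5 h6 h7 h8
    exact splitRoots_left_neg_pos hX hp h3 (by omega) h5.1 h6.1 h7 h8

theorem splitRoots_sides (hX : Noncrossing m X) (hp : 1 ≤ p) {α : Lat}
    (h : α ∈ splitRoots p X) : SupportedIn 1 (p - 1) α ∨ SupportedIn p m α := by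
  rcases splitRoots_subset hX hp h with ⟨i, j, b1, b2, b3, rfl⟩ | ⟨u, b1, b2, rfl⟩
  · rw [supportedIn_rootSum b2, supportedIn_rootSum b2]
    have := splitRoots_left_or_right hp b2 h
    omega
  · rw [supportedIn_neg, supportedIn_neg]
    omega

theorem ncard_sides (hX : Noncrossing m X) (hp : 1 ≤ p) :
    (leftSide p (splitRoots p X)).ncard + (rightSide p (m + 1) (splitRoots p X)).ncard =
      X.ncard := by
  have hf : (splitRoots p X).Finite := (almostPosRoots_finite m).subset (splitRoots_subset hX hp)
  rw [rightSide_ncard, ← ncard_splitRoots hX hp, ← Set.ncard_union_eq ?_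
    (hf.subset fun _ h => h.1) (hf.subset fun _ h => h.1)]
  · congr 1
    ext α
    constructor
    · rintro (h | h)
      · exact h.1
      · exact h.1
    · intro h
      rcases splitRoots_sides hX hp h with h1 | h1
      · exact Or.inl ⟨h, h1⟩
      · exact Or.inr ⟨h, h1⟩
  · rw [Set.disjoint_left]
    rintro α ⟨h1, h2⟩ ⟨-, h3⟩
    rcases splitRoots_subset hX hp h1 with ⟨i, j, b1, b2, b3, rfl⟩ | ⟨u, b1, b2, rfl⟩
    · rw [supportedIn_rootSum b2] at h2 h3
      omega
    · rw [supportedIn_neg] at h2 h3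
      omega

/-- Neither half can exceed its rank, and together they have `m = (p - 1) + (m + 1 - p)` elements,
so both bounds are attained. -/
theorem isCluster_sides (hX : IsCluster m X) (hp : 1 ≤ p) (hpm : p ≤ m + 1) :
    IsCluster (p - 1) (leftSide p (splitRoots p X)) ∧
      IsCluster (m + 1 - p) (rightSide p (m + 1) (splitRoots p X)) := by
  have hN := hX.noncrossing
  have h1 := leftSide_splitRoots_noncrossing hN hp
  have h2 := rightSide_splitRoots_noncrossing hN hp
  have h3 := ncard_sides hN hp
  have h4 := h1.ncard_le
  have h5 := h2.ncard_le
  rw [hX.ncard] at h3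
  exact ⟨h1.isCluster (by omega), h2.isCluster (by omega)⟩

theorem isTaggedCluster_left (hX : IsCluster m X) (hp : 1 ≤ p) (hpm : p ≤ m + 1) (g : Prop) :
    IsTaggedCluster (p - 1) ⟨leftSide p (splitRoots p X), leftSide p (splitTags p X), g⟩ := by
  refine ⟨(isCluster_sides hX hp hpm).1, ?_⟩
  rintro α ⟨h1, h2⟩
  obtain ⟨h3, u, rfl⟩ := splitTags_subset hX.noncrossing h1
  have h4 := supportedIn_neg.1 h2
  exact ⟨⟨h3, h2⟩, u, h4.1, h4.2, rfl⟩

theorem isTaggedCluster_right (hX : IsCluster m X) (hp : 1 ≤ p) (hpm : p ≤ m + 1) (g : Prop) :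
    IsTaggedCluster (m + 1 - p)
      ⟨rightSide p (m + 1) (splitRoots p X), rightSide p (m + 1) (splitTags p X), g⟩ := by
  refine ⟨(isCluster_sides hX hp hpm).2, ?_⟩
  rintro _ ⟨α, ⟨h1, h2⟩, rfl⟩
  obtain ⟨h3, u, rfl⟩ := splitTags_subset hX.noncrossing h1
  have h4 := supportedIn_neg.1 h2
  refine ⟨⟨_, ⟨h3, h2⟩, rfl⟩, m + 1 - u, by omega, by omega, ?_⟩
  exact flipRoot_neg (by omega) (by omega)

/-- Every `Multi` index `k` gives `-α_k` on the right and `-α_{j-1}` on the left, where the second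
start `j` is at most `p`. The left tags are distinct since the second starts strictly decrease. -/
theorem ncard_tags_sides (hX : Noncrossing m X) :
    (leftSide p (splitTags p X)).ncard = (rightSide p (m + 1) (splitTags p X)).ncard := by
  classical
  have hsec : ∀ k, ∃ j, Multi p X k → IsSecond (startsAt X k) j ∧ j ≤ p := fun k => by
    by_cases h : Multi p X k
    · obtain ⟨j, hj⟩ := h.exists_second
      exact ⟨j, fun _ => hj⟩
    · exact ⟨0, fun h' => absurd h' h⟩
  choose sec hsec using hsec
  have h2le : ∀ k, Multi p X k → 2 ≤ sec k := fun k hk => by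
    obtain ⟨-, i, h1, h2, -⟩ := (hsec k hk).1
    have := hX.bounds h1
    omega
  have e1 : leftSide p (splitTags p X) = (fun k => -simpleRoot (sec k - 1)) '' {k | Multi p X k} := by
    ext α
    constructor
    · rintro ⟨⟨k, hk, rfl | ⟨j, hj, rfl⟩⟩, h2⟩
      · have := supportedIn_neg.1 h2
        have := hk.1
        omega
      · exact ⟨k, hk, by simp only; rw [hj.unique (hsec k hk).1]⟩
    · rintro ⟨k, hk, rfl⟩
      have := hsec k hk
      have := h2le k hk
      refine ⟨⟨k, hk, Or.inr ⟨sec k, (hsec k hk).1, rfl⟩⟩, supportedIn_neg.2 ?_⟩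
      omega
  have e2 : {α | α ∈ splitTags p X ∧ SupportedIn p (m + 1 - 1) α} =
      (fun k => -simpleRoot k) '' {k | Multi p X k} := by
    ext α
    constructor
    · rintro ⟨⟨k, hk, rfl | ⟨j, hj, rfl⟩⟩, h2⟩
      · exact ⟨k, hk, rfl⟩
      · have := supportedIn_neg.1 h2
        have := hk.second_le hj
        have := hX.bounds hj.1
        omega
    · rintro ⟨k, hk, rfl⟩
      obtain ⟨i₀, h1, -⟩ := hk.exists_least hX
      have := hX.bounds h1
      exact ⟨⟨k, hk, Or.inl rfl⟩, supportedIn_neg.2 ⟨hk.1, by omega⟩⟩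
  rw [rightSide_ncard, e1, e2, Set.InjOn.ncard_image, Set.InjOn.ncard_image]
  · exact fun k _ k' _ e => neg_simpleRoot_inj e
  · intro k hk k' hk' e
    have e := neg_simpleRoot_inj e
    have h1 := h2le k hk
    have h2 := h2le k' hk'
    rcases lt_trichotomy k k' with h | h | h
    · have := Multi.second_lt hX hk hk' h (hsec k hk).1 (hsec k' hk').1
      omega
    · exact h
    · have := Multi.second_lt hX hk' hk h (hsec k' hk').1 (hsec k hk).1
      omega

end split

/-! ### Injectivity -/

section injective

variable {p m : ℕ} {X Z : Set Lat}

/-- Tags coming from second starts have index below `p`, so the tags of index at least `p` are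
exactly the `Multi` indices. -/
theorem multi_of_tags_eq (hX : Noncrossing m X) (hZ : Noncrossing m Z)
    (hT : splitTags p X = splitTags p Z) {k : ℕ} (h : Multi p X k) : Multi p Z k := by
  have h1 : -simpleRoot k ∈ splitTags p Z := by
    rw [← hT]
    exact (neg_mem_splitTags hX).2 (Or.inl h)
  rcases (neg_mem_splitTags hZ).1 h1 with h2 | ⟨k', h2, h3⟩
  · exact h2
  · have := h2.second_le h3
    have := h.1
    omega

theorem single_of_split_eq (hX : Noncrossing m X) (hZ : Noncrossing m Z) (hp : 1 ≤ p)
    (hR : splitRoots p X = splitRoots p Z) (hT : splitTags p X = splitTags p Z) {k : ℕ}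
    (h : Single p X k) : Single p Z k := by
  obtain ⟨c1, c2, c3, c4⟩ := cutAt_spec X hp h.1
  have h1 : rootSum (cutAt p X k + 1) k ∈ splitRoots p Z := by
    rw [← hR]
    exact (rootSum_mem_splitRoots hp (by omega)).2 (Or.inr ⟨h, rfl⟩)
  rcases (rootSum_mem_splitRoots hp (by omega)).1 h1 with ⟨h2, h3 | h3⟩ | h2
  · have := h.1
    omega
  · obtain ⟨i₀, g1, g2, g3, -⟩ := (multi_of_tags_eq hX hZ hT (c3 (by omega))).exists_least hZ
    exact (hZ.pos_pos g1 h2 (by omega) le_rfl c2).elim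
  · exact h2.1

/-- The left tag `-α_{j'-1}` of `Z` must arise in `X` from some `k'`. By monotonicity in `X`, `k' ≥
k` would give a second start of at most `j < j'`. So `k' < k`, and by induction `j'` is also the
second start at `k'` in `Z`, against strict monotonicity there. -/
theorem second_not_lt (hX : Noncrossing m X) (hZ : Noncrossing m Z)
    (hT : splitTags p X = splitTags p Z) {k j j' : ℕ}
    (ih : ∀ k' < k, Multi p X k' → ∀ j, IsSecond (startsAt X k') j → IsSecond (startsAt Z k') j)
    (h : Multi p X k) (hj : IsSecond (startsAt X k) j) (hj' : IsSecond (startsAt Z k) j') :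
    ¬ j < j' := by
  intro hlt
  have hm := multi_of_tags_eq hX hZ hT h
  have b := hZ.bounds hj'.1
  have h1 : -simpleRoot (j' - 1) ∈ splitTags p X := by
    rw [hT]
    exact ⟨k, hm, Or.inr ⟨j', hj', rfl⟩⟩
  rcases (neg_mem_splitTags hX).1 h1 with h2 | ⟨k', h2, h3⟩
  · have := h2.1
    have := hm.second_le hj'
    omega
  · rw [Nat.sub_add_cancel b.1] at h3
    rcases lt_trichotomy k k' with h4 | h4 | h4
    · have := Multi.second_lt hX h h2 h4 hj h3
      omega
    · subst h4
      have := hj.unique h3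
      omega
    · have := Multi.second_lt hZ (multi_of_tags_eq hX hZ hT h2) hm h4 (ih k' h4 h2 j' h3) hj'
      omega

theorem second_of_tags_eq (hX : Noncrossing m X) (hZ : Noncrossing m Z)
    (hT : splitTags p X = splitTags p Z) {k j : ℕ} (h : Multi p X k)
    (hj : IsSecond (startsAt X k) j) : IsSecond (startsAt Z k) j := by
  induction k using Nat.strong_induction_on generalizing j with
  | _ k ih =>
    have hm := multi_of_tags_eq hX hZ hT h
    obtain ⟨j', hj', -⟩ := hm.exists_second
    have h1 := second_not_lt hX hZ hT (fun k' h1 h2 j h3 => ih k' h1 h2 h3) h hj hj'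
    have h2 := second_not_lt hZ hX hT.symm (fun k' h1 h2 j h3 => by
      have h4 := multi_of_tags_eq hZ hX hT.symm h2
      obtain ⟨s, hs, -⟩ := h4.exists_second
      rwa [h3.unique (ih k' h1 h4 hs)]) hm hj' hj
    rwa [show j = j' by omega]

/-- In the left half, every vertex with a crossing diagonal gets a negative root. -/
theorem neg_mem_splitRoots_of_crossing (hX : IsCluster m X) {i k : ℕ}
    (h : rootSum i k ∈ X) (hi : 2 ≤ i) (hip : i ≤ p) (hpk : p ≤ k) (hpm : p ≤ m + 1) :
    -simpleRoot (i - 1) ∈ splitRoots p X := by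
  have hN := hX.noncrossing
  refine ((isCluster_sides hX (by omega : 1 ≤ p) hpm).1.neg_mem_of_forall (by omega) (by omega)
    fun a b h1 h2 h3 => ?_).1
  have hb := (leftSide_splitRoots_noncrossing hN (by omega : 1 ≤ p)).bounds h1
  rcases (rootSum_mem_splitRoots (by omega) hb.2.1).1 h1.1 with ⟨h4, -⟩ | ⟨h4, -⟩
  · exact hN.pos_pos h4 h (by omega) (by omega) (by omega)
  · have := h4.1
    omega

/-- The left half of `Z`, hence also that of `X`, contains `-α_{i'-1}`. In `X` this root cannot be
original, as it crosses `[i, k]`, so it stems from some `[i', k']`. For `k' > k` this crosses `[i,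
k]`. For `k' ≤ k` the second starts are known to agree, so `Z` has a root ending with `α_{k'}` that
starts before `i'`: it contradicts minimality if `k' = k` and crosses `[i', k]` otherwise. -/
theorem least_not_lt (hX : Noncrossing m X) (hZ : IsCluster m Z) (hpm : p ≤ m + 1)
    (hR : splitRoots p X = splitRoots p Z) (hT : splitTags p X = splitTags p Z) {k i i' : ℕ}
    (hk : p ≤ k) (h : rootSum i k ∈ X) (h' : rootSum i' k ∈ Z)
    (hip' : i' ≤ p) (hmin' : ∀ t ∈ startsAt Z k, i' ≤ t) : ¬ i < i' := by
  intro hlt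
  have hN := hZ.noncrossing
  have b := hX.bounds h
  have b' := hN.bounds h'
  have h1 := neg_mem_splitRoots_of_crossing hZ h' (by omega) hip' hk hpm
  rw [← hR] at h1
  rcases (neg_mem_splitRoots hX).1 h1 with h2 | h2 | ⟨k', h2, h3, t, h4, h5⟩
  · exact hX.neg_pos h2 h (by omega) (by omega)
  · have := h2.1
    omega
  · rw [Nat.sub_add_cancel b'.1] at h3
    have hpk' := h2.1
    obtain ⟨j, hj, -⟩ := h2.exists_second
    have hji := hj.le h3 h4 (by omega)
    have hj' := second_of_tags_eq hX hN hT h2 hj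
    obtain ⟨-, s, h6, h7, -⟩ := hj'
    rcases lt_trichotomy k k' with h8 | h8 | h8
    · exact hX.pos_pos h h3 hlt (by omega) h8
    · subst h8
      have := hmin' s h6
      omega
    · exact hN.pos_pos h6 h' (by omega) (by omega) h8

theorem exists_least_of_crossing {i k : ℕ} (h : rootSum i k ∈ X) (hi : i ≤ p) :
    ∃ i₀, rootSum i₀ k ∈ X ∧ i₀ ≤ p ∧ ∀ t ∈ startsAt X k, i₀ ≤ t := by
  obtain ⟨i₀, h1, h2⟩ := exists_least (I := startsAt X k) ⟨i, h⟩
  exact ⟨i₀, h1, (h2 i h).trans hi, h2⟩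

/-- Roots in the left half are kept. Among the roots across the cut, the longest for a given last
index is determined by `least_not_lt` in both directions, and any other is traced through the root
`-α_{i-1}` it leaves behind. Roots in the right half are kept or traced in the same way. In each
case a wrong origin in `Z` would force a crossing in `X` or `Z`, since `Multi` indices and second
starts agree. -/
theorem subset_of_split_eq (hX : IsCluster m X) (hZ : IsCluster m Z) (hp : 1 ≤ p)
    (hpm : p ≤ m + 1) (hR : splitRoots p X = splitRoots p Z)
    (hT : splitTags p X = splitTags p Z) : X ⊆ Z := by
  have hNX := hX.noncrossing
  have hNZ := hZ.noncrossing
  intro α hα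
  rcases hNX.sub hα with ⟨i, j, b1, b2, b3, rfl⟩ | ⟨u, b1, b2, rfl⟩
  · by_cases hjp : j < p
    · have h1 : rootSum i j ∈ splitRoots p Z := by
        rw [← hR]
        exact (rootSum_mem_splitRoots hp b2).2 (Or.inl ⟨hα, Or.inl hjp⟩)
      rcases (rootSum_mem_splitRoots hp b2).1 h1 with h1 | h1
      · exact h1.1
      · have := h1.1.1
        omega
    by_cases hip : i ≤ p
    · obtain ⟨i₀, g1, g2, g3⟩ := exists_least_of_crossing hα hip
      have hsm := single_or_multi hα hip (by omega)
      by_cases hi : i = i₀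
      · have hex : ∃ t, rootSum t j ∈ Z ∧ t ≤ p := by
          rcases hsm with h | h
          · obtain ⟨t, h1, h2, -⟩ := (single_of_split_eq hNX hNZ hp hR hT h).exists_start
            exact ⟨t, h1, h2⟩
          · obtain ⟨t, h1, -, h2, -⟩ := (multi_of_tags_eq hNX hNZ hT h).exists_least hNZ
            exact ⟨t, h1, h2.le⟩
        obtain ⟨t, h1, h2⟩ := hex
        obtain ⟨i₁, f1, f2, f3⟩ := exists_least_of_crossing h1 h2
        have l1 := least_not_lt hNX hZ hpm hR hT (by omega) g1 f1 f2 f3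
        have l2 := least_not_lt hNZ hX hpm hR.symm hT.symm (by omega) f1 g1 g2 g3
        rwa [hi, show i₀ = i₁ by omega]
      · have hlt : i₀ < i := lt_of_le_of_ne (g3 i hα) (Ne.symm hi)
        have hm : Multi p X j := ⟨by omega, i₀, i, hlt, hip, g1, hα⟩
        have b0 := hNX.bounds g1
        obtain ⟨s, hs, -⟩ := hm.exists_second
        have hs' := second_of_tags_eq hNX hNZ hT hm hs
        have hsi := hs.le hα g1 hlt
        obtain ⟨-, t, f1, f2, -⟩ := hs'
        have h1 : -simpleRoot (i - 1) ∈ splitRoots p Z := by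
          rw [← hR]
          refine (neg_mem_splitRoots hNX).2 (Or.inr (Or.inr ⟨j, hm, ?_, i₀, g1, by omega⟩))
          rwa [Nat.sub_add_cancel b1]
        rcases (neg_mem_splitRoots hNZ).1 h1 with h2 | h2 | ⟨k', h2, h3, t', h4, h5⟩
        · exact (hNZ.neg_pos h2 f1 (by omega) (by omega)).elim
        · have := h2.1
          omega
        · rw [Nat.sub_add_cancel b1] at h3
          rcases lt_trichotomy k' j with h6 | h6 | h6
          · have hk' := multi_of_tags_eq hNZ hNX hT.symm h2
            obtain ⟨s', hs', -⟩ := h2.exists_second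
            have hsi' := hs'.le h3 h4 (by omega)
            obtain ⟨-, t'', f3, f4, -⟩ := second_of_tags_eq hNZ hNX hT.symm h2 hs'
            have := h2.1
            exact (hNX.pos_pos f3 hα (by omega) (by omega) h6).elim
          · rwa [h6] at h3
          · exact (hNZ.pos_pos f1 h3 (by omega) (by omega) h6).elim
    · have hcr : ∀ t, Multi p Z t → i ≤ t + 1 → t < j → False := fun t ht h1 h2 => by
        obtain ⟨i₀, g1, g2, g3, -⟩ := (multi_of_tags_eq hNZ hNX hT.symm ht).exists_least hNX
        exact hNX.pos_pos g1 hα (by omega) h1 h2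
      by_cases hm : Multi p X j
      · obtain ⟨i₀, g1, g2, g3, -⟩ := hm.exists_least hNX
        obtain ⟨i₁, f1, f2, f3, -⟩ := (multi_of_tags_eq hNX hNZ hT hm).exists_least hNZ
        have h1 : -simpleRoot (i - 1) ∈ splitRoots p Z := by
          rw [← hR]
          refine (neg_mem_splitRoots hNX).2 (Or.inr (Or.inr ⟨j, hm, ?_, i₀, g1, by omega⟩))
          rwa [Nat.sub_add_cancel b1]
        rcases (neg_mem_splitRoots hNZ).1 h1 with h2 | h2 | ⟨k', h2, h3, -⟩
        · exact (hNZ.neg_pos h2 f1 (by omega) (by omega)).elim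
        · exact (hcr _ h2 (by omega) (by omega)).elim
        · rw [Nat.sub_add_cancel b1] at h3
          have := hNZ.bounds h3
          rcases lt_trichotomy k' j with h6 | h6 | h6
          · exact (hcr _ h2 (by omega) h6).elim
          · rwa [h6] at h3
          · exact (hNZ.pos_pos f1 h3 (by omega) (by omega) h6).elim
      · have h1 : rootSum i j ∈ splitRoots p Z := by
          rw [← hR]
          exact (rootSum_mem_splitRoots hp b2).2 (Or.inl ⟨hα, Or.inr ⟨by omega, hm⟩⟩)
        rcases (rootSum_mem_splitRoots hp b2).1 h1 with h1 | ⟨h1, h2⟩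
        · exact h1.1
        · obtain ⟨c1, c2, c3, c4⟩ := cutAt_spec Z hp h1.1
          exact (hcr _ (c3 (by omega)) (by omega) c2).elim
  · have h1 : -simpleRoot u ∈ splitRoots p Z := by
      rw [← hR]
      exact (neg_mem_splitRoots hNX).2 (Or.inl hα)
    rcases (neg_mem_splitRoots hNZ).1 h1 with h2 | h2 | ⟨k, h2, h3, t, h4, h5⟩
    · exact h2
    · have := h2.1
      obtain ⟨i₀, g1, g2, g3, -⟩ := (multi_of_tags_eq hNZ hNX hT.symm h2).exists_least hNX
      exact (hNX.neg_pos hα g1 (by omega) le_rfl).elim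
    · have b := hNZ.bounds h3
      have hm := multi_of_tags_eq hNZ hNX hT.symm h2
      obtain ⟨s, hs, -⟩ := h2.exists_second
      have hsu := hs.le h3 h4 (by omega)
      obtain ⟨-, t', f3, f4, -⟩ := second_of_tags_eq hNZ hNX hT.symm h2 hs
      exact (hNX.neg_pos hα f3 (by omega) (by omega)).elim

theorem eq_of_sides_eq (hX : IsCluster m X) (hZ : IsCluster m Z) (hp : 1 ≤ p)
    (hpm : p ≤ m + 1)
    (h1 : leftSide p (splitRoots p X) = leftSide p (splitRoots p Z))
    (h2 : leftSide p (splitTags p X) = leftSide p (splitTags p Z))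
    (h3 : rightSide p (m + 1) (splitRoots p X) = rightSide p (m + 1) (splitRoots p Z))
    (h4 : rightSide p (m + 1) (splitTags p X) = rightSide p (m + 1) (splitTags p Z)) : X = Z := by
  have hNX := hX.noncrossing
  have hNZ := hZ.noncrossing
  have glue : ∀ S T : Set Lat, leftSide p S = leftSide p T →
      rightSide p (m + 1) S = rightSide p (m + 1) T →
      (∀ α ∈ S, SupportedIn 1 (p - 1) α ∨ SupportedIn p m α) → S ⊆ T := by
    intro S T e1 e2 h α hα
    have e3 := rightSide_injective e2
    rcases h α hα with h' | h'
    · have : α ∈ leftSide p T := e1 ▸ ⟨hα, h'⟩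
      exact this.1
    · have : α ∈ {α | α ∈ T ∧ SupportedIn p (m + 1 - 1) α} := e3 ▸ ⟨hα, h'⟩
      exact this.1
  have sx := fun α h => splitRoots_sides (α := α) hNX hp h
  have sz := fun α h => splitRoots_sides (α := α) hNZ hp h
  exact hX.eq_of_subset hZ (subset_of_split_eq hX hZ hp hpm
    ((glue _ _ h1 h3 sx).antisymm (glue _ _ h1.symm h3.symm sz))
    ((glue _ _ h2 h4 fun α h => sx α (splitTags_subset hNX h).1).antisymm
      (glue _ _ h2.symm h4.symm fun α h => sz α (splitTags_subset hNZ h).1)))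

end injective

/-! ### The bra-ket extraction of the layers -/

theorem startSet_eq {m : ℕ} {X : Set Lat} (hX : Noncrossing m X) (k : ℕ) :
    startSet X k = startsAt X k := by
  ext i
  exact ⟨fun h => h.2.2, fun h => ⟨(hX.bounds h).1, (hX.bounds h).2.1, h⟩⟩

theorem eq_of_mem_iff {m : ℕ} {S T : Set Lat} (hS : S ⊆ almostPosRoots m)
    (hT : T ⊆ almostPosRoots m)
    (h1 : ∀ i j, 1 ≤ i → i ≤ j → j ≤ m → (rootSum i j ∈ S ↔ rootSum i j ∈ T))
    (h2 : ∀ u, 1 ≤ u → u ≤ m → (-simpleRoot u ∈ S ↔ -simpleRoot u ∈ T)) : S = T := by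
  ext α
  by_cases h : α ∈ almostPosRoots m
  · rcases h with ⟨i, j, b1, b2, b3, rfl⟩ | ⟨u, b1, b2, rfl⟩
    · exact h1 i j b1 b2 b3
    · exact h2 u b1 b2
  · exact iff_of_false (fun h' => h (hS h')) (fun h' => h (hT h'))

/-! ### The replacement rules in terms of a single cut -/

section replaced

variable {n m : ℕ} {X : Set Lat}

theorem ncard_crossingRoots (hX : Noncrossing m X) (k : ℕ) : (crossingRoots n X k).ncard =
    (startsAt X k ∩ Set.Iic (startBound n k)).ncard := by
  have e : crossingRoots n X k =
      (fun i => rootSum i k) '' (startsAt X k ∩ Set.Iic (startBound n k)) := by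
    ext α
    rw [crossingRoots, startSet_eq hX]
    constructor
    · rintro ⟨i, h1, h2, rfl⟩
      exact ⟨i, ⟨h1, h2⟩, rfl⟩
    · rintro ⟨i, ⟨h1, h2⟩, rfl⟩
      exact ⟨i, h1, h2, rfl⟩
  rw [e, Set.InjOn.ncard_image]
  intro i hi j hj h
  exact (rootSum_inj (hX.bounds hi.1).2.1 (hX.bounds hj.1).2.1 h).1

theorem one_lt_ncard_crossingRoots (hX : Noncrossing m X) (k : ℕ) :
    1 < (crossingRoots n X k).ncard ↔
      ∃ i j, i < j ∧ j ≤ startBound n k ∧ rootSum i k ∈ X ∧ rootSum j k ∈ X := by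
  rw [ncard_crossingRoots hX, Set.one_lt_ncard_iff ((Set.finite_Iic _).inter_of_right _)]
  constructor
  · rintro ⟨i, j, ⟨h1, h2⟩, ⟨h3, h4⟩, hne⟩
    rcases lt_or_gt_of_ne hne with h | h
    · exact ⟨i, j, h, h4, h1, h3⟩
    · exact ⟨j, i, h, h2, h3, h1⟩
  · rintro ⟨i, j, h1, h2, h3, h4⟩
    exact ⟨i, j, ⟨h3, (h1.trans_le h2).le⟩, ⟨h4, h2⟩, h1.ne⟩

/-- Two starts within the bound already rule out both cases of `LeftAlone`. -/
theorem isMultiIndex_iff (hX : Noncrossing (n - 1) X) {k : ℕ} :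
    IsMultiIndex n X k ↔ layerRank n + 1 ≤ k ∧
      ∃ i j, i < j ∧ j ≤ startBound n k ∧ rootSum i k ∈ X ∧ rootSum j k ∈ X := by
  rw [IsMultiIndex, one_lt_ncard_crossingRoots hX]
  constructor
  · rintro ⟨h1, -, -, h2⟩
    exact ⟨h1, h2⟩
  · rintro ⟨h1, i, j, h2, h3, h4, h5⟩
    refine ⟨h1, (hX.bounds h4).2.2, ?_, i, j, h2, h3, h4, h5⟩
    rintro ⟨he, ⟨h6, h7⟩ | ⟨rfl, h7⟩⟩
    · have := h7 i (by rw [startSet_eq hX]; exact h4)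
      have hno := Nat.not_odd_iff_even.2 he
      rw [startBound, if_neg (not_or.2 ⟨hno, by omega⟩)] at h3
      omega
    · rw [startSet_eq hX] at h7
      have e1 : i ∈ ({layerRank n + 1} : Set ℕ) := h7 ▸ h4
      have e2 : j ∈ ({layerRank n + 1} : Set ℕ) := h7 ▸ h5
      rw [Set.mem_singleton_iff] at e1 e2
      omega

theorem isSingleIndex_iff (hX : Noncrossing (n - 1) X) {k : ℕ} :
    IsSingleIndex n X k ↔ layerRank n + 1 ≤ k ∧ ¬ LeftAlone n X k ∧
      ∃ i, startsAt X k ∩ Set.Iic (startBound n k) = {i} := by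
  rw [IsSingleIndex, ncard_crossingRoots hX, Set.ncard_eq_one]
  constructor
  · rintro ⟨h1, -, h2, h3⟩
    exact ⟨h1, h2, h3⟩
  · rintro ⟨h1, h2, i, h3⟩
    have : i ∈ startsAt X k ∩ Set.Iic (startBound n k) := by rw [h3]; rfl
    exact ⟨h1, (hX.bounds this.1).2.2, h2, i, h3⟩

theorem startBound_eq {k : ℕ} (hk : rightStart n ≤ k) : startBound n k = rightStart n := by
  unfold startBound
  unfold rightStart at hk ⊢
  split_ifs at hk ⊢ <;> first | rfl | omega | (exfalso; simp_all)

theorem rightStart_bounds (n : ℕ) :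
    layerRank n + 1 ≤ rightStart n ∧ rightStart n ≤ layerRank n + 2 := by
  unfold rightStart
  split_ifs <;> omega

theorem isMultiIndex_iff_multi (hX : Noncrossing (n - 1) X) {k : ℕ} (hk : rightStart n ≤ k) :
    IsMultiIndex n X k ↔ Multi (rightStart n) X k := by
  rw [isMultiIndex_iff hX, startBound_eq hk, Multi]
  have := rightStart_bounds n
  exact and_congr_left' (iff_of_true (by omega) hk)

theorem isSingleIndex_iff_single (hX : Noncrossing (n - 1) X) {k : ℕ} (hk : rightStart n ≤ k) :
    IsSingleIndex n X k ↔ Single (rightStart n) X k ∧ ¬ LeftAlone n X k := by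
  rw [isSingleIndex_iff hX, startBound_eq hk, Single]
  have := rightStart_bounds n
  constructor
  · rintro ⟨-, h1, h2⟩
    exact ⟨⟨hk, h2⟩, h1⟩
  · rintro ⟨⟨-, h2⟩, h1⟩
    exact ⟨by omega, h1, h2⟩

theorem cutIndex_eq (hX : Noncrossing (n - 1) X) {k : ℕ} (hk : rightStart n ≤ k) :
    cutIndex n X k = cutAt (rightStart n) X k := by
  have e : {t | rightStart n ≤ t ∧ t < k ∧ 1 < (crossingRoots n X t).ncard} =
      {t | Multi (rightStart n) X t ∧ t < k} := by
    ext t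
    simp only [Set.mem_ofPred_eq, one_lt_ncard_crossingRoots hX, Multi]
    constructor
    · rintro ⟨h1, h2, h3⟩
      rw [startBound_eq h1] at h3
      exact ⟨⟨h1, h3⟩, h2⟩
    · rintro ⟨⟨h1, h3⟩, h2⟩
      rw [startBound_eq h1]
      exact ⟨h1, h2, h3⟩
  unfold cutIndex cutAt
  dsimp only
  rw [e]
  by_cases h : {t | Multi (rightStart n) X t ∧ t < k}.Nonempty
  · rw [if_pos h, if_pos h]
  · rw [if_neg h, if_neg h]
    unfold rightStart at hk ⊢
    by_cases ho : Odd n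
    · rw [if_pos (Or.inl ho), if_pos ho, Nat.add_sub_cancel]
    · rw [if_neg ho] at hk ⊢
      rw [if_neg (not_or.2 ⟨ho, by omega⟩)]
      omega

theorem cutIndex_lt {k : ℕ} (hk : layerRank n + 1 ≤ k) :
    cutIndex n X k < k := by
  unfold cutIndex
  simp only
  split_ifs with h1 h2
  · exact (Nat.sSup_mem h1 ⟨k, fun t ht => ht.2.1.le⟩).2.1
  · omega
  · have := fun h => h2 (Or.inr h)
    omega

theorem rootSum_mem_replaced (hX : Noncrossing (n - 1) X) {i j : ℕ} (hij : i ≤ j) :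
    rootSum i j ∈ replaced n X ↔ (rootSum i j ∈ X ∧ ¬ (IsSingleIndex n X j ∧ i ≤ startBound n j) ∧
      ¬ IsMultiIndex n X j) ∨ (IsSingleIndex n X j ∧ i = cutIndex n X j + 1) := by
  constructor
  · rintro (((⟨h1, h2, h3⟩ | ⟨k, h1, e⟩) | ⟨k, -, e⟩) | ⟨k, -, i', -, -, e⟩)
    · have hi : i ∈ startSet X j := by
        rw [startSet_eq hX]
        exact h1
      exact Or.inl ⟨h1, fun h => h2 ⟨j, h.1, i, hi, h.2, rfl⟩, fun h => h3 ⟨j, h, i, hi, rfl⟩⟩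
    · have := cutIndex_lt (X := X) h1.1
      obtain ⟨rfl, rfl⟩ := rootSum_inj hij (by omega) e
      exact Or.inr ⟨h1, rfl⟩
    · exact absurd e (rootSum_ne_neg _ _ _)
    · exact absurd e (rootSum_ne_neg _ _ _)
  · rintro (⟨h1, h2, h3⟩ | ⟨h1, rfl⟩)
    · refine Or.inl (Or.inl (Or.inl ⟨h1, ?_, ?_⟩))
      · rintro ⟨k, h4, i', h5, h6, e⟩
        obtain ⟨rfl, rfl⟩ := rootSum_inj hij h5.2.1 e
        exact h2 ⟨h4, h6⟩
      · rintro ⟨k, h4, i', h5, e⟩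
        obtain ⟨rfl, rfl⟩ := rootSum_inj hij h5.2.1 e
        exact h3 h4
    · exact Or.inl (Or.inl (Or.inr ⟨j, h1, rfl⟩))

theorem neg_mem_replaced (hX : Noncrossing (n - 1) X) {u : ℕ} :
    -simpleRoot u ∈ replaced n X ↔ -simpleRoot u ∈ X ∨ IsMultiIndex n X u ∨
      ∃ k, IsMultiIndex n X k ∧ rootSum (u + 1) k ∈ X ∧ ∃ i, rootSum i k ∈ X ∧ i ≤ u := by
  constructor
  · rintro (((⟨h1, h2, h3⟩ | ⟨k, h1, e⟩) | ⟨k, h, e⟩) | ⟨k, h, i, h1, ⟨i', h2, h3⟩, e⟩)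
    · exact Or.inl h1
    · exact absurd e.symm (rootSum_ne_neg _ _ _)
    · rw [neg_simpleRoot_inj e]
      exact Or.inr (Or.inl h)
    · have := h1.1
      have := neg_simpleRoot_inj e
      obtain rfl : i = u + 1 := by omega
      exact Or.inr (Or.inr ⟨k, h, h1.2.2, i', h2.2.2, by omega⟩)
  · rintro (h | h | ⟨k, h, h1, i, h2, h3⟩)
    · refine Or.inl (Or.inl (Or.inl ⟨h, ?_, ?_⟩))
      · rintro ⟨k, -, i, -, -, e⟩
        exact rootSum_ne_neg _ _ _ e.symm
      · rintro ⟨k, -, i, -, e⟩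
        exact rootSum_ne_neg _ _ _ e.symm
    · exact Or.inl (Or.inr ⟨u, h, rfl⟩)
    · refine Or.inr ⟨k, h, u + 1, ?_, ⟨i, ?_, by omega⟩, by rw [Nat.add_sub_cancel]⟩
      · rw [startSet_eq hX]
        exact h1
      · rw [startSet_eq hX]
        exact h2

theorem replacedTags_eq (hX : Noncrossing (n - 1) X) : replacedTags n X =
    {α | ∃ k, IsMultiIndex n X k ∧ (α = -simpleRoot k ∨
      ∃ j, IsSecond (startsAt X k) j ∧ α = -simpleRoot (j - 1))} := by
  simp only [replacedTags, startSet_eq hX, isSecond_iff_ncard, and_assoc]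

theorem neg_mem_replacedTags (hX : Noncrossing (n - 1) X) {u : ℕ} :
    -simpleRoot u ∈ replacedTags n X ↔ IsMultiIndex n X u ∨
      ∃ k, IsMultiIndex n X k ∧ IsSecond (startsAt X k) (u + 1) := by
  rw [replacedTags_eq hX]
  constructor
  · rintro ⟨k, h, e | ⟨j, hj, e⟩⟩
    · rw [neg_simpleRoot_inj e]
      exact Or.inl h
    · have := hX.bounds hj.1
      have := neg_simpleRoot_inj e
      obtain rfl : j = u + 1 := by omega
      exact Or.inr ⟨k, h, hj⟩
  · rintro (h | ⟨k, h, hj⟩)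
    · exact ⟨u, h, Or.inl rfl⟩
    · exact ⟨k, h, Or.inr ⟨u + 1, hj, by rw [Nat.add_sub_cancel]⟩⟩

theorem replaced_subset (hX : Noncrossing (n - 1) X) :
    replaced n X ⊆ almostPosRoots (n - 1) := by
  rintro α (((⟨h1, -⟩ | ⟨k, h1, rfl⟩) | ⟨k, h, rfl⟩) | ⟨k, h, i, h1, ⟨i', h2, h3⟩, rfl⟩)
  · exact hX.sub h1
  · have := cutIndex_lt (X := X) h1.1
    exact rootSum_mem.2 ⟨by omega, by omega, h1.2.1⟩
  · exact neg_mem.2 ⟨by have := h.1; omega, h.2.1⟩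
  · have := hX.bounds h1.2.2
    have := h2.1
    exact neg_mem.2 ⟨by omega, by omega⟩

theorem replacedTags_subset (hX : Noncrossing (n - 1) X) :
    replacedTags n X ⊆ almostPosRoots (n - 1) := by
  rw [replacedTags_eq hX]
  rintro α ⟨k, hk, rfl | ⟨j, hj, rfl⟩⟩
  · exact neg_mem.2 ⟨by have := hk.1; omega, hk.2.1⟩
  · obtain ⟨h1, i₀, h2, h3, -⟩ := hj
    have := hX.bounds h1
    have := hX.bounds h2
    exact neg_mem.2 ⟨by omega, by omega⟩

theorem rootSum_notMem_replacedTags (i j : ℕ) : rootSum i j ∉ replacedTags n X := by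
  rintro ⟨k, hk, e | ⟨j, -, -, e⟩⟩
  · exact rootSum_ne_neg _ _ _ e
  · exact rootSum_ne_neg _ _ _ e

theorem rootSum_notMem_splitTags (p i j : ℕ) : rootSum i j ∉ splitTags p X := by
  rintro ⟨k, hk, e | ⟨j, -, e⟩⟩
  · exact rootSum_ne_neg _ _ _ e
  · exact rootSum_ne_neg _ _ _ e

theorem not_isMultiIndex_of_lt {k : ℕ} (h : k < layerRank n + 1) : ¬ IsMultiIndex n X k :=
  fun h' => by
    have := h'.1
    omega

theorem not_isSingleIndex_of_lt {k : ℕ} (h : k < layerRank n + 1) : ¬ IsSingleIndex n X k :=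
  fun h' => by
    have := h'.1
    omega

theorem rootSum_mem_replaced_right (hX : Noncrossing (n - 1) X) {i j : ℕ}
    (hij : i ≤ j) (hj : rightStart n ≤ j) :
    rootSum i j ∈ replaced n X ↔ rootSum i j ∈ splitRoots (rightStart n) X := by
  have hb := rightStart_bounds n
  rw [rootSum_mem_replaced hX hij, rootSum_mem_splitRoots (by omega) hij,
    isMultiIndex_iff_multi hX hj, isSingleIndex_iff_single hX hj, startBound_eq hj,
    cutIndex_eq hX hj]
  -- Leaving a root alone is no real exception in the right half: the crossing root is then `[p, j]`
  -- with `p = rightStart n`, no earlier `Multi` index exists since it would cause a crossing, and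
  -- the replacement would be `[p, j]` again.
  have halone : Single (rightStart n) X j → LeftAlone n X j →
      cutAt (rightStart n) X j + 1 = rightStart n ∧ rootSum (rightStart n) j ∈ X ∧
        ∀ t, rootSum t j ∈ X → rightStart n ≤ t := by
    intro hs hl
    obtain ⟨i', g1, g2, g3⟩ := hs.exists_start
    have he := Nat.not_odd_iff_even.2 hl.1
    have hrs : rightStart n = layerRank n + 2 := by rw [rightStart, if_neg he]
    rcases hl.2 with ⟨-, hl⟩ | ⟨hl, -⟩
    · rw [startSet_eq hX] at hl
      have h1 := hl i' g1
      obtain rfl : i' = rightStart n := by omega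
      refine ⟨?_, g1, fun t ht => by have := hl t ht; omega⟩
      obtain ⟨c1, c2, c3, c4⟩ := cutAt_spec X (by omega : 1 ≤ rightStart n) hj
      by_contra hne
      obtain ⟨i₀, f1, f2, f3, -⟩ := (c3 (by omega)).exists_least hX
      exact hX.pos_pos f1 g1 f3 (by omega) c2
    · omega
  constructor
  · rintro (⟨h1, h2, h3⟩ | ⟨h1, h2⟩)
    · by_cases hi : i ≤ rightStart n
      · have hs := (single_or_multi h1 hi hj).resolve_right h3
        have hl : LeftAlone n X j := by
          by_contra hl
          exact h2 ⟨⟨hs, hl⟩, hi⟩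
        obtain ⟨e, -, h4⟩ := halone hs hl
        have := h4 i h1
        exact Or.inr ⟨hs, by omega⟩
      · exact Or.inl ⟨h1, Or.inr ⟨by omega, h3⟩⟩
    · exact Or.inr ⟨h1.1, h2⟩
  · rintro (⟨h1, h2 | h2⟩ | ⟨h1, h2⟩)
    · omega
    · exact Or.inl ⟨h1, fun h => by omega, h2.2⟩
    · by_cases hl : LeftAlone n X j
      · obtain ⟨e, h3, h4⟩ := halone h1 hl
        rw [e] at h2
        subst h2
        exact Or.inl ⟨h3, fun h => h.1.2 hl, h1.not_multi⟩
      · exact Or.inr ⟨⟨h1, hl⟩, h2⟩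

theorem rootSum_mem_replaced_left (hX : Noncrossing (n - 1) X) {i j : ℕ} (hij : i ≤ j)
    (hj : j < layerRank n + 1) : rootSum i j ∈ replaced n X ↔ rootSum i j ∈ X := by
  rw [rootSum_mem_replaced hX hij]
  have h1 := not_isSingleIndex_of_lt (X := X) hj
  have h2 := not_isMultiIndex_of_lt (X := X) hj
  simp [h1, h2]

end replaced

/-! ### The right half of the extraction is that of the cut at `rightStart n` -/

section sides

variable {n : ℕ} {X : Set Lat}

theorem rightPart_eq_of_forall {S T : Set Lat} (hS : S ⊆ almostPosRoots (n - 1))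
    (hT : T ⊆ almostPosRoots (n - 1))
    (h1 : ∀ i j, rightStart n ≤ i → i ≤ j → (rootSum i j ∈ S ↔ rootSum i j ∈ T))
    (h2 : ∀ u, rightStart n ≤ u → (-simpleRoot u ∈ S ↔ -simpleRoot u ∈ T)) :
    rightPart n S = rightSide (rightStart n) n T := by
  have e : {α | α ∈ S ∧ SupportedIn (rightStart n) (n - 1) α} =
      {α | α ∈ T ∧ SupportedIn (rightStart n) (n - 1) α} := by
    refine eq_of_mem_iff (fun α h => hS h.1) (fun α h => hT h.1) (fun i j _ hij _ => ?_)
      (fun u _ _ => ?_)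
    · refine and_congr_left fun h => h1 i j ?_ hij
      exact ((supportedIn_rootSum hij).1 h).1
    · refine and_congr_left fun h => h2 u ?_
      exact (supportedIn_neg.1 h).1
  rw [rightPart, rightSide, e]

theorem rightPart_replaced (hX : Noncrossing (n - 1) X) :
    rightPart n (replaced n X) = rightSide (rightStart n) n (splitRoots (rightStart n) X) := by
  have hb := rightStart_bounds n
  refine rightPart_eq_of_forall (replaced_subset hX) (splitRoots_subset hX (by omega))
    (fun i j hi hij => rootSum_mem_replaced_right hX hij (by omega)) (fun u hu => ?_)
  rw [neg_mem_replaced hX, neg_mem_splitRoots hX, isMultiIndex_iff_multi hX hu]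
  refine or_congr_right (or_congr_right (exists_congr fun k => and_congr_left fun h => ?_))
  have := hX.bounds h.1
  exact isMultiIndex_iff_multi hX (by omega)

theorem splitTags_subset_almostPosRoots {p m : ℕ} (hX : Noncrossing m X) (hp : 1 ≤ p) :
    splitTags p X ⊆ almostPosRoots m :=
  fun _ h => splitRoots_subset hX hp (splitTags_subset hX h).1

theorem rightPart_replacedTags (hX : Noncrossing (n - 1) X) :
    rightPart n (replacedTags n X) = rightSide (rightStart n) n (splitTags (rightStart n) X) := by
  have hb := rightStart_bounds n
  refine rightPart_eq_of_forall (replacedTags_subset hX)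
    (splitTags_subset_almostPosRoots hX (by omega))
    (fun i j _ _ => iff_of_false (rootSum_notMem_replacedTags _ _)
      (rootSum_notMem_splitTags _ _ _)) (fun u hu => ?_)
  rw [neg_mem_replacedTags hX, neg_mem_splitTags hX, isMultiIndex_iff_multi hX hu]
  refine or_congr_right (exists_congr fun k => and_congr_left fun h => ?_)
  have := hX.bounds h.1
  exact isMultiIndex_iff_multi hX (by omega)

theorem subset_almostPosRoots_of_supportedIn {m r : ℕ} {S : Set Lat}
    (hS : S ⊆ almostPosRoots m) : {α | α ∈ S ∧ SupportedIn 1 r α} ⊆ almostPosRoots r := by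
  rintro α ⟨h1, h2⟩
  rcases hS h1 with ⟨i, j, b1, b2, b3, rfl⟩ | ⟨u, b1, b2, rfl⟩
  · exact rootSum_mem.2 ⟨b1, b2, ((supportedIn_rootSum b2).1 h2).2⟩
  · exact neg_mem.2 ⟨b1, (supportedIn_neg.1 h2).2⟩

end sides

/-! ### Odd layers -/

section odd

variable {r : ℕ} {X : Set Lat}

theorem rightStart_odd (r : ℕ) : rightStart (2 * r + 1) = r + 1 := by
  rw [rightStart, if_pos ⟨r, rfl⟩, layerRank_odd]

theorem leftPart_replaced_odd (hX : Noncrossing (2 * r) X) :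
    leftPart (2 * r + 1) (replaced (2 * r + 1) X) = leftSide (r + 1) (splitRoots (r + 1) X) := by
  have hX' : Noncrossing (2 * r + 1 - 1) X := hX
  have hl := layerRank_odd r
  rw [leftPart, leftSide, hl, Nat.add_sub_cancel]
  refine eq_of_mem_iff (m := r) (subset_almostPosRoots_of_supportedIn (replaced_subset hX'))
    (subset_almostPosRoots_of_supportedIn (splitRoots_subset hX (by omega)))
    (fun i j _ hij hj => and_congr_left fun _ => ?_) (fun u _ hu => and_congr_left fun _ => ?_)
  · rw [rootSum_mem_replaced_left hX' hij (by omega), rootSum_mem_splitRoots (by omega) hij]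
    constructor
    · exact fun h => Or.inl ⟨h, Or.inl (by omega)⟩
    · rintro (h | h)
      · exact h.1
      · have := h.1.1
        omega
  · rw [neg_mem_replaced hX', neg_mem_splitRoots hX]
    have key : ∀ k, IsMultiIndex (2 * r + 1) X k ↔ Multi (r + 1) X k := fun k => by
      by_cases hk : r + 1 ≤ k
      · rw [isMultiIndex_iff_multi hX' (by rwa [rightStart_odd]), rightStart_odd]
      · exact iff_of_false (not_isMultiIndex_of_lt (by omega)) fun h => hk h.1
    simp only [key]

theorem leftPart_replacedTags_odd (hX : Noncrossing (2 * r) X) :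
    leftPart (2 * r + 1) (replacedTags (2 * r + 1) X) =
      leftSide (r + 1) (splitTags (r + 1) X) := by
  have hX' : Noncrossing (2 * r + 1 - 1) X := hX
  have hl := layerRank_odd r
  rw [leftPart, leftSide, hl, Nat.add_sub_cancel]
  refine eq_of_mem_iff (m := r) (subset_almostPosRoots_of_supportedIn (replacedTags_subset hX'))
    (subset_almostPosRoots_of_supportedIn (splitTags_subset_almostPosRoots hX (by omega)))
    (fun i j _ hij hj => and_congr_left fun _ => iff_of_false (rootSum_notMem_replacedTags _ _)
      (rootSum_notMem_splitTags _ _ _)) (fun u _ hu => and_congr_left fun _ => ?_)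
  rw [neg_mem_replacedTags hX', neg_mem_splitTags hX]
  have key : ∀ k, IsMultiIndex (2 * r + 1) X k ↔ Multi (r + 1) X k := fun k => by
    by_cases hk : r + 1 ≤ k
    · rw [isMultiIndex_iff_multi hX' (by rwa [rightStart_odd]), rightStart_odd]
    · exact iff_of_false (not_isMultiIndex_of_lt (by omega)) fun h => hk h.1
  simp only [key]

theorem braKet_odd (hX : Noncrossing (2 * r) X) : braKet (2 * r + 1) X =
    (⟨leftSide (r + 1) (splitRoots (r + 1) X), leftSide (r + 1) (splitTags (r + 1) X), False⟩,
      ⟨rightSide (r + 1) (2 * r + 1) (splitRoots (r + 1) X),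
        rightSide (r + 1) (2 * r + 1) (splitTags (r + 1) X), False⟩) := by
  have hX' : Noncrossing (2 * r + 1 - 1) X := hX
  have hne : ¬ Even (2 * r + 1) := Nat.not_even_iff_odd.2 ⟨r, rfl⟩
  unfold braKet
  dsimp only
  rw [leftPart_replaced_odd hX, leftPart_replacedTags_odd hX, rightPart_replaced hX',
    rightPart_replacedTags hX', rightStart_odd]
  simp only [hne, false_and]

theorem mapsTo_braKet_odd (r : ℕ) : Set.MapsTo (braKet (2 * r + 1)) (rootClusters (2 * r + 1))
    (⋃ v, Yc (2 * r + 1) v ×ˢ Yc (2 * r + 1) v) := by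
  intro X hX
  have hX : IsCluster (2 * r) X := hX
  rw [braKet_odd hX.noncrossing]
  refine Set.mem_iUnion.2 ⟨2 * (leftSide (r + 1) (splitTags (r + 1) X)).ncard + 1, ?_, ?_⟩
  · exact mem_Yc_odd.2 ⟨isTaggedCluster_left hX (by omega) (by omega) _, id, rfl⟩
  · refine mem_Yc_odd.2 ⟨?_, id, ?_⟩
    · have := isTaggedCluster_right hX (by omega : 1 ≤ r + 1) (by omega) False
      rwa [(by omega : 2 * r + 1 - (r + 1) = r)] at this
    · rw [ncard_tags_sides hX.noncrossing]

theorem injOn_braKet_odd (r : ℕ) :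
    Set.InjOn (braKet (2 * r + 1)) (rootClusters (2 * r + 1)) := by
  intro X hX Z hZ e
  have hX : IsCluster (2 * r) X := hX
  have hZ : IsCluster (2 * r) Z := hZ
  rw [braKet_odd hX.noncrossing, braKet_odd hZ.noncrossing] at e
  simp only [Prod.mk.injEq, TaggedSet.mk.injEq, and_true] at e
  exact eq_of_sides_eq hX hZ (by omega) (by omega) e.1.1 e.1.2 e.2.1 e.2.2

end odd

/-! ### Even layers -/

section even

variable {r : ℕ} {X Z : Set Lat}

theorem rightStart_even (r : ℕ) : rightStart (2 * r + 2) = r + 2 := by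
  rw [rightStart, if_neg (not_odd_even r), layerRank_even]

/-- The part of the extraction at `α_{r+2}` to the left of that place, with its root tags. -/
def leftTagged (r : ℕ) (X : Set Lat) : TaggedSet :=
  ⟨leftSide (r + 2) (splitRoots (r + 2) X), leftSide (r + 2) (splitTags (r + 2) X), False⟩

theorem isTaggedCluster_leftTagged (hX : IsCluster (2 * r + 1) X) :
    IsTaggedCluster (r + 1) (leftTagged r X) :=
  isTaggedCluster_left hX (by omega) (by omega) _

theorem rootSum_mem_leftTagged {i j : ℕ} (hi : 1 ≤ i) (hij : i ≤ j) (hj : j ≤ r + 1) :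
    rootSum i j ∈ (leftTagged r X).roots ↔ rootSum i j ∈ X := by
  have hs : SupportedIn 1 (r + 2 - 1) (rootSum i j) := (supportedIn_rootSum hij).2 ⟨hi, hj⟩
  refine (and_iff_left hs).trans ?_
  rw [rootSum_mem_splitRoots (by omega) hij]
  constructor
  · rintro (h | h)
    · exact h.1
    · have := h.1.1
      omega
  · exact fun h => Or.inl ⟨h, Or.inl (by omega)⟩

theorem startsAt_leftTagged (hX : IsCluster (2 * r + 1) X) :
    startsAt (leftTagged r X).roots (r + 1) = startsAt X (r + 1) := by
  ext i
  constructor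
  · intro h
    have := startsAt_bounds (isTaggedCluster_leftTagged hX).noncrossing h
    exact (rootSum_mem_leftTagged this.1 this.2.1 le_rfl).1 h
  · intro h
    have := startsAt_bounds hX.noncrossing h
    exact (rootSum_mem_leftTagged this.1 this.2.1 le_rfl).2 h

theorem neg_mem_leftTagged_roots {u : ℕ} (hu : 1 ≤ u) (hur : u ≤ r + 1) :
    -simpleRoot u ∈ (leftTagged r X).roots ↔ -simpleRoot u ∈ splitRoots (r + 2) X :=
  and_iff_left (supportedIn_neg.2 ⟨hu, hur⟩)

theorem neg_mem_leftTagged_tagged {u : ℕ} (hu : 1 ≤ u) (hur : u ≤ r + 1) :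
    -simpleRoot u ∈ (leftTagged r X).tagged ↔ -simpleRoot u ∈ splitTags (r + 2) X :=
  and_iff_left (supportedIn_neg.2 ⟨hu, hur⟩)

theorem startBound_middle (r : ℕ) : startBound (2 * r + 2) (r + 1) = r + 1 := by
  rw [startBound, layerRank_even, if_pos (Or.inr rfl)]

/-- Compared with the cut at `r + 2` there is one additional column, `k = r + 1`. It lies in the
left half and is what `contractTop` will act on. -/
theorem isMultiIndex_even (hX : Noncrossing (2 * r + 1) X) {k : ℕ} :
    IsMultiIndex (2 * r + 2) X k ↔
      (k = r + 1 ∧ ∃ i ∈ startsAt X (r + 1), ∃ j ∈ startsAt X (r + 1), i < j) ∨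
        Multi (r + 2) X k := by
  have hX' : Noncrossing (2 * r + 2 - 1) X := hX
  have hl := layerRank_even r
  have hs := rightStart_even r
  rcases lt_trichotomy k (r + 1) with h | rfl | h
  · refine iff_of_false (not_isMultiIndex_of_lt (by omega)) ?_
    rintro (h' | h')
    · omega
    · have := h'.1
      omega
  · rw [isMultiIndex_iff hX', startBound_middle, hl]
    constructor
    · rintro ⟨-, i, j, h1, -, h3, h4⟩
      exact Or.inl ⟨rfl, i, h3, j, h4, h1⟩
    · rintro (⟨-, i, h3, j, h4, h1⟩ | h')
      · exact ⟨le_rfl, i, j, h1, (hX.bounds h4).2.1, h3, h4⟩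
      · have := h'.1
        omega
  · rw [isMultiIndex_iff_multi hX' (by omega), hs]
    exact (or_iff_right (by omega)).symm

theorem isSingleIndex_middle (hX : Noncrossing (2 * r + 1) X) :
    IsSingleIndex (2 * r + 2) X (r + 1) ↔
      ¬ LeftAlone (2 * r + 2) X (r + 1) ∧ ∃ i, startsAt X (r + 1) = {i} := by
  have hX' : Noncrossing (2 * r + 2 - 1) X := hX
  have e : startsAt X (r + 1) ∩ Set.Iic (r + 1) = startsAt X (r + 1) :=
    Set.inter_eq_left.2 fun i hi => (startsAt_bounds hX hi).2.1
  rw [isSingleIndex_iff hX', startBound_middle, layerRank_even, e]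
  exact and_iff_right le_rfl

theorem cutIndex_middle (r : ℕ) (X : Set Lat) : cutIndex (2 * r + 2) X (r + 1) = r := by
  unfold cutIndex
  dsimp only
  rw [if_neg, if_pos (Or.inr (by rw [layerRank_even])), layerRank_even]
  rintro ⟨t, h1, h2, -⟩
  rw [rightStart_even] at h1
  omega

/-- In the middle column the cut index is `r`, so a single root ending with `α_{r+1}` becomes
`α_{r+1}`; in the left-alone case it is `α_{r+1}` already. -/
theorem simpleRoot_mem_replaced (hX : Noncrossing (2 * r + 1) X) :
    simpleRoot (r + 1) ∈ replaced (2 * r + 2) X ↔ ∃ i, startsAt X (r + 1) = {i} := by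
  have hX' : Noncrossing (2 * r + 2 - 1) X := hX
  rw [← rootSum_self, rootSum_mem_replaced hX' le_rfl, isMultiIndex_even hX,
    isSingleIndex_middle hX, cutIndex_middle, startBound_middle]
  constructor
  · rintro (⟨h1, -, h2⟩ | h)
    · refine ⟨r + 1, Set.Subset.antisymm (fun i hi => ?_) (Set.singleton_subset_iff.2 h1)⟩
      have := startsAt_bounds hX hi
      by_contra hne
      exact h2 (Or.inl ⟨rfl, i, hi, r + 1, h1, lt_of_le_of_ne this.2.1 hne⟩)
    · exact h.1.2
  · rintro ⟨i, hi⟩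
    by_cases hl : LeftAlone (2 * r + 2) X (r + 1)
    · left
      have h1 : startsAt X (r + 1) = {r + 1} := by
        rcases hl.2 with ⟨h, -⟩ | ⟨-, h⟩
        · rw [layerRank_even] at h
          omega
        · rwa [startSet_eq hX, layerRank_even] at h
      refine ⟨?_, fun h => h.1.1 hl, ?_⟩
      · have : r + 1 ∈ startsAt X (r + 1) := by rw [h1]; rfl
        exact this
      · rintro (⟨-, a, ha, b, hb, hab⟩ | h)
        · rw [h1] at ha hb
          rw [ha, hb] at hab
          omega
        · have := h.1
          omega
    · exact Or.inr ⟨⟨hl, i, hi⟩, rfl⟩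

theorem neg_mem_replacedTags_middle (hX : Noncrossing (2 * r + 1) X) :
    -simpleRoot (r + 1) ∈ replacedTags (2 * r + 2) X ↔
      (∃ i ∈ startsAt X (r + 1), ∃ j ∈ startsAt X (r + 1), i < j) ∨
        -simpleRoot (r + 1) ∈ (leftTagged r X).tagged := by
  have hX' : Noncrossing (2 * r + 2 - 1) X := hX
  rw [neg_mem_leftTagged_tagged (by omega) le_rfl, neg_mem_replacedTags hX', neg_mem_splitTags hX]
  simp only [isMultiIndex_even hX, true_and]
  constructor
  · rintro ((h | h) | ⟨k, ⟨rfl, -⟩ | h, h'⟩)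
    · exact Or.inl h
    · exact Or.inr (Or.inl h)
    · have := startsAt_bounds hX h'.1
      omega
    · exact Or.inr (Or.inr ⟨k, h, h'⟩)
  · rintro (h | h | ⟨k, h, h'⟩)
    · exact Or.inl (Or.inl h)
    · exact Or.inl (Or.inr h)
    · exact Or.inr ⟨k, Or.inr h, h'⟩

/-- The replacements in the columns `k ≥ r + 2` give the left half of the cut at `r + 2`, and do not
affect the roots `[i, r+1]`. The replacement in the middle column is then the contraction. -/
theorem leftPart_replaced_even (hX : IsCluster (2 * r + 1) X) :
    leftPart (2 * r + 2) (replaced (2 * r + 2) X) = (contractTop r (leftTagged r X)).roots := by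
  have hN := hX.noncrossing
  have hN' : Noncrossing (2 * r + 2 - 1) X := hN
  have hT := isTaggedCluster_leftTagged hX
  have hl := layerRank_even r
  refine eq_of_mem_iff (m := r) ?_ (contractTop_subset hT.noncrossing) ?_ ?_
  · rw [leftPart, hl]
    exact subset_almostPosRoots_of_supportedIn (replaced_subset hN')
  · intro i j hi hij hj
    have hs : SupportedIn 1 (layerRank (2 * r + 2)) (rootSum i j) :=
      (supportedIn_rootSum hij).2 (by omega)
    refine (and_iff_left hs).trans ?_
    rw [rootSum_mem_replaced_left hN' hij (by omega), rootSum_mem_contractTop hij,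
      rootSum_mem_leftTagged hi hij (by omega)]
    exact (and_iff_left (by omega)).symm
  · intro u hu hur
    have hs : SupportedIn 1 (layerRank (2 * r + 2)) (-simpleRoot u) :=
      supportedIn_neg.2 (by omega)
    refine (and_iff_left hs).trans ?_
    rw [neg_mem_replaced hN', neg_mem_contractTop hT.noncrossing,
      neg_mem_leftTagged_roots hu (by omega), neg_mem_splitRoots hN, startsAt_leftTagged hX]
    simp only [isMultiIndex_even hN]
    constructor
    · rintro (h | (⟨h, -⟩ | h) | ⟨k, ⟨rfl, -⟩ | h, h1, i, h2, h3⟩)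
      · exact Or.inl ⟨Or.inl h, by omega⟩
      · omega
      · have := h.1
        omega
      · exact Or.inr ⟨h1, i, h2, by omega⟩
      · exact Or.inl ⟨Or.inr (Or.inr ⟨k, h, h1, i, h2, h3⟩), by omega⟩
    · rintro (⟨h | h | ⟨k, h, h1⟩, -⟩ | ⟨h1, i, h2, h3⟩)
      · exact Or.inl h
      · exact Or.inr (Or.inl (Or.inr h))
      · exact Or.inr (Or.inr ⟨k, Or.inr h, h1⟩)
      · exact Or.inr (Or.inr ⟨r + 1, Or.inl ⟨rfl, i, h2, u + 1, h1, h3⟩, h1, i, h2, by omega⟩)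

theorem leftPart_replacedTags_even (hX : IsCluster (2 * r + 1) X) :
    leftPart (2 * r + 2) (replacedTags (2 * r + 2) X) =
      (contractTop r (leftTagged r X)).tagged := by
  have hN := hX.noncrossing
  have hN' : Noncrossing (2 * r + 2 - 1) X := hN
  have hT := isTaggedCluster_leftTagged hX
  have hl := layerRank_even r
  refine eq_of_mem_iff (m := r) ?_
    (fun α h => contractTop_subset hT.noncrossing ((isTaggedCluster_contractTop hT).2 h).1) ?_ ?_
  · rw [leftPart, hl]
    exact subset_almostPosRoots_of_supportedIn (replacedTags_subset hN')
  · intro i j hi hij hj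
    refine iff_of_false (fun h => rootSum_notMem_replacedTags _ _ h.1) fun h => ?_
    obtain ⟨u, -, -, e⟩ := ((isTaggedCluster_contractTop hT).2 h).2
    exact rootSum_ne_neg _ _ _ e
  · intro u hu hur
    have hs : SupportedIn 1 (layerRank (2 * r + 2)) (-simpleRoot u) :=
      supportedIn_neg.2 (by omega)
    refine (and_iff_left hs).trans ?_
    rw [neg_mem_replacedTags hN', neg_mem_contractTop_tagged hT,
      neg_mem_leftTagged_tagged hu (by omega), neg_mem_splitTags hN, startsAt_leftTagged hX]
    simp only [isMultiIndex_even hN]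
    constructor
    · rintro ((⟨h, -⟩ | h) | ⟨k, ⟨rfl, -⟩ | h, h1⟩)
      · omega
      · have := h.1
        omega
      · exact Or.inr h1
      · exact Or.inl ⟨Or.inr ⟨k, h, h1⟩, by omega⟩
    · rintro (⟨h | ⟨k, h, h1⟩, -⟩ | h1)
      · exact Or.inl (Or.inr h)
      · exact Or.inr ⟨k, Or.inr h, h1⟩
      · obtain ⟨h2, i, h3, h4, -⟩ := id h1
        exact Or.inr ⟨r + 1, Or.inl ⟨rfl, i, h3, u + 1, h2, h4⟩, h1⟩

/-- The right hand side of the extraction: there is a global tag if and only if `-α_{r+1}` is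
not a root of the left hand side. -/
def rightTagged (r : ℕ) (X : Set Lat) : TaggedSet :=
  ⟨rightSide (r + 2) (2 * r + 2) (splitRoots (r + 2) X),
    rightSide (r + 2) (2 * r + 2) (splitTags (r + 2) X),
    -simpleRoot (r + 1) ∉ (leftTagged r X).roots⟩

theorem ncard_tagged_sides (hX : Noncrossing (2 * r + 1) X) :
    (leftTagged r X).tagged.ncard = (rightTagged r X).tagged.ncard := ncard_tags_sides hX

theorem ncard_tagged_of_mem (hX : IsCluster (2 * r + 1) X)
    (h : -simpleRoot (r + 1) ∈ (leftTagged r X).roots) :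
    tagCount (contractTop r (leftTagged r X)) = (rightTagged r X).tagged.ncard := by
  have hT := isTaggedCluster_leftTagged hX
  rw [← ncard_tagged_phiPlus (isTaggedCluster_contractTop hT), phiPlus_contractTop hT id h,
    ncard_tagged_sides hX.noncrossing]

theorem ncard_tagged_of_notMem (hX : IsCluster (2 * r + 1) X)
    (h : -simpleRoot (r + 1) ∉ (leftTagged r X).roots) :
    tagCount (contractTop r (leftTagged r X)) = (rightTagged r X).tagged.ncard + 1 := by
  have hT := isTaggedCluster_leftTagged hX
  obtain ⟨k, hk, e⟩ := exists_minusLift_contractTop hT id h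
  rw [← ncard_tagged_minusLift (isTaggedCluster_contractTop hT) hk, e,
    ncard_tagged_sides hX.noncrossing]

/-- The halves of the cut carry equally many root tags. Undoing `φ_c^+` preserves the total on the
left and undoing `φ_c^-` raises it by one; the right half gets its global tag precisely in the
second case. -/
theorem tagCount_sides (hX : IsCluster (2 * r + 1) X) :
    tagCount (contractTop r (leftTagged r X)) = tagCount (rightTagged r X) := by
  by_cases h : -simpleRoot (r + 1) ∈ (leftTagged r X).roots
  · rw [ncard_tagged_of_mem hX h, tagCount_of_not_globalTag (not_not.2 h)]
  · rw [ncard_tagged_of_notMem hX h, tagCount_of_globalTag h]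

theorem braKet_even (hX : IsCluster (2 * r + 1) X) :
    braKet (2 * r + 2) X = (contractTop r (leftTagged r X), rightTagged r X) := by
  have hN := hX.noncrossing
  have hN' : Noncrossing (2 * r + 2 - 1) X := hN
  have hT := isTaggedCluster_leftTagged hX
  have heven : Even (2 * r + 2) := Nat.not_odd_iff_even.1 (not_odd_even r)
  have hst := startsAt_leftTagged hX
  have hne := startsAt_nonempty_iff hT.1
  rw [hst] at hne
  have hg : (contractTop r (leftTagged r X)).globalTag ↔
      -simpleRoot (r + 1) ∈ (leftTagged r X).tagged ∨ ∃ i, startsAt X (r + 1) = {i} := by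
    rw [← hst]
    rfl
  have hs := simpleRoot_mem_replaced hN
  have ht := neg_mem_replacedTags_middle hN
  unfold braKet
  dsimp only
  rw [leftPart_replaced_even hX, leftPart_replacedTags_even hX, rightPart_replaced hN',
    rightPart_replacedTags hN', rightStart_even, layerRank_even, hs, ht]
  set C := contractTop r (leftTagged r X) with hC
  have hnt : -simpleRoot (r + 1) ∉ (leftTagged r X).roots →
      -simpleRoot (r + 1) ∉ (leftTagged r X).tagged := fun h h' => h (hT.2 h').1
  -- Four cases: with `-α_{r+1}` in the left half, it is either tagged, and then the contraction
  -- lacks one root tag and gets the global one, or untagged, and there is no global tag. Otherwise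
  -- either one root ends with `α_{r+1}`, and both get a global tag, or several do, and the
  -- contraction has one root tag more, so only the right half gets a global tag.
  have key : ((∃ i, startsAt X (r + 1) = {i}) ∨
      ((∃ i ∈ startsAt X (r + 1), ∃ j ∈ startsAt X (r + 1), i < j) ∨
        -simpleRoot (r + 1) ∈ (leftTagged r X).tagged) ∧
          C.tagged.ncard < (rightTagged r X).tagged.ncard ↔ C.globalTag) ∧
      ((∃ i, startsAt X (r + 1) = {i}) ∨
      ((∃ i ∈ startsAt X (r + 1), ∃ j ∈ startsAt X (r + 1), i < j) ∨
        -simpleRoot (r + 1) ∈ (leftTagged r X).tagged) ∧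
          (rightTagged r X).tagged.ncard < C.tagged.ncard ↔ (rightTagged r X).globalTag) := by
    by_cases hr : -simpleRoot (r + 1) ∈ (leftTagged r X).roots
    · have h0 : startsAt X (r + 1) = ∅ :=
        Set.not_nonempty_iff_eq_empty.1 fun h => hne.1 h hr
      have hcount := ncard_tagged_of_mem hX hr
      have hsing : ¬ ∃ i, startsAt X (r + 1) = {i} := by
        rintro ⟨i, hi⟩
        rw [h0] at hi
        exact (Set.singleton_ne_empty i) hi.symm
      have hpair : ¬ ∃ i ∈ startsAt X (r + 1), ∃ j ∈ startsAt X (r + 1), i < j := by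
        rintro ⟨i, hi, -⟩
        rw [h0] at hi
        exact hi
      have hrg : ¬ (rightTagged r X).globalTag := not_not.2 hr
      by_cases ht' : -simpleRoot (r + 1) ∈ (leftTagged r X).tagged
      · have hCg := hg.2 (Or.inl ht')
        rw [tagCount_of_globalTag hCg] at hcount
        refine ⟨iff_of_true (Or.inr ⟨Or.inr ht', by omega⟩) hCg, iff_of_false ?_ hrg⟩
        rintro (h | h)
        · exact hsing h
        · omega
      · have hCg : ¬ C.globalTag := fun h => (hg.1 h).elim ht' hsing
        exact ⟨iff_of_false (fun h => h.elim hsing fun h => h.1.elim hpair ht') hCg,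
          iff_of_false (fun h => h.elim hsing fun h => h.1.elim hpair ht') hrg⟩
    · have hcount := ncard_tagged_of_notMem hX hr
      have hrg : (rightTagged r X).globalTag := hr
      by_cases hsing : ∃ i, startsAt X (r + 1) = {i}
      · exact ⟨iff_of_true (Or.inl hsing) (hg.2 (Or.inr hsing)), iff_of_true (Or.inl hsing) hrg⟩
      · have hCg : ¬ C.globalTag := fun h => (hg.1 h).elim (hnt hr) hsing
        rw [tagCount_of_not_globalTag hCg] at hcount
        obtain ⟨i, hi, hmin⟩ := exists_least (hne.2 hr)
        have hpair : ∃ i ∈ startsAt X (r + 1), ∃ j ∈ startsAt X (r + 1), i < j := by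
          by_contra hno
          refine hsing ⟨i, Set.Subset.antisymm (fun j hj => ?_) (Set.singleton_subset_iff.2 hi)⟩
          by_contra hji
          exact hno ⟨i, hi, j, hj, lt_of_le_of_ne (hmin j hj) fun e => hji e.symm⟩
        refine ⟨iff_of_false ?_ hCg, iff_of_true (Or.inr ⟨Or.inl hpair, by omega⟩) hrg⟩
        rintro (h | h)
        · exact hsing h
        · omega
  refine Prod.ext (TaggedSet.ext rfl rfl ?_) (TaggedSet.ext rfl rfl ?_)
  · exact propext ((and_iff_right heven).trans key.1)
  · exact propext ((and_iff_right heven).trans key.2)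

/-- The contraction together with the information which edge map undoes it determines the cluster.
In the extraction this information is the global tag of the right half. -/
theorem contractTop_injective {T T' : TaggedSet} (hT : IsTaggedCluster (r + 1) T)
    (hT' : IsTaggedCluster (r + 1) T') (hg : ¬ T.globalTag) (hg' : ¬ T'.globalTag)
    (h : contractTop r T = contractTop r T')
    (h' : -simpleRoot (r + 1) ∈ T.roots ↔ -simpleRoot (r + 1) ∈ T'.roots) : T = T' := by
  by_cases hr : -simpleRoot (r + 1) ∈ T.roots
  · rw [← phiPlus_contractTop hT hg hr, ← phiPlus_contractTop hT' hg' (h'.1 hr), h]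
  · obtain ⟨k, hk, e⟩ := exists_minusLift_contractTop hT hg hr
    obtain ⟨k', hk', e'⟩ := exists_minusLift_contractTop hT' hg' (fun h => hr (h'.2 h))
    rw [← e, ← e', ← phiMinus_even (isTaggedCluster_contractTop hT) hk,
      ← phiMinus_even (isTaggedCluster_contractTop hT') hk', h]

theorem mapsTo_braKet_even (r : ℕ) : Set.MapsTo (braKet (2 * r + 2)) (rootClusters (2 * r + 2))
    (⋃ v, Yc (2 * r + 2) v ×ˢ Yc (2 * r + 2) v) := by
  intro X hX
  have hX : IsCluster (2 * r + 1) X := hX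
  rw [braKet_even hX]
  refine Set.mem_iUnion.2 ⟨2 * tagCount (rightTagged r X), ?_, ?_⟩
  · exact mem_Yc_even.2 ⟨isTaggedCluster_contractTop (isTaggedCluster_leftTagged hX),
      by rw [tagCount_sides hX]⟩
  · refine mem_Yc_even.2 ⟨?_, rfl⟩
    have := isTaggedCluster_right hX (by omega : 1 ≤ r + 2) (by omega)
      (-simpleRoot (r + 1) ∉ (leftTagged r X).roots)
    rwa [(by omega : 2 * r + 1 + 1 - (r + 2) = r)] at this

theorem injOn_braKet_even (r : ℕ) :
    Set.InjOn (braKet (2 * r + 2)) (rootClusters (2 * r + 2)) := by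
  intro X hX Z hZ e
  have hX : IsCluster (2 * r + 1) X := hX
  have hZ : IsCluster (2 * r + 1) Z := hZ
  rw [braKet_even hX, braKet_even hZ, Prod.mk.injEq] at e
  obtain ⟨e1, e2⟩ := e
  have e3 := contractTop_injective (isTaggedCluster_leftTagged hX)
    (isTaggedCluster_leftTagged hZ) id id e1
    (not_iff_not.1 (iff_of_eq (congrArg TaggedSet.globalTag e2)))
  exact eq_of_sides_eq hX hZ (by omega) (by omega) (congrArg TaggedSet.roots e3)
    (congrArg TaggedSet.tagged e3) (congrArg TaggedSet.roots e2) (congrArg TaggedSet.tagged e2)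

end even

/-! ### The bijections -/

theorem mem_rootClusters_zero {X : Set Lat} : X ∈ rootClusters 0 ↔ X = ∅ := isCluster_zero

theorem braKet_zero : braKet 0 ∅ = (⟨∅, ∅, False⟩, ⟨∅, ∅, False⟩) := by
  have hN : Noncrossing (0 - 1) (∅ : Set Lat) :=
    (mem_rootClusters_zero.2 rfl : IsCluster 0 ∅).noncrossing
  have h1 : replaced 0 ∅ = ∅ := Set.subset_eq_empty (replaced_subset hN) almostPosRoots_zero
  have h2 : replacedTags 0 ∅ = ∅ := Set.subset_eq_empty (replacedTags_subset hN) almostPosRoots_zero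
  simp [braKet, h1, h2, leftPart, rightPart]

theorem bijOn_braKet (n : ℕ) :
    Set.BijOn (braKet n) (rootClusters n) (⋃ v, Yc n v ×ˢ Yc n v) := by
  rcases layer_cases n with rfl | ⟨r, rfl⟩ | ⟨r, rfl⟩
  · refine bijOn_of_injOn (fun X hX => ?_) (fun X hX Z hZ _ => ?_)
    · rw [mem_rootClusters_zero.1 hX, braKet_zero]
      exact Set.mem_iUnion.2 ⟨0, mem_Yc_zero.2 ⟨rfl, rfl⟩, mem_Yc_zero.2 ⟨rfl, rfl⟩⟩
    · rw [mem_rootClusters_zero.1 hX, mem_rootClusters_zero.1 hZ]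
  · exact bijOn_of_injOn (mapsTo_braKet_odd r) (injOn_braKet_odd r)
  · exact bijOn_of_injOn (mapsTo_braKet_even r) (injOn_braKet_even r)

end TaggedClusters

theorem mainTheorem12 :
    TaggedClusters.IsPascalArray TaggedClusters.graphAInf 0
      TaggedClusters.Yc TaggedClusters.edgeMap ∧
    TaggedClusters.UnderliesVia TaggedClusters.graphAInf 0
      TaggedClusters.Yc TaggedClusters.Yc
      TaggedClusters.rootClusters TaggedClusters.braKet :=
  ⟨TaggedClusters.isPascalArray_Yc,
    ⟨_, TaggedClusters.isPascalArray_Yc⟩, ⟨_, TaggedClusters.isPascalArray_op_Yc⟩,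
    TaggedClusters.disjoint_pairs, TaggedClusters.bijOn_braKet⟩
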